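/- Let $I$ be a small category, and let $F$ be a covering class of maps in $I$: $F$ is closed under composition, contains all identity maps, and every map $f:i'\to i$ in $F$ admits a pullback along every map $i''\to i$, this pullback again being in $F$. Equip $I$ with the $F$-topology, for which a sieve on $i$ is covering if and only if it contains some map $i'\to i$ in $F$. Let $\mathcal{E}$ be a finitely presentable abelian category, that is, an abelian category that is cocomplete and has a small set of compact (finitely presentable) objects such that every object is a filtered colimit of objects in this set. Let $e:\operatorname{Shv}(I,\mathcal{E})\to\operatorname{Fun}(I^o,\mathcal{E})$ be the embedding of the category of $\mathcal{E}$-valued sheaves on $I$, let $a:\operatorname{Fun}(I^o,\mathcal{E})\to\operatorname{Shv}(I,\mathcal{E})$ be the associated sheaf functor, left adjoint to $e$, and let $R^ne$, $n\ge 0$, be the right derived functors of the left exact functor $e$. For $i\in I$, a hypercovering of $i$ is a simplicial object $X:\Delta^o\to I/i$ such that for every $n\ge 0$ the limit $\operatorname{Hom}(\partial\Delta_n,X)=\lim_{[k]\to[n]\text{ not surjective}}X_k$ exists in $I/i$ and the natural map $X_n\to\operatorname{Hom}(\partial\Delta_n,X)$ is in $F$. Let $\operatorname{HCov}(i)\subset\operatorname{Fun}(\Delta^o,I/i)$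 be the full subcategory spanned by hypercoverings, and let $HC(i)$ be the category with the same objects, whose morphisms are the morphisms of $\operatorname{HCov}(i)$ modulo chain homotopy (two maps are identified if they are connected by a finite chain of simplicial homotopies over $i$, in either direction). For a functor $E:I^o\to\mathcal{E}$ and a hypercovering $X$ of $i$, let $C^\bullet(E(X))$ be the normalized cochain complex of the cosimplicial object $E(X_\bullet)$ of $\mathcal{E}$; its cohomology objects define functors $HC(i)^o\to\mathcal{E}$. The $n$-th Dold-derived functor $D^n(E):I^o\to\mathcal{E}$ is given by $$ D^n(E)(i)=\operatorname{colim}_{X\in HC(i)^o}H^n(C^\bullet(E(X))), $$ where the maps $D^n(E)(i)\to D^n(E)(i')$ for $i'\to i$ are induced by pulling back hypercoverings of $i$ to hypercoverings of $i'$. Then for every $n\ge 0$ there is an isomorphism $$ D^n(E)\cong R^ne(a(E)) $$ in $\operatorname{Fun}(I^o,\mathcal{E})$, functorial in $E\in\operatorname{Fun}(I^o,\mathcal{E})$. -/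

import Mathlib

open CategoryTheory Limits Opposite
open scoped Simplicial

universe w u v

namespace HyperDold

section FinitelyPresentable

variable (E : Type u) [Category.{w} E]

theorem exists_compactGenerator [IsLocallyFinitelyPresentable.{w} E] : ∃ (P : ObjectProperty E), ObjectProperty.Small.{w} P ∧
    (∀ X, P X → IsFinitelyPresentable.{w} X) ∧ P.IsSeparating ∧
    ∀ X : E, ∃ (J : Type w) (_ : SmallCategory J), P.colimitsOfShape J X := by
  have h0 : Fact (Cardinal.aleph0.{w}).IsRegular := Cardinal.fact_isRegular_aleph0
  obtain ⟨P', hP', h'⟩ := HasCardinalFilteredGenerator.exists_generator E Cardinal.aleph0.{w}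
  obtain ⟨P, _, h₁, h₂⟩ := ObjectProperty.EssentiallySmall.exists_small_le P'
  have h : P.IsCardinalFilteredGenerator Cardinal.aleph0.{w} :=
    h'.of_le_isoClosure h₂ (h₁.trans h'.le_isCardinalPresentable)
  refine ⟨P, inferInstance, fun X hX => h.le_isCardinalPresentable X hX,
    h.isStrongGenerator.isSeparating, fun X => ?_⟩
  obtain ⟨J, i, _, hJ⟩ := h.exists_colimitsOfShape X
  exact ⟨J, i, hJ⟩

instance hasColimits_of_lfp [IsLocallyFinitelyPresentable.{w} E] : HasColimitsOfSize.{w, w} E :=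
  IsCardinalLocallyPresentable.toHasColimitsOfSize Cardinal.aleph0.{w}

instance isGrothendieckAbelian_of_lfp [Abelian E] [IsLocallyFinitelyPresentable.{w} E] :
    IsGrothendieckAbelian.{w} E where
  hasFilteredColimitsOfSize := inferInstance
  ab5OfSize := by
    obtain ⟨P, _, hP, hs, _⟩ := exists_compactGenerator E
    refine ⟨fun K _ _ => ?_⟩
    have : (colim (J := K) (C := E)).PreservesMonomorphisms := by
      refine ⟨fun {A B} α hα => ?_⟩
      rw [hs.mono_iff]
      intro G hG g₁ g₂ h
      have := hP G hG
      obtain ⟨j₁, f₁, rfl⟩ :=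
        IsFinitelyPresentable.exists_hom_of_isColimit (colimit.isColimit A) g₁
      obtain ⟨j₂, f₂, rfl⟩ :=
        IsFinitelyPresentable.exists_hom_of_isColimit (colimit.isColimit A) g₂
      obtain ⟨k, u, v, e⟩ := IsFinitelyPresentable.exists_eq_of_isColimit (colimit.isColimit B)
        (f₁ ≫ α.app j₁) (f₂ ≫ α.app j₂) (by simpa using h)
      have e' : f₁ ≫ A.map u = f₂ ≫ A.map v := by
        rw [← cancel_mono (α.app k)]
        simpa using e
      have := congr($e' ≫ colimit.ι A k)
      simpa using this
    exact hasExactColimitsOfShape_of_preservesMono E K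
  hasSeparator := by
    obtain ⟨P, _, hP, hs, _⟩ := exists_compactGenerator E
    let f : Shrink.{w} (Subtype P) → E := fun x => ((equivShrink _).symm x).1
    refine ⟨∐ f, (isSeparator_sigma f).2 (hs.of_le fun X hX => ?_)⟩
    exact (ObjectProperty.ofObj_iff _ _).2 ⟨equivShrink _ ⟨X, hX⟩, by simp [f]⟩

variable {I : Type w} [SmallCategory I] (J : GrothendieckTopology I)

theorem isSheaf_of_compactGenerator {P : ObjectProperty E}
    (hP : ∀ X : E, ∃ (K : Type w) (_ : SmallCategory K), P.colimitsOfShape K X)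
    (Q : Iᵒᵖ ⥤ E) (hQ : ∀ G, P G → Presieve.IsSheaf J (Q ⋙ coyoneda.obj (op G))) :
    Presheaf.IsSheaf J Q := by
  intro X U S hS x hx
  obtain ⟨K, _, ⟨p⟩⟩ := hP X
  have hG (k : K) := hQ _ (p.prop_diag_obj k)
  have hc (k : K) : Presieve.FamilyOfElements.Compatible
      (P := Q ⋙ coyoneda.obj (op (p.diag.obj k))) (R := S.arrows)
      (fun Y f hf => p.ι.app k ≫ x f hf) := by
    intro Y₁ Y₂ Z g₁ g₂ f₁ f₂ h₁ h₂ e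
    have h : x f₁ h₁ ≫ Q.map g₁.op = x f₂ h₂ ≫ Q.map g₂.op := hx g₁ g₂ h₁ h₂ e
    change (p.ι.app k ≫ x f₁ h₁) ≫ Q.map g₁.op = (p.ι.app k ≫ x f₂ h₂) ≫ Q.map g₂.op
    rw [Category.assoc, Category.assoc, h]
  let t (k : K) : p.diag.obj k ⟶ Q.obj (op U) := (hG k S hS).amalgamate _ (hc k)
  have ht (k : K) {Y : I} (f : Y ⟶ U) (hf : S f) : t k ≫ Q.map f.op = p.ι.app k ≫ x f hf :=
    (hG k S hS).valid_glue (hc k) f hf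
  have hsep (k : K) (a b : p.diag.obj k ⟶ Q.obj (op U))
      (h : ∀ {Y : I} (f : Y ⟶ U), S f → a ≫ Q.map f.op = b ≫ Q.map f.op) : a = b :=
    (hG k S hS).isSeparatedFor.ext fun Y f hf => h f hf
  obtain ⟨d, hd⟩ : ∃ d : X ⟶ Q.obj (op U), ∀ k, p.ι.app k ≫ d = t k := by
    refine ⟨p.isColimit.desc ⟨_, ⟨t, ?_⟩⟩, fun k => p.isColimit.fac _ k⟩
    intro k l u
    refine hsep _ _ _ fun f hf => ?_
    simp [ht _ f hf]
  refine ⟨d, ?_, ?_⟩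
  · intro Y f hf
    refine p.isColimit.hom_ext fun k => ?_
    change p.ι.app k ≫ d ≫ Q.map f.op = p.ι.app k ≫ x f hf
    rw [← Category.assoc, hd, ht]
  · intro y hy
    refine p.isColimit.hom_ext fun k => ?_
    refine hsep _ _ _ fun f hf => ?_
    have h : y ≫ Q.map f.op = x f hf := hy f hf
    change (p.ι.app k ≫ y) ≫ Q.map f.op = (p.ι.app k ≫ d) ≫ Q.map f.op
    rw [Category.assoc, h, hd, ht]

variable [Abelian E] [IsLocallyFinitelyPresentable.{w} E]

theorem sheafify_isSheaf_of_lfp (Q : Iᵒᵖ ⥤ E) : Presheaf.IsSheaf J (J.sheafify Q) := by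
  obtain ⟨P, _, hP, _, hc⟩ := exists_compactGenerator E
  refine isSheaf_of_compactGenerator E J hc _ fun G hG => ?_
  have := hP G hG
  have (X : I) : PreservesColimitsOfShape (J.Cover X)ᵒᵖ (coyoneda.obj (op G)) :=
    PreservesFilteredColimitsOfSize.preserves_filtered_colimits _
  refine Presieve.isSheaf_iso J (J.sheafifyCompIso (coyoneda.obj (op G)) Q).symm ?_
  rw [← isSheaf_iff_isSheaf_of_type]
  exact J.sheafify_isSheaf _

instance preservesFiniteLimits_plusFunctor_of_lfp : PreservesFiniteLimits (J.plusFunctor E) := by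
  refine ⟨fun K _ _ => preservesLimitsOfShape_of_evaluation _ _ fun X => ?_⟩
  have : PreservesLimitsOfShape K (J.diagramFunctor E X.unop ⋙ colim) := inferInstance
  exact this

/-- The associated sheaf functor exists for every Grothendieck topology on a small category,
with values in a locally finitely presentable abelian category, and it is exact. -/
instance hasSheafify_of_lfp : HasSheafify J E :=
  let F : (Iᵒᵖ ⥤ E) ⥤ Sheaf J E :=
    { obj P := ⟨J.sheafify P, sheafify_isSheaf_of_lfp E J P⟩
      map η := ⟨J.sheafifyMap η⟩ }
  have : PreservesFiniteLimits (F ⋙ sheafToPresheaf J E) :=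
    comp_preservesFiniteLimits (J.plusFunctor E) (J.plusFunctor E)
  have : PreservesFiniteLimits F :=
    preservesFiniteLimits_of_reflects_of_preserves F (sheafToPresheaf J E)
  HasSheafify.mk' J E (F := F) <| Adjunction.mkOfHomEquiv
    { homEquiv := fun P Q =>
        { toFun := fun e => J.toSheafify P ≫ e.hom
          invFun := fun e => ⟨J.sheafifyLift e Q.2⟩
          left_inv := fun _ => Sheaf.hom_ext <| (J.sheafifyLift_unique _ _ _ rfl).symm
          right_inv := fun _ => J.toSheafify_sheafifyLift _ _ }
      homEquiv_naturality_left_symm := by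
        intro P Q R η γ; ext1; dsimp; symm
        apply J.sheafifyMap_sheafifyLift
      homEquiv_naturality_right := fun η γ => by
        dsimp
        rw [Category.assoc] }


end FinitelyPresentable
/-- The topology defined by a class `F` of maps that contains the identities, is closed under
compositions, and has and is stable under pullbacks: a sieve on `X` is covering if and only if it
contains some map `Y ⟶ X` in `F`. -/
def topology {I : Type u} [Category.{v} I] (F : MorphismProperty I) [F.IsMultiplicative] [F.HasPullbacks]
    [F.IsStableUnderBaseChange] : GrothendieckTopology I where
  sieves X := {S | ∃ (Y : I) (f : Y ⟶ X), F f ∧ S f}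
  top_mem' X := ⟨X, 𝟙 X, F.id_mem X, trivial⟩
  pullback_stable' := by
    rintro X Y S g ⟨Z, f, hf, hS⟩
    have := F.hasPullback g hf
    refine ⟨_, pullback.snd f g, F.pullback_snd _ _ hf, ?_⟩
    change S (pullback.snd f g ≫ g)
    rw [← pullback.condition]
    exact S.downward_closed hS _
  transitive' := by
    rintro X S ⟨Y, f, hf, hS⟩ R h
    obtain ⟨Z, g, hg, hR⟩ := h hS
    exact ⟨Z, g ≫ f, F.comp_mem _ _ hg hf, hR⟩

section Matching
variable {C : Type u} [Category.{v} C]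

/-- The boundary `∂Δ_n ⊂ Δ_n`, as the sieve on `[n]` of all maps that are not surjective. -/
def boundary (n : ℕ) : Sieve ⦋n⦌ where
  arrows _ f := ¬ Epi f
  downward_closed {_ _ f} hf g := fun _ => hf (epi_of_epi g f)

/-- For a simplicial subset `S ⊂ Δ_n` (a sieve on `[n]`), the diagram `([k] ⟶ [n]) ↦ X_k`, indexed
by the opposite of the category of simplices of `S`, whose limit is `Hom(S, X)`. -/
abbrev sieveDiagram (X : SimplicialObject C) {n : ℕ} (S : Sieve ⦋n⦌) :
    (S.arrows.category)ᵒᵖ ⥤ C :=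
  S.arrows.diagram.op ⋙ X

/-- The canonical cone on `X_n` over the diagram that defines `Hom(S, X)`. -/
@[simps]
def sieveCone (X : SimplicialObject C) {n : ℕ} (S : Sieve ⦋n⦌) : Cone (sieveDiagram X S) where
  pt := X.obj (op ⦋n⦌)
  π := { app := fun f => X.map f.unop.obj.hom.op
         naturality := fun f g u => by
          simp [← X.map_comp, ← op_comp] }

/-- The canonical map `X_n ⟶ Hom(S, X)`, for any chosen limit `c` that represents `Hom(S, X)`. -/
def matchingMap {X : SimplicialObject C} {n : ℕ} {S : Sieve ⦋n⦌} {c : Cone (sieveDiagram X S)}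
    (hc : IsLimit c) : X.obj (op ⦋n⦌) ⟶ c.pt :=
  hc.lift (sieveCone X S)

/-- For every `n ≥ 0`, the limit `Hom(∂Δ_n, X)` exists in `C`, and the canonical map
`X_n ⟶ Hom(∂Δ_n, X)` is in `P`. -/
def IsReedy (P : MorphismProperty C) (X : SimplicialObject C) : Prop :=
  ∀ n : ℕ, ∃ (c : Cone (sieveDiagram X (boundary n))) (hc : IsLimit c),
    P (matchingMap hc)

/-- The component at `f : [k] ⟶ [n]` of a cone over `sieveDiagram X S`. -/
def proj {X : SimplicialObject C} {n : ℕ} {S : Sieve ⦋n⦌} (c : Cone (sieveDiagram X S))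
    {k : SimplexCategory} (f : k ⟶ ⦋n⦌) (hf : S f) : c.pt ⟶ X.obj (op k) :=
  c.π.app (op (S.arrows.categoryMk f hf))

theorem proj_w {X : SimplicialObject C} {n : ℕ} {S : Sieve ⦋n⦌}
    (c : Cone (sieveDiagram X S)) {k l : SimplexCategory} (f : k ⟶ ⦋n⦌) (hf : S f) (g : l ⟶ k)
    (h : l ⟶ ⦋n⦌) (hh : S h) (e : g ≫ f = h) :
    proj c f hf ≫ X.map g.op = proj c h hh := by
  subst e
  let u : S.arrows.categoryMk (g ≫ f) hh ⟶ S.arrows.categoryMk f hf :=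
    ObjectProperty.homMk (Over.homMk g)
  exact c.w u.op

theorem proj_hom_ext {X : SimplicialObject C} {n : ℕ} {S : Sieve ⦋n⦌}
    {c : Cone (sieveDiagram X S)} (hc : IsLimit c) {T : C} {a b : T ⟶ c.pt}
    (h : ∀ {k : SimplexCategory} (f : k ⟶ ⦋n⦌) (hf : S f), a ≫ proj c f hf = b ≫ proj c f hf) :
    a = b :=
  hc.hom_ext fun f => h f.unop.obj.hom f.unop.property

/-- A cone over `sieveDiagram X S` given by a compatible family of morphisms. -/
def coneOfFamily (X : SimplicialObject C) {n : ℕ} (S : Sieve ⦋n⦌) (T : C)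
    (x : ∀ {k : SimplexCategory} (f : k ⟶ ⦋n⦌), S f → (T ⟶ X.obj (op k)))
    (hx : ∀ {k l : SimplexCategory} (f : k ⟶ ⦋n⦌) (hf : S f) (g : l ⟶ k),
      x f hf ≫ X.map g.op = x (g ≫ f) (S.downward_closed hf g)) :
    Cone (sieveDiagram X S) where
  pt := T
  π := { app := fun f => x f.unop.obj.hom f.unop.property
         naturality := fun f g u => by
          have e : u.unop.hom.left ≫ f.unop.obj.hom = g.unop.obj.hom := Over.w u.unop.hom
          have := hx f.unop.obj.hom f.unop.property u.unop.hom.left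
          dsimp at this ⊢
          rw [Category.id_comp]
          simp only [e] at this
          exact this.symm }

theorem matchingMap_proj {X : SimplicialObject C} {n : ℕ} {S : Sieve ⦋n⦌}
    {c : Cone (sieveDiagram X S)} (hc : IsLimit c) {k : SimplexCategory} (f : k ⟶ ⦋n⦌)
    (hf : S f) : matchingMap hc ≫ proj c f hf = X.map f.op :=
  hc.fac _ _

theorem exists_lift {X : SimplicialObject C} {n : ℕ} {S : Sieve ⦋n⦌}
    {c : Cone (sieveDiagram X S)} (hc : IsLimit c) {T : C}
    (x : ∀ {k : SimplexCategory} (f : k ⟶ ⦋n⦌), S f → (T ⟶ X.obj (op k)))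
    (hx : ∀ {k l : SimplexCategory} (f : k ⟶ ⦋n⦌) (hf : S f) (g : l ⟶ k),
      x f hf ≫ X.map g.op = x (g ≫ f) (S.downward_closed hf g)) :
    ∃ t : T ⟶ c.pt, ∀ {k : SimplexCategory} (f : k ⟶ ⦋n⦌) (hf : S f),
      t ≫ proj c f hf = x f hf :=
  ⟨hc.lift (coneOfFamily X S T x hx), fun _ _ => hc.fac _ _⟩

theorem exists_isLimit {X : SimplicialObject C} {n : ℕ} {S : Sieve ⦋n⦌} (M : C)
    (x : ∀ {k : SimplexCategory} (f : k ⟶ ⦋n⦌), S f → (M ⟶ X.obj (op k)))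
    (hx : ∀ {k l : SimplexCategory} (f : k ⟶ ⦋n⦌) (hf : S f) (g : l ⟶ k),
      x f hf ≫ X.map g.op = x (g ≫ f) (S.downward_closed hf g))
    (hl : ∀ (s : Cone (sieveDiagram X S)), ∃ t : s.pt ⟶ M,
      ∀ {k : SimplexCategory} (f : k ⟶ ⦋n⦌) (hf : S f), t ≫ x f hf = proj s f hf)
    (hu : ∀ {T : C} (a b : T ⟶ M), (∀ {k : SimplexCategory} (f : k ⟶ ⦋n⦌) (hf : S f),
      a ≫ x f hf = b ≫ x f hf) → a = b) :
    Nonempty (IsLimit (coneOfFamily X S M x hx)) := by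
  choose t ht using hl
  exact ⟨{ lift := t
           fac := fun s f => ht s f.unop.obj.hom f.unop.property
           uniq := fun s q hq => hu _ _ fun f hf =>
            (hq (op (S.arrows.categoryMk f hf))).trans (ht s f hf).symm }⟩

theorem exists_limit_step {P : MorphismProperty C} [P.HasPullbacks]
    [P.IsStableUnderBaseChange] {X : SimplicialObject C} (hX : IsReedy P X)
    {n : ℕ} (S₀ S₁ : Sieve ⦋n⦌) {k : ℕ} (m : ⦋k⦌ ⟶ ⦋n⦌) [Mono m] (hm : ¬ S₀ m)
    (hb : ∀ {l : SimplexCategory} (g : l ⟶ ⦋k⦌), boundary k g → S₀ (g ≫ m))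
    (h₁ : ∀ {l : SimplexCategory} (f : l ⟶ ⦋n⦌), S₁ f ↔ S₀ f ∨ ∃ g, g ≫ m = f)
    (c₀ : Cone (sieveDiagram X S₀)) (hc₀ : IsLimit c₀) :
    ∃ (c₁ : Cone (sieveDiagram X S₁)) (_ : IsLimit c₁) (r : c₁.pt ⟶ c₀.pt), P r := by
  obtain ⟨b, hb', hP⟩ := hX k
  obtain ⟨ρ, hρ⟩ : ∃ ρ : c₀.pt ⟶ b.pt, ∀ {l : SimplexCategory} (g : l ⟶ ⦋k⦌) (hg : boundary k g),
      ρ ≫ proj b g hg = proj c₀ (g ≫ m) (hb g hg) :=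
    exists_lift hb' (fun g hg => proj c₀ (g ≫ m) (hb g hg))
      (fun f hf g => proj_w c₀ _ _ _ _ _ (Category.assoc _ _ _).symm)
  obtain ⟨lam, hP, hlam⟩ : ∃ lam : X.obj (op ⦋k⦌) ⟶ b.pt, P lam ∧
      ∀ {l : SimplexCategory} (g : l ⟶ ⦋k⦌) (hg : boundary k g),
        lam ≫ proj b g hg = X.map g.op :=
    ⟨_, hP, fun g hg => hb'.fac _ _⟩
  have := P.hasPullback ρ hP
  have hsec {l : SimplexCategory} (g : l ⟶ ⦋k⦌) (hg : S₀ (g ≫ m)) : boundary k g := by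
    intro h
    have := isSplitEpi_of_epi g
    exact hm (by simpa using S₀.downward_closed hg (section_ g))
  have key {l : SimplexCategory} (g : l ⟶ ⦋k⦌) (hg : S₀ (g ≫ m)) :
      pullback.snd lam ρ ≫ proj c₀ (g ≫ m) hg = pullback.fst lam ρ ≫ X.map g.op := by
    rw [← hlam g (hsec g hg), ← hρ g (hsec g hg), pullback.condition_assoc]
  classical
  let x {l : SimplexCategory} (f : l ⟶ ⦋n⦌) (hf : S₁ f) : pullback lam ρ ⟶ X.obj (op l) :=
    if h : S₀ f then pullback.snd lam ρ ≫ proj c₀ f h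
    else pullback.fst lam ρ ≫ X.map (((h₁ f).1 hf).resolve_left h).choose.op
  have x₀ {l : SimplexCategory} (f : l ⟶ ⦋n⦌) (hf : S₁ f) (h : S₀ f) :
      x f hf = pullback.snd lam ρ ≫ proj c₀ f h := dif_pos h
  have x₁ {l : SimplexCategory} (g : l ⟶ ⦋k⦌) (hf : S₁ (g ≫ m)) :
      x (g ≫ m) hf = pullback.fst lam ρ ≫ X.map g.op := by
    by_cases h : S₀ (g ≫ m)
    · rw [x₀ _ hf h, key]
    · have e := (((h₁ _).1 hf).resolve_left h).choose_spec
      rw [cancel_mono] at e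
      simp only [x, dif_neg h, e]
  have hS {l : SimplexCategory} (f : l ⟶ ⦋n⦌) (h : S₀ f) : S₁ f := (h₁ f).2 (.inl h)
  have hmS : S₁ m := (h₁ m).2 (.inr ⟨𝟙 _, by simp⟩)
  have xm : x m hmS = pullback.fst lam ρ := by
    have := x₁ (𝟙 _) (by simpa using hmS)
    simpa using this
  obtain ⟨hc₁⟩ := exists_isLimit (X := X) (S := S₁) (pullback lam ρ) x (by
    intro l l' f hf g
    by_cases h : S₀ f
    · rw [x₀ f hf h, x₀ (g ≫ f) (S₁.downward_closed hf g) (S₀.downward_closed h g), Category.assoc,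
        proj_w c₀ f h g _ _ rfl]
    · obtain ⟨f', rfl⟩ := ((h₁ _).1 hf).resolve_left h
      have := x₁ (g ≫ f') (by simpa using S₁.downward_closed hf g)
      simp only [Category.assoc] at this
      rw [this, x₁ f' hf]
      simp) (by
    intro s
    obtain ⟨t, ht⟩ := exists_lift hc₀ (fun f hf => proj s f (hS f hf))
      (fun f hf g => proj_w s _ _ _ _ _ rfl)
    have hcond : proj s m hmS ≫ lam = t ≫ ρ := by
      refine proj_hom_ext hb' fun g hg => ?_
      rw [Category.assoc, Category.assoc, hlam, hρ, ht]
      exact proj_w s m hmS g _ _ rfl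
    refine ⟨pullback.lift _ _ hcond, fun f hf => ?_⟩
    by_cases h : S₀ f
    · rw [x₀ f hf h, pullback.lift_snd_assoc, ht]
    · obtain ⟨g, rfl⟩ := ((h₁ _).1 hf).resolve_left h
      rw [x₁ g hf, pullback.lift_fst_assoc]
      exact proj_w s m hmS g _ _ rfl) (by
    intro T p q h
    refine pullback.hom_ext ?_ ?_
    · rw [← xm, h m hmS]
    · refine proj_hom_ext hc₀ fun f hf => ?_
      rw [Category.assoc, Category.assoc, ← x₀ f (hS f hf), h f (hS f hf)])
  exact ⟨_, hc₁, pullback.snd lam ρ, P.pullback_snd _ _ hP⟩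

theorem exists_missing_face {n : ℕ} {S S₀ : Sieve ⦋n⦌} (hS₀ : S₀ ≤ S) (hne : S₀ ≠ S) :
    ∃ (k : ℕ) (m : ⦋k⦌ ⟶ ⦋n⦌), Mono m ∧ S m ∧ ¬ S₀ m ∧
      ∀ {l : SimplexCategory} (g : l ⟶ ⦋k⦌), boundary k g → S₀ (g ≫ m) := by
  classical
  have hex : ∃ (k : ℕ) (m : ⦋k⦌ ⟶ ⦋n⦌), S m ∧ ¬ S₀ m := by
    by_contra! h
    exact hne (le_antisymm hS₀ fun Y f hf => h Y.len f hf)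
  obtain ⟨m, hm, hm₀⟩ := Nat.find_spec hex
  have hmin {j : ℕ} (hj : j < Nat.find hex) (f : ⦋j⦌ ⟶ ⦋n⦌) (hf : S f) : S₀ f := by
    by_contra h
    exact Nat.find_min hex hj ⟨f, hf, h⟩
  generalize Nat.find hex = k at m hm hm₀ hmin
  refine ⟨k, m, ?_, hm, hm₀, fun {l} g hg => ?_⟩
  · rw [SimplexCategory.mono_iff_injective]
    by_contra h
    cases k with
    | zero => exact h fun a b _ => Subsingleton.elim (α := Fin 1) a b
    | succ k =>
      obtain ⟨i, m', rfl⟩ := SimplexCategory.eq_σ_comp_of_not_injective m h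
      have h' := hmin (Nat.lt_succ_self k) (SimplexCategory.δ i.castSucc ≫ _)
        (S.downward_closed hm (SimplexCategory.δ i.castSucc))
      rw [SimplexCategory.δ_comp_σ_self_assoc] at h'
      exact hm₀ (S₀.downward_closed h' _)
  · have hg' : ¬ Function.Surjective g.toOrderHom := fun h =>
      hg (SimplexCategory.epi_iff_surjective.2 h)
    cases k with
    | zero => exact (hg' fun y => ⟨0, Subsingleton.elim (α := Fin 1) _ _⟩).elim
    | succ k =>
      obtain ⟨i, g', rfl⟩ := SimplexCategory.eq_comp_δ_of_not_surjective g hg'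
      rw [Category.assoc]
      exact S₀.downward_closed (hmin (Nat.lt_succ_self k) _ (S.downward_closed hm _)) _

/-- The simplices of dimension at most `n` that lie in `S` and not in `S₀`. -/
def missingFaces {n : ℕ} (S S₀ : Sieve ⦋n⦌) :
    Set (Sigma fun k : Fin (n + 1) => (⦋(k : ℕ)⦌ ⟶ ⦋n⦌)) :=
  Set.ofPred fun f => S f.2 ∧ ¬ S₀ f.2

theorem exists_limit_aux {P : MorphismProperty C} [P.IsMultiplicative] [P.HasPullbacks]
    [P.IsStableUnderBaseChange] {X : SimplicialObject C} (hX : IsReedy P X)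
    {T : C} (hT : IsTerminal T) {n : ℕ} (S : Sieve ⦋n⦌) (N : ℕ) (S₀ : Sieve ⦋n⦌) (hS₀ : S₀ ≤ S)
    (hN : (missingFaces S S₀).ncard ≤ N)
    (c₀ : Cone (sieveDiagram X S₀)) (hc₀ : IsLimit c₀) (h₀ : P (hT.from c₀.pt)) :
    ∃ (c : Cone (sieveDiagram X S)) (_ : IsLimit c), P (hT.from c.pt) := by
  induction N generalizing S₀ with
  | zero =>
    by_cases hne : S₀ = S
    · subst hne
      exact ⟨c₀, hc₀, h₀⟩
    · obtain ⟨k, m, _, hm, hm₀, -⟩ := exists_missing_face hS₀ hne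
      rw [Nat.le_zero, Set.ncard_eq_zero (Set.toFinite _)] at hN
      have hk : k < n + 1 := Nat.lt_succ_of_le (SimplexCategory.le_of_mono m)
      exact absurd (show Sigma.mk ⟨k, hk⟩ m ∈ missingFaces S S₀
        from ⟨hm, hm₀⟩) (Set.eq_empty_iff_forall_notMem.1 hN _)
  | succ N ih =>
    by_cases hne : S₀ = S
    · subst hne
      exact ⟨c₀, hc₀, h₀⟩
    · obtain ⟨k, m, _, hm, hm₀, hb⟩ := exists_missing_face hS₀ hne
      have hk : k < n + 1 := Nat.lt_succ_of_le (SimplexCategory.le_of_mono m)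
      let S₁ : Sieve ⦋n⦌ :=
        { arrows := fun l f => S₀ f ∨ ∃ g, g ≫ m = f
          downward_closed := by
            rintro Y Z f (hf | ⟨g, rfl⟩) h
            · exact .inl (S₀.downward_closed hf h)
            · exact .inr ⟨h ≫ g, Category.assoc _ _ _⟩ }
      obtain ⟨c₁, hc₁, r, hr⟩ := exists_limit_step hX S₀ S₁ m hm₀ hb (fun _ => Iff.rfl) c₀ hc₀
      refine ih S₁ ?_ ?_ c₁ hc₁ ?_
      · rintro Y f (hf | ⟨g, rfl⟩)
        · exact hS₀ _ hf
        · exact S.downward_closed hm g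
      · refine Nat.le_of_lt_succ (lt_of_lt_of_le (Set.ncard_lt_ncard ?_ (Set.toFinite _)) hN)
        refine ⟨fun f hf => ⟨hf.1, fun h => hf.2 (.inl h)⟩, fun h => ?_⟩
        exact (h (show Sigma.mk ⟨k, hk⟩ m ∈ missingFaces S S₀
          from ⟨hm, hm₀⟩)).2 (.inr ⟨𝟙 _, Category.id_comp _⟩)
      · rw [← hT.hom_ext (r ≫ hT.from c₀.pt) (hT.from c₁.pt)]
        exact P.comp_mem _ _ hr h₀

/-- The limits `Hom(S, X)` exist for all `S ⊂ Δ_n`, with structure map to the terminal object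
in `P`. -/
theorem exists_limit {P : MorphismProperty C} [P.IsMultiplicative] [P.HasPullbacks]
    [P.IsStableUnderBaseChange] {X : SimplicialObject C} (hX : IsReedy P X)
    {T : C} (hT : IsTerminal T) {n : ℕ} (S : Sieve ⦋n⦌) :
    ∃ (c : Cone (sieveDiagram X S)) (_ : IsLimit c), P (hT.from c.pt) := by
  refine exists_limit_aux hX hT S _ ⊥ bot_le le_rfl
    (coneOfFamily X ⊥ T (fun f hf => hf.elim) (fun f hf => hf.elim)) ?_ ?_
  · exact
      { lift := fun s => hT.from _
        fac := fun s f => f.unop.property.elim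
        uniq := fun s q hq => hT.hom_ext _ _ }
  · change P (hT.from T)
    rw [hT.hom_ext (hT.from T) (𝟙 T)]
    exact P.id_mem T

end Matching

section Hypercovering

variable {I : Type u} [Category.{v} I] (F : MorphismProperty I)

/-- The maps of `I/i` whose underlying map in `I` is in `F`. -/
abbrev overClass (i : I) : MorphismProperty (Over i) := F.inverseImage (Over.forget i)

instance overClass_hasPullbacks [F.HasPullbacks] (i : I) : (overClass F i).HasPullbacks where
  hasPullback {X Y Z f} g hf := by
    have : HasPullback f.left g.left := F.hasPullback g.left hf
    have : HasLimit (cospan ((Over.forget i).map f) ((Over.forget i).map g)) := this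
    have : HasLimit (cospan f g ⋙ Over.forget i) :=
      hasLimit_of_iso (cospanCompIso (Over.forget i) f g).symm
    exact hasLimit_of_created (cospan f g) (Over.forget i)

instance overClass_isStable [F.IsStableUnderBaseChange] (i : I) :
    (overClass F i).IsStableUnderBaseChange where
  of_isPullback h hg := F.of_isPullback (h.map (Over.forget i)) hg

/-- If `X` is a hypercovering of `i`, then the augmentations of `X_n` and `Hom(∂Δ_n, X)`
to `i` are in `F`. -/
theorem isReedy_hom_mem [F.IsMultiplicative] [F.HasPullbacks] [F.IsStableUnderBaseChange] {i : I}
    {X : SimplicialObject (Over i)} (hX : IsReedy (overClass F i) X) (n : ℕ) :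
    ∃ (c : Cone (sieveDiagram X (boundary n))) (hc : IsLimit c),
      F c.pt.hom ∧ F (matchingMap hc).left ∧ F (X.obj (op ⦋n⦌)).hom := by
  obtain ⟨c₀, hc₀, h₀⟩ := hX n
  obtain ⟨c, hc, h⟩ := exists_limit hX Over.mkIdTerminal (boundary n)
  have e : (Over.mkIdTerminal.from c.pt).left = c.pt.hom := by
    simp
  have h₁ : F c.pt.hom := by
    rw [← e]; exact h
  have h₂ : (overClass F i) (matchingMap hc) := by
    have := (overClass F i).comp_mem _ (hc₀.conePointUniqueUpToIso hc).hom h₀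
      (MorphismProperty.of_isIso _ _)
    have e : matchingMap hc₀ ≫ (hc₀.conePointUniqueUpToIso hc).hom =
      matchingMap hc := proj_hom_ext hc fun g hg => by
        have e' : (hc₀.conePointUniqueUpToIso hc).hom ≫ proj c g hg = proj c₀ g hg :=
          hc₀.conePointUniqueUpToIso_hom_comp hc _
        rw [Category.assoc, e', matchingMap_proj, matchingMap_proj]
    rwa [e] at this
  refine ⟨c, hc, h₁, h₂, ?_⟩
  rw [← Over.w (matchingMap hc)]
  exact F.comp_mem _ _ h₂ h₁

/-- The simplicial object `Y` in `I/i'`, viewed as a simplicial object in `I/i` via `f : i' ⟶ i`. -/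
abbrev pushforward {i' i : I} (f : i' ⟶ i) (Y : SimplicialObject (Over i')) :
    SimplicialObject (Over i) :=
  ((SimplicialObject.whiskering _ _).obj (Over.map f)).obj Y

/-- A hypercovering of `i` can be pulled back along `f : i' ⟶ i`. -/
theorem exists_baseChange [F.IsMultiplicative] [F.HasPullbacks] [F.IsStableUnderBaseChange]
    {i' i : I} (f : i' ⟶ i) {X : SimplicialObject (Over i)} (hX : IsReedy (overClass F i) X) :
    ∃ (Y : SimplicialObject (Over i')) (_ : IsReedy (overClass F i') Y) (φ : pushforward f Y ⟶ X),
      ∀ (Z : SimplicialObject (Over i')) (ψ : pushforward f Z ⟶ X),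
        ∃! t : Z ⟶ Y, ((SimplicialObject.whiskering _ _).obj (Over.map f)).map t ≫ φ = ψ := by
  have ex (U : Over i) (hU : F U.hom) : ∃ (V : Over i') (e : (Over.map f).obj V ⟶ U),
      IsPullback e.left V.hom U.hom f := by
    have := F.hasPullback f hU
    exact ⟨Over.mk (pullback.snd U.hom f),
      Over.homMk (pullback.fst U.hom f) pullback.condition, IsPullback.of_hasPullback _ _⟩
  choose G ε hε using ex
  have lift {U : Over i} (hU : F U.hom) {Z : Over i'} (z : (Over.map f).obj Z ⟶ U) :
      ∃ t : Z ⟶ G U hU, (Over.map f).map t ≫ ε U hU = z := by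
    refine ⟨Over.homMk ((hε U hU).lift z.left Z.hom (Over.w z)) ((hε U hU).lift_snd _ _ _), ?_⟩
    ext
    exact (hε U hU).lift_fst _ _ _
  choose lift fac using @lift
  have uniq {U : Over i} (hU : F U.hom) {Z : Over i'} {a b : Z ⟶ G U hU}
      (h : (Over.map f).map a ≫ ε U hU = (Over.map f).map b ≫ ε U hU) : a = b := by
    ext
    refine (hε U hU).hom_ext ?_ ?_
    · exact congr_arg CommaMorphism.left h
    · rw [Over.w, Over.w]
  have hXm (m : SimplexCategoryᵒᵖ) : F (X.obj m).hom := by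
    obtain ⟨_, _, _, _, h⟩ := isReedy_hom_mem F hX m.unop.len
    exact h
  let Y : SimplicialObject (Over i') :=
    { obj m := G _ (hXm m)
      map {m m'} θ := lift (hXm m') (ε _ (hXm m) ≫ X.map θ)
      map_id m := uniq _ (by simp [fac])
      map_comp {a b c} θ θ' := uniq _ (by simp [fac, reassoc_of% fac]) }
  have Ymap {m m'} (θ : m ⟶ m') : (Over.map f).map (Y.map θ) ≫ ε _ (hXm m') =
    ε _ (hXm m) ≫ X.map θ := fac _ _
  refine ⟨Y, ?_, { app m := ε _ (hXm m), naturality m m' θ := Ymap θ }, ?_⟩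
  · intro n
    obtain ⟨c, hc, h₁, h₂, -⟩ := isReedy_hom_mem F hX n
    obtain ⟨hl⟩ := exists_isLimit (X := Y) (S := boundary n) (G c.pt h₁)
      (fun g hg => lift (hXm _) (ε _ h₁ ≫ proj c g hg))
      (fun g hg g' => uniq (hXm _) (by
        rw [Functor.map_comp, Category.assoc, Ymap, ← Category.assoc, fac, fac, Category.assoc,
          proj_w c g hg g' _ _ rfl])) (by
        intro s
        obtain ⟨t, ht⟩ := exists_lift hc (T := (Over.map f).obj s.pt)
          (fun g hg => (Over.map f).map (proj s g hg) ≫ ε _ (hXm _))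
          (fun g hg g' => by
            rw [Category.assoc, ← Ymap, ← Category.assoc, ← Functor.map_comp,
              proj_w s g hg g' _ _ rfl])
        refine ⟨lift h₁ t, fun g hg => uniq (hXm _) ?_⟩
        rw [Functor.map_comp, Category.assoc, fac, ← Category.assoc, fac, ht]) (by
        intro T a b h
        refine uniq h₁ (proj_hom_ext hc fun g hg => ?_)
        have := congr((Over.map f).map $(h g hg) ≫ ε _ (hXm _))
        simpa only [Functor.map_comp, Category.assoc, fac] using this)
    refine ⟨_, hl, ?_⟩
    set q : G _ (hXm (op ⦋n⦌)) ⟶ G c.pt h₁ := matchingMap hl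
    have e : (Over.map f).map q ≫ ε _ h₁ =
        ε _ (hXm (op ⦋n⦌)) ≫ matchingMap hc := by
      refine proj_hom_ext hc fun g hg => ?_
      have e₁ : matchingMap hc ≫ proj c g hg = X.map g.op := matchingMap_proj hc g hg
      have e₂ : q ≫ lift (hXm _) (ε _ h₁ ≫ proj c g hg) = Y.map g.op :=
        matchingMap_proj hl g hg
      have := congr((Over.map f).map $e₂ ≫ ε _ (hXm _))
      rw [Category.assoc, Category.assoc, e₁, ← Ymap]
      simpa only [Functor.map_comp, Category.assoc, fac] using this
    have sq : IsPullback (ε _ (hXm (op ⦋n⦌))).left q.left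
        (matchingMap hc).left (ε _ h₁).left := by
      refine IsPullback.of_bot ?_ (congr_arg CommaMorphism.left e).symm (hε _ h₁)
      have := hε _ (hXm (op ⦋n⦌))
      rwa [← Over.w q, ← Over.w (matchingMap hc)] at this
    exact F.of_isPullback sq h₂
  · intro Z ψ
    refine ⟨{ app m := lift (hXm m) (ψ.app m)
              naturality m m' θ := uniq (hXm _) ?_ }, ?_, ?_⟩
    · have e : (Over.map f).map (Z.map θ) ≫ ψ.app m' = ψ.app m ≫ X.map θ := ψ.naturality θ
      rw [Functor.map_comp, Functor.map_comp, Category.assoc, Category.assoc]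
      refine (congr(_ ≫ $(fac (hXm m') (ψ.app m')))).trans (e.trans ?_)
      exact (congr($(fac (hXm m) (ψ.app m)) ≫ X.map θ)).symm.trans
        ((Category.assoc _ _ _).trans (congr(_ ≫ $(Ymap θ))).symm)
    · ext1 m
      exact fac _ _
    · intro t ht
      ext1 m
      exact uniq (hXm m) ((congr_app ht m).trans (fac _ _).symm)

end Hypercovering

noncomputable section Dold

section Cohomology

variable {I : Type w} [SmallCategory I] {E : Type u} [Category.{w} E] [Abelian E]

/-- `H^n(C^•(P(X)))`, where `C^•` is the normalized cochain complex of the cosimplicial object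
`P(X)` of `E`, that is, the normalized chain complex of the simplicial object of `Eᵒᵖ`
given by `X` and `P.rightOp : I ⥤ Eᵒᵖ`. -/
def cohomology (n : ℕ) : (Iᵒᵖ ⥤ E) ⥤ (SimplicialObject I)ᵒᵖ ⥤ E where
  obj P := ((SimplicialObject.whiskering I Eᵒᵖ).obj P.rightOp ⋙
    AlgebraicTopology.normalizedMooreComplex Eᵒᵖ ⋙
      HomologicalComplex.homologyFunctor Eᵒᵖ _ n).leftOp
  map η := NatTrans.leftOp (Functor.whiskerRight
    ((SimplicialObject.whiskering I Eᵒᵖ).map (NatTrans.rightOp η))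
    (AlgebraicTopology.normalizedMooreComplex Eᵒᵖ ⋙
      HomologicalComplex.homologyFunctor Eᵒᵖ _ n))
  map_id P := by
    ext X
    apply Quiver.Hom.op_inj
    exact (AlgebraicTopology.normalizedMooreComplex Eᵒᵖ ⋙
      HomologicalComplex.homologyFunctor Eᵒᵖ _ n).map_id
        (((SimplicialObject.whiskering I Eᵒᵖ).obj P.rightOp).obj X.unop)
  map_comp η θ := by
    ext X
    apply Quiver.Hom.op_inj
    exact (AlgebraicTopology.normalizedMooreComplex Eᵒᵖ ⋙
      HomologicalComplex.homologyFunctor Eᵒᵖ _ n).map_comp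
        (((SimplicialObject.whiskering I Eᵒᵖ).map (NatTrans.rightOp θ)).app X.unop)
        (((SimplicialObject.whiskering I Eᵒᵖ).map (NatTrans.rightOp η)).app X.unop)

theorem moore_homologyMap_eq {A : Type u} [Category.{w} A] [Abelian A] {X Y : SimplicialObject A}
    {f g : X ⟶ Y} (h : SimplicialObject.Homotopy f g) (n : ℕ) :
    (AlgebraicTopology.normalizedMooreComplex A ⋙
      HomologicalComplex.homologyFunctor A _ n).map f =
    (AlgebraicTopology.normalizedMooreComplex A ⋙
      HomologicalComplex.homologyFunctor A _ n).map g := by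
  let G := HomologicalComplex.homologyFunctor A (ComplexShape.down ℕ) n
  have : IsIso (G.map ((AlgebraicTopology.inclusionOfMooreComplex A).app Y)) := by
    have : QuasiIso ((AlgebraicTopology.inclusionOfMooreComplex A).app Y) :=
      (AlgebraicTopology.DoldKan.homotopyEquivNormalizedMooreComplexAlternatingFaceMapComplex
        (A := A) (Y := Y)).quasiIso_hom
    exact inferInstanceAs
      (IsIso (HomologicalComplex.homologyMap ((AlgebraicTopology.inclusionOfMooreComplex A).app Y) n))
  change G.map _ = G.map _
  rw [← cancel_mono (G.map ((AlgebraicTopology.inclusionOfMooreComplex A).app Y)),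
    ← G.map_comp, ← G.map_comp, NatTrans.naturality, NatTrans.naturality, G.map_comp, G.map_comp,
    h.map_homology_eq n]

theorem cohomology_map_eq (n : ℕ) (P : Iᵒᵖ ⥤ E) {X Y : SimplicialObject I} {f g : X ⟶ Y}
    (h : SimplicialObject.Homotopy f g) :
    ((cohomology n).obj P).map f.op = ((cohomology n).obj P).map g.op :=
  Quiver.Hom.op_inj (moore_homologyMap_eq (h.whiskerRight P.rightOp) n)

end Cohomology

section Derived

variable {I : Type w} [SmallCategory I] (F : MorphismProperty I)

/-- Hypercoverings of `i`: simplicial objects `X` of `I/i` (that is, simplicial objects of `I`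
augmented by `i`) such that `X_n ⟶ Hom(∂Δ_n, X)` is in `F` for every `n ≥ 0`, where
`Hom(∂Δ_n, X)` is computed in `I/i`. -/
def IsHypercovering (i : I) : ObjectProperty (SimplicialObject (Over i)) :=
  fun X => IsReedy (overClass F i) X

/-- The category of hypercoverings of `i`, a full subcategory of simplicial objects of `I/i`. -/
abbrev HCov (i : I) : Type w := (IsHypercovering F i).FullSubcategory

/-- Two maps of hypercoverings are related if there is a simplicial homotopy over `i`
from one to the other. -/
def homotopyRel (i : I) : HomRel (HCov F i) :=
  fun _ _ f g => Nonempty (SimplicialObject.Homotopy f.hom g.hom)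

/-- The homotopy category of hypercoverings of `i`: two maps are identified if they are connected
by a chain of simplicial homotopies. -/
abbrev HC (i : I) : Type w := CategoryTheory.Quotient (homotopyRel F i)

/-- The underlying simplicial object of `I` of a simplicial object of `I/i`. -/
abbrev total (i : I) : SimplicialObject (Over i) ⥤ SimplicialObject I :=
  (SimplicialObject.whiskering _ _).obj (Over.forget i)

variable {E : Type u} [Category.{w} E] [Abelian E]

/-- The functor `X ↦ H^n(C^•(P(X)))` on the homotopy category of hypercoverings of `i`. -/
def cohomologyHC (n : ℕ) (P : Iᵒᵖ ⥤ E) (i : I) : (HC F i)ᵒᵖ ⥤ E :=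
  (CategoryTheory.Quotient.lift (homotopyRel F i)
    (((IsHypercovering F i).ι ⋙ total i).op ⋙ (cohomology n).obj P).rightOp
    (fun _ _ _ _ ⟨h⟩ => Quiver.Hom.unop_inj
      (cohomology_map_eq n P (h.whiskerRight (Over.forget i))))).leftOp

variable [HasColimitsOfSize.{w, w} E]

/-- The value `D^n(P)(i)` of the Dold-derived functor: the colimit of `H^n(C^•(P(X)))` over the
opposite of the homotopy category of hypercoverings `X` of `i`. -/
def doldObj (n : ℕ) (P : Iᵒᵖ ⥤ E) (i : I) : E := colimit (cohomologyHC F n P i)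

/-- The canonical map from the cohomology of the hypercovering `X` to the colimit. -/
def doldι (n : ℕ) (P : Iᵒᵖ ⥤ E) {i : I} (X : HCov F i) :
    ((cohomology n).obj P).obj (op ((total i).obj X.obj)) ⟶ doldObj F n P i :=
  colimit.ι (cohomologyHC F n P i) (op ((CategoryTheory.Quotient.functor _).obj X))

variable {F}

theorem doldι_w (n : ℕ) (P : Iᵒᵖ ⥤ E) {i : I} {X Y : HCov F i} (t : Y ⟶ X) :
    ((cohomology n).obj P).map ((total i).map t.hom).op ≫ doldι F n P Y = doldι F n P X :=
  colimit.w (cohomologyHC F n P i) ((CategoryTheory.Quotient.functor _).map t).op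

theorem dold_hom_ext {n : ℕ} {P : Iᵒᵖ ⥤ E} {i : I} {T : E} {a b : doldObj F n P i ⟶ T}
    (h : ∀ X : HCov F i, doldι F n P X ≫ a = doldι F n P X ≫ b) : a = b :=
  colimit.hom_ext fun X => h X.unop.as

/-- The map out of the colimit given by a compatible family. -/
def doldDesc {n : ℕ} {P : Iᵒᵖ ⥤ E} {i : I} {T : E}
    (x : ∀ X : HCov F i, ((cohomology n).obj P).obj (op ((total i).obj X.obj)) ⟶ T)
    (hx : ∀ {X Y : HCov F i} (t : Y ⟶ X),
      ((cohomology n).obj P).map ((total i).map t.hom).op ≫ x Y = x X) :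
    doldObj F n P i ⟶ T :=
  colimit.desc (cohomologyHC F n P i)
    { pt := T
      ι :=
        { app := fun X => x X.unop.as
          naturality := by
            intro X Y t
            obtain ⟨s, hs⟩ := (CategoryTheory.Quotient.functor (homotopyRel F i)).map_surjective
              (X := Y.unop.as) (Y := X.unop.as) t.unop
            have : t = ((CategoryTheory.Quotient.functor (homotopyRel F i)).map s).op :=
              Quiver.Hom.unop_inj hs.symm
            subst this
            exact (hx s).trans (Category.comp_id _).symm } }

/-- The map `D^n(P)(i) ⟶ D^n(Q)(i)` induced by `η : P ⟶ Q`. -/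
def doldMapPresheaf (n : ℕ) {P Q : Iᵒᵖ ⥤ E} (η : P ⟶ Q) (i : I) :
    doldObj F n P i ⟶ doldObj F n Q i :=
  doldDesc (fun X => ((cohomology n).map η).app _ ≫ doldι F n Q X) (fun t => by
    rw [NatTrans.naturality_assoc, doldι_w])

theorem doldι_mapPresheaf (n : ℕ) {P Q : Iᵒᵖ ⥤ E} (η : P ⟶ Q) {i : I} (X : HCov F i) :
    doldι F n P X ≫ doldMapPresheaf n η i = ((cohomology n).map η).app _ ≫ doldι F n Q X :=
  colimit.ι_desc _ _

/-- The map of simplicial objects of `I` underlying a map `Y ⟶ X` over `f : i' ⟶ i`. -/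
def totalMap {i' i : I} {f : i' ⟶ i} {Y : SimplicialObject (Over i')}
    {X : SimplicialObject (Over i)} (φ : pushforward f Y ⟶ X) :
    (total i').obj Y ⟶ (total i).obj X where
  app m := (φ.app m).left
  naturality _ _ θ := congr_arg CommaMorphism.left (φ.naturality θ)

variable [F.IsMultiplicative] [F.HasPullbacks] [F.IsStableUnderBaseChange]

/-- The pullback of a hypercovering of `i` along `f : i' ⟶ i`, a simplicial object of `I/i'` with
the universal property of `exists_baseChange`. -/
def baseChange {i' i : I} (f : i' ⟶ i) (X : HCov F i) : HCov F i' :=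
  ⟨(exists_baseChange F f X.property).choose, (exists_baseChange F f X.property).choose_spec.choose⟩

/-- The projection from the pullback of a hypercovering. -/
def baseChangeMap {i' i : I} (f : i' ⟶ i) (X : HCov F i) :
    pushforward f (baseChange f X).obj ⟶ X.obj :=
  (exists_baseChange F f X.property).choose_spec.choose_spec.choose

theorem exists_baseChange_lift {i' i : I} (f : i' ⟶ i) (X : HCov F i) {Z : HCov F i'}
    (ψ : pushforward f Z.obj ⟶ X.obj) :
    ∃ t : Z ⟶ baseChange f X, (total i').map t.hom ≫ totalMap (baseChangeMap f X) = totalMap ψ := by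
  obtain ⟨t, ht, -⟩ :=
    (exists_baseChange F f X.property).choose_spec.choose_spec.choose_spec Z.obj ψ
  refine ⟨ObjectProperty.homMk t, ?_⟩
  ext m
  exact congr_arg CommaMorphism.left (congr_app ht m)

theorem totalMap_dold {i' i : I} (f : i' ⟶ i) (n : ℕ) (P : Iᵒᵖ ⥤ E) {X : HCov F i} {Z : HCov F i'}
    (ψ : pushforward f Z.obj ⟶ X.obj) :
    ((cohomology n).obj P).map (totalMap ψ).op ≫ doldι F n P Z =
      ((cohomology n).obj P).map (totalMap (baseChangeMap f X)).op ≫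
        doldι F n P (baseChange f X) := by
  obtain ⟨t, ht⟩ := exists_baseChange_lift f X ψ
  rw [← ht, op_comp, Functor.map_comp, Category.assoc, doldι_w]

/-- The map `D^n(P)(i) ⟶ D^n(P)(i')` induced by `f : i' ⟶ i` by pulling back hypercoverings. -/
def doldMap (n : ℕ) (P : Iᵒᵖ ⥤ E) {i' i : I} (f : i' ⟶ i) :
    doldObj F n P i ⟶ doldObj F n P i' :=
  doldDesc (fun X => ((cohomology n).obj P).map (totalMap (baseChangeMap f X)).op ≫
    doldι F n P (baseChange f X)) (by
      intro X Y t
      have e := totalMap_dold f n P (X := X) (baseChangeMap f Y ≫ t.hom)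
      rw [← e, ← Category.assoc, ← Functor.map_comp, ← op_comp]
      rfl)

theorem doldι_map (n : ℕ) (P : Iᵒᵖ ⥤ E) {i' i : I} (f : i' ⟶ i) {X : HCov F i} {Z : HCov F i'}
    (ψ : pushforward f Z.obj ⟶ X.obj) :
    doldι F n P X ≫ doldMap n P f =
      ((cohomology n).obj P).map (totalMap ψ).op ≫ doldι F n P Z := by
  rw [totalMap_dold]
  exact colimit.ι_desc _ _

/-- The composite of a map over `f` and a map over `g`. -/
def overComp {i'' i' i : I} {g : i'' ⟶ i'} {f : i' ⟶ i} {Z : SimplicialObject (Over i'')}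
    {Y : SimplicialObject (Over i')} {X : SimplicialObject (Over i)}
    (φ : pushforward g Z ⟶ Y) (ψ : pushforward f Y ⟶ X) : pushforward (g ≫ f) Z ⟶ X where
  app m := Over.homMk ((φ.app m).left ≫ (ψ.app m).left) (by
    have h₁ := Over.w (φ.app m)
    have h₂ := Over.w (ψ.app m)
    change ((φ.app m).left ≫ (ψ.app m).left) ≫ (X.obj m).hom = (Z.obj m).hom ≫ g ≫ f
    change (φ.app m).left ≫ (Y.obj m).hom = (Z.obj m).hom ≫ g at h₁
    change (ψ.app m).left ≫ (X.obj m).hom = (Y.obj m).hom ≫ f at h₂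
    rw [← Category.assoc, ← h₁]
    exact (Category.assoc _ _ _).trans ((congr(_ ≫ $h₂)).trans (Category.assoc _ _ _).symm))
  naturality a b θ := by
    ext
    exact (totalMap φ ≫ totalMap ψ).naturality θ

/-- The identity as a map over `𝟙 i`. -/
def overId {i : I} (X : SimplicialObject (Over i)) : pushforward (𝟙 i) X ⟶ X where
  app m := Over.homMk (𝟙 (X.obj m).left) ((Category.id_comp _).trans (Category.comp_id _).symm)
  naturality a b θ := by
    ext
    exact (𝟙 ((total i).obj X) : _ ⟶ _).naturality θ

variable (F) in
/-- The functor `D^n(P) : Iᵒᵖ ⥤ E`. -/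
def doldPresheaf (n : ℕ) (P : Iᵒᵖ ⥤ E) : Iᵒᵖ ⥤ E where
  obj i := doldObj F n P i.unop
  map f := doldMap n P f.unop
  map_id i := dold_hom_ext fun X => by
    refine (doldι_map n P (𝟙 i.unop) (overId X.obj)).trans ?_
    have : totalMap (overId X.obj) = 𝟙 _ := rfl
    rw [this]
    simp
  map_comp {i i' i''} f g := dold_hom_ext fun X => by
    have e := doldι_map n P (g.unop ≫ f.unop)
      (overComp (baseChangeMap g.unop (baseChange f.unop X)) (baseChangeMap f.unop X))
    have : totalMap (overComp (baseChangeMap g.unop (baseChange f.unop X))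
      (baseChangeMap f.unop X)) = totalMap (baseChangeMap g.unop (baseChange f.unop X)) ≫
        totalMap (baseChangeMap f.unop X) := rfl
    refine e.trans ?_
    rw [this, ← Category.assoc, doldι_map n P f.unop (baseChangeMap f.unop X), Category.assoc,
      doldι_map n P g.unop (baseChangeMap g.unop (baseChange f.unop X)), op_comp,
      Functor.map_comp, Category.assoc]

theorem doldMap_mapPresheaf (n : ℕ) {P Q : Iᵒᵖ ⥤ E} (η : P ⟶ Q) {i' i : I} (f : i' ⟶ i) :
    doldMap (F := F) n P f ≫ doldMapPresheaf n η i' = doldMapPresheaf n η i ≫ doldMap n Q f :=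
  dold_hom_ext fun X => by
    rw [← Category.assoc, ← Category.assoc, doldι_map n P f (baseChangeMap f X),
      doldι_mapPresheaf, Category.assoc, Category.assoc, doldι_mapPresheaf,
      doldι_map n Q f (baseChangeMap f X), NatTrans.naturality_assoc]

variable (F) (E) in
/-- The `n`-th Dold-derived functor `P ↦ D^n(P)`. -/
def doldDerived (n : ℕ) : (Iᵒᵖ ⥤ E) ⥤ (Iᵒᵖ ⥤ E) where
  obj P := doldPresheaf F n P
  map {P Q} η :=
    { app i := doldMapPresheaf n η i.unop
      naturality _ _ f := doldMap_mapPresheaf n η f.unop }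
  map_id P := by
    ext i
    refine dold_hom_ext fun X => (doldι_mapPresheaf n _ X).trans ?_
    rw [CategoryTheory.Functor.map_id]
    exact (Category.id_comp _).trans (Category.comp_id _).symm
  map_comp η θ := by
    ext i
    refine dold_hom_ext fun X => (doldι_mapPresheaf n _ X).trans ?_
    change _ = doldι F n _ X ≫ doldMapPresheaf n η i.unop ≫ doldMapPresheaf n θ i.unop
    rw [← Category.assoc, doldι_mapPresheaf, Category.assoc, doldι_mapPresheaf, Functor.map_comp,
      NatTrans.comp_app, Category.assoc]

end Derived

end Dold
end HyperDold

/-! Three facts about the functors `D^n` suffice. They form a delta functor on presheaves; they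
invert every map that becomes an isomorphism of sheaves, so `D^n` factors through sheafification `a`
(`isIso_doldDerived_map`, `doldSheafifyIso`); and on sheaves `D^0` is the embedding `e`, while
`D^{n+1}` kills injective sheaves (`doldZeroIso`, `isZero_doldDerived_injective`). On sheaves the
`D^n` are thus an effaceable delta functor extending `e`, and dimension shifting along injective
resolutions identifies them with `R^n e` (`nonempty_iso_rightDerived`).

Two geometric properties of a hypercovering `X` of `i` carry these facts. First, `X` is locally
contractible over `i`: after passing to a cover of `T`, any finite set of simplices in `X(T)`
acquires compatible cones (`exists_isLocalCone`), which act as a contracting homotopy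
(`exists_local_homotopy`). Second, a cover of a single term `X_n` can be absorbed by refining `X`
(`exists_refinement`). Finiteness is forced because only finitely many covers have a common
refinement; compact generators of `E` reduce the questions to finite sums.

For the long exact sequence the colimit defining `D^n` has to be exact. Instead of the homotopy
category `HC`, the proof uses the coarser quotient `HCTrunc`, where maps with equal effect on
cohomology in degrees below `N` are identified. In these degrees the colimit is unchanged, and
`HCTrunc` is cofiltered: two parallel maps become chain homotopic in degrees below `N` after a
refinement (`exists_fr_homotopy`). Exactness then follows from that of filtered colimits in `E`
(`dold_exact`).

The second property also shows that `D^n(P) = 0` when `a(P) = 0`: a cocycle vanishes on a cover of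
`X_n`, hence on a refinement of `X`. For an injective sheaf, the first property makes the complex of
free presheaves on `X` locally exact, and mapping it into the sheaf gives an exact cochain complex
in positive degrees for every `X`, before any colimit is taken. -/

namespace HyperDold

/-! ### Refining a hypercovering along a cover of one term -/

section Refinement

variable {C : Type u} [Category.{v} C]

/-- `W` is the limit of the diagram formed by the maps `b j : B ⟶ B₀`, for `j : J`, and one copy of
`c : A ⟶ B₀` for every `j`. -/
structure IsMultiPullback {J : Type*} {A B₀ B W : C} (c : A ⟶ B₀) (b : J → (B ⟶ B₀))
    (p : W ⟶ B) (a : J → (W ⟶ A)) : Prop where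
  w (j : J) : a j ≫ c = p ≫ b j
  exists_lift {T : C} (t : T ⟶ B) (x : J → (T ⟶ A)) (h : ∀ j, x j ≫ c = t ≫ b j) :
    ∃ s : T ⟶ W, s ≫ p = t ∧ ∀ j, s ≫ a j = x j
  hom_ext {T : C} (s s' : T ⟶ W) (hp : s ≫ p = s' ≫ p) (h : ∀ j, s ≫ a j = s' ≫ a j) : s = s'

/-- Induction on `J`: one more index costs one more pullback of `c`, so `p` is a finite composite of
base changes of `c`. -/
theorem exists_multiPullback {P : MorphismProperty C} [P.IsMultiplicative] [P.HasPullbacks]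
    [P.IsStableUnderBaseChange] {A B₀ : C} {c : A ⟶ B₀} (hc : P c) (J : Type*) [Finite J] :
    ∀ {B : C} (b : J → (B ⟶ B₀)), ∃ (W : C) (p : W ⟶ B) (a : J → (W ⟶ A)), P p ∧
      IsMultiPullback c b p a := by
  induction J using Finite.induction_empty_option with
  | of_equiv e ih =>
    intro B b
    obtain ⟨W, p, a, hp, h⟩ := ih (b ∘ e)
    refine ⟨W, p, a ∘ e.symm, hp, fun j => ?_, fun t x hx => ?_, fun s s' h₁ h₂ => ?_⟩
    · simpa using h.w (e.symm j)
    · obtain ⟨s, hs, hs'⟩ := h.exists_lift t (x ∘ e) (fun j => hx _)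
      exact ⟨s, hs, fun j => by simpa using hs' (e.symm j)⟩
    · exact h.hom_ext _ _ h₁ fun j => by simpa using h₂ (e j)
  | h_empty =>
    intro B b
    exact ⟨B, 𝟙 B, fun j => j.elim, P.id_mem B, fun j => j.elim,
      fun t x _ => ⟨t, by simp, fun j => j.elim⟩, fun s s' h _ => by simpa using h⟩
  | h_option ih =>
    intro B b
    obtain ⟨W, p, a, hp, h⟩ := ih (fun j => b (some j))
    have := P.hasPullback (p ≫ b none) hc
    refine ⟨pullback c (p ≫ b none), pullback.snd _ _ ≫ p,
      fun j => j.elim (pullback.fst _ _) (fun j => pullback.snd _ _ ≫ a j),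
      P.comp_mem _ _ (P.pullback_snd _ _ hc) hp, ?_, fun t x hx => ?_, fun s s' h₁ h₂ => ?_⟩
    · rintro (_ | j)
      · simp [pullback.condition]
      · simp [h.w]
    · obtain ⟨s, hs, hs'⟩ := h.exists_lift t (fun j => x (some j)) (fun j => hx _)
      refine ⟨pullback.lift (x none) s (by rw [hx, ← hs, Category.assoc]),
        (pullback.lift_snd_assoc _ _ _ _).trans hs, ?_⟩
      rintro (_ | j)
      · exact pullback.lift_fst _ _ _
      · exact (pullback.lift_snd_assoc _ _ _ _).trans (hs' j)
    · refine pullback.hom_ext (h₂ none) (h.hom_ext _ _ (by simpa using h₁) fun j => ?_)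
      simpa using h₂ (some j)

/-- Evaluation at `[n]` has a right adjoint `R`, formally `R(A)_m = A^{Hom([n],[m])}`, and `X'` is
the fibre product of `X` and `R(A)` over `R(X_n)`, built directly from finite pullbacks of `c`. Its
matching map in degree `m` is a composite of a base change of the matching map of `X` with base
changes of `c`, one for each surjection `[n] ⟶ [m]`. The map `a` is the projection to the factor
indexed by the identity of `[n]`. -/
theorem exists_refinement {P : MorphismProperty C} [P.IsMultiplicative] [P.HasPullbacks]
    [P.IsStableUnderBaseChange] {X : SimplicialObject C} (hX : IsReedy P X) {n : ℕ} {A : C}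
    {c : A ⟶ X.obj (op ⦋n⦌)} (hc : P c) :
    ∃ (X' : SimplicialObject C) (_ : IsReedy P X') (φ : X' ⟶ X) (a : X'.obj (op ⦋n⦌) ⟶ A),
      a ≫ c = φ.app (op ⦋n⦌) := by
  have ex (m : SimplexCategoryᵒᵖ) := exists_multiPullback hc (⦋n⦌ ⟶ m.unop)
    (fun θ => X.map θ.op)
  choose W p a hp hW using ex
  have exm {m m' : SimplexCategoryᵒᵖ} (τ : m ⟶ m') : ∃ s : W m ⟶ W m', s ≫ p m' = p m ≫ X.map τ ∧
      ∀ θ, s ≫ a m' θ = a m (θ ≫ τ.unop) :=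
    (hW m').exists_lift (p m ≫ X.map τ) _ (fun θ => by simp [(hW m).w])
  choose s hsp hsa using @exm
  let X' : SimplicialObject C :=
    { obj := W
      map := s
      map_id m := (hW m).hom_ext _ _ (by simp [hsp]) (by simp [hsa])
      map_comp τ τ' := (hW _).hom_ext _ _ (by
        rw [hsp, Category.assoc, hsp, ← Category.assoc (s τ), hsp, Category.assoc, X.map_comp])
        (by simp [hsa]) }
  refine ⟨X', fun m => ?_, { app := p, naturality _ _ τ := hsp τ }, a _ (𝟙 _), ?_⟩
  swap
  · exact ((hW _).w _).trans ((congr(_ ≫ $(X.map_id _))).trans (Category.comp_id _))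
  obtain ⟨c₀, hc₀, hl⟩ := hX m
  -- The non-surjective maps `[n] ⟶ [m]` are the `n`-simplices of the boundary of `Δ_m`. Attaching a
  -- copy of `A` to each of them gives the object `M` that represents `Hom(∂Δ_m, X')`.
  obtain ⟨M, q, b, hq, hM⟩ := exists_multiPullback hc {θ : ⦋n⦌ ⟶ ⦋m⦌ // boundary m θ}
    (fun θ => proj c₀ θ.1 θ.2)
  have exx {k : SimplexCategory} (f : k ⟶ ⦋m⦌) (hf : boundary m f) :
      ∃ t : M ⟶ W (op k), t ≫ p _ = q ≫ proj c₀ f hf ∧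
        ∀ θ, t ≫ a _ θ = b ⟨θ ≫ f, (boundary m).downward_closed hf θ⟩ :=
    (hW _).exists_lift _ (fun θ => b ⟨θ ≫ f, (boundary m).downward_closed hf θ⟩) (fun θ => by
      rw [hM.w, Category.assoc, proj_w c₀ f hf θ _ _ rfl])
  choose x hxp hxa using @exx
  obtain ⟨hlim⟩ := exists_isLimit (X := X') (S := boundary m) M x (by
      intro k l f hf g
      refine (hW _).hom_ext _ _ ?_ fun θ => ?_
      · rw [hxp, Category.assoc]
        refine (congr(_ ≫ $(hsp g.op))).trans ?_
        rw [← Category.assoc, hxp, Category.assoc, proj_w c₀ f hf g _ _ rfl]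
      · rw [hxa, Category.assoc]
        refine (congr(_ ≫ $(hsa g.op θ))).trans ?_
        simp [hxa]) (by
      intro r
      obtain ⟨t₀, ht₀⟩ := exists_lift hc₀ (fun f hf => proj r f hf ≫ p _) (fun f hf g => by
        rw [← proj_w r f hf g _ _ rfl, Category.assoc, Category.assoc]
        exact (congr(_ ≫ $(hsp g.op))).symm)
      obtain ⟨t, ht, ht'⟩ := hM.exists_lift t₀ (fun θ => proj r θ.1 θ.2 ≫ a _ (𝟙 _)) (fun θ => by
        rw [ht₀, Category.assoc, (hW _).w]
        simp)
      refine ⟨t, fun f hf => (hW _).hom_ext _ _ ?_ fun θ => ?_⟩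
      · rw [Category.assoc, hxp, ← Category.assoc, ht, ht₀]
      · rw [Category.assoc, hxa, ht', ← proj_w r f hf θ _ _ rfl, Category.assoc]
        refine (congr(_ ≫ $(hsa θ.op _))).trans ?_
        simp) (by
      intro T t t' h
      refine hM.hom_ext _ _ (proj_hom_ext hc₀ fun f hf => ?_) fun θ => ?_
      · rw [Category.assoc, Category.assoc, ← hxp, ← Category.assoc, h, Category.assoc]
      · have := hxa θ.1 θ.2 (𝟙 _)
        simp only [Category.id_comp] at this
        have e : b θ = x θ.1 θ.2 ≫ a _ (𝟙 _) := this.symm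
        rw [e, ← Category.assoc, h, Category.assoc])
  refine ⟨_, hlim, ?_⟩
  have hpb := P.hasPullback q hl
  have hsnd := P.pullback_snd (f := matchingMap hc₀) (g := q) hl
  -- Over `M`, first pull back the matching map of `X`, then attach the copies of `A` for the
  -- surjective maps. The result `V` is isomorphic to `X'_m`, and `V ⟶ M` is in `P` by construction.
  obtain ⟨V, r, d, hr, hV⟩ := exists_multiPullback hc {θ : ⦋n⦌ ⟶ ⦋m⦌ // ¬ boundary m θ}
    (fun θ => pullback.fst (matchingMap hc₀) q ≫ X.map θ.1.op)
  set e : W (op ⦋m⦌) ⟶ M := matchingMap hlim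
  have hex {k : SimplexCategory} (f : k ⟶ ⦋m⦌) (hf : boundary m f) : e ≫ x f hf = s f.op :=
    matchingMap_proj hlim f hf
  have heq : e ≫ q = p _ ≫ matchingMap hc₀ := proj_hom_ext hc₀ fun f hf => by
    rw [Category.assoc, Category.assoc, matchingMap_proj, ← hxp, ← Category.assoc, hex, hsp]
  have heb (θ) : e ≫ b θ = a _ θ.1 := by
    have h : x θ.1 θ.2 ≫ a _ (𝟙 _) = b θ := by simp [hxa]
    rw [← h, ← Category.assoc, hex, hsa]
    simp
  obtain ⟨t, ht, ht'⟩ := hV.exists_lift (pullback.lift (p _) e heq.symm) (fun θ => a _ θ.1)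
    (fun θ => by rw [(hW _).w, pullback.lift_fst_assoc])
  classical
  obtain ⟨t', h₁, h₂⟩ := (hW (op ⦋m⦌)).exists_lift (r ≫ pullback.fst _ _)
    (fun θ => if h : boundary m θ then r ≫ pullback.snd _ _ ≫ b ⟨θ, h⟩ else d ⟨θ, h⟩) (fun θ => by
      dsimp only
      split_ifs with h
      · rw [Category.assoc, Category.assoc, hM.w, ← pullback.condition_assoc, matchingMap_proj,
          Category.assoc]
      · rw [hV.w, Category.assoc])
  have h₃ : t' ≫ e = r ≫ pullback.snd _ _ := by
    refine hM.hom_ext _ _ ?_ fun θ => ?_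
    · rw [Category.assoc, heq, ← Category.assoc, h₁, Category.assoc, Category.assoc,
        pullback.condition]
    · rw [Category.assoc, heb, h₂, dif_pos θ.2, Category.assoc]
  have : IsIso t := by
    refine ⟨t', (hW _).hom_ext _ _ ?_ fun θ => ?_, hV.hom_ext _ _ ?_ fun θ => ?_⟩
    · rw [Category.assoc, h₁, ← Category.assoc, ht, pullback.lift_fst, Category.id_comp]
    · rw [Category.assoc, h₂]
      split_ifs with h
      · rw [← Category.assoc, ht, pullback.lift_snd_assoc, heb, Category.id_comp]
      · rw [ht', Category.id_comp]
    · rw [Category.assoc, ht, Category.id_comp]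
      refine pullback.hom_ext ?_ ?_
      · rw [Category.assoc, pullback.lift_fst, h₁]
      · rw [Category.assoc, pullback.lift_snd, h₃]
    · rw [Category.assoc, ht', h₂, dif_neg θ.2, Category.id_comp]
  have h : e = t ≫ r ≫ pullback.snd _ _ := by
    rw [← Category.assoc, ht, pullback.lift_snd]
  rw [h]
  exact P.comp_mem _ _ (P.of_isIso t) (P.comp_mem _ _ hr hsnd)

end Refinement

/-! ### Products of hypercoverings -/

section Product

variable {C : Type u} [Category.{v} C]

theorem exists_limit_boundary {P : MorphismProperty C} [P.IsMultiplicative] [P.HasPullbacks]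
    [P.IsStableUnderBaseChange] {X : SimplicialObject C} (hX : IsReedy P X)
    {T : C} (hT : IsTerminal T) (n : ℕ) :
    ∃ (c : Cone (sieveDiagram X (boundary n))) (hc : IsLimit c),
      P (hT.from c.pt) ∧ P (matchingMap hc) := by
  obtain ⟨c₀, hc₀, h₀⟩ := hX n
  obtain ⟨c, hc, h⟩ := exists_limit hX hT (boundary n)
  refine ⟨c, hc, h, ?_⟩
  have e : matchingMap hc₀ ≫ (hc₀.conePointUniqueUpToIso hc).hom = matchingMap hc :=
    proj_hom_ext hc fun g hg => by
      have e' : (hc₀.conePointUniqueUpToIso hc).hom ≫ proj c g hg = proj c₀ g hg :=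
        hc₀.conePointUniqueUpToIso_hom_comp hc _
      rw [Category.assoc, e', matchingMap_proj, matchingMap_proj]
  rw [← e]
  exact P.comp_mem _ _ h₀ (P.of_isIso _)

/-- Termwise products exist because each `X_m ⟶ T` is in `P`. Since `Hom(∂Δ_m, -)` commutes with
products, the matching map is the product of the two matching maps, which is in `P` as a composite
of two base changes. -/
theorem exists_product {P : MorphismProperty C} [P.IsMultiplicative] [P.HasPullbacks]
    [P.IsStableUnderBaseChange] {T : C} (hT : IsTerminal T) {X Y : SimplicialObject C}
    (hX : IsReedy P X) (hY : IsReedy P Y) :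
    ∃ (W : SimplicialObject C) (_ : IsReedy P W), Nonempty (W ⟶ X) ∧ Nonempty (W ⟶ Y) := by
  have ex (A B : C) (hA : P (hT.from A)) : ∃ (W : C) (p : W ⟶ A) (q : W ⟶ B),
      (∀ {Z : C} (a : Z ⟶ A) (b : Z ⟶ B), ∃ s : Z ⟶ W, s ≫ p = a ∧ s ≫ q = b) ∧
      ∀ {Z : C} (s s' : Z ⟶ W), s ≫ p = s' ≫ p → s ≫ q = s' ≫ q → s = s' := by
    have := P.hasPullback (hT.from B) hA
    exact ⟨pullback (hT.from A) (hT.from B), pullback.fst _ _, pullback.snd _ _,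
      fun a b => ⟨pullback.lift a b (hT.hom_ext _ _), pullback.lift_fst _ _ _,
        pullback.lift_snd _ _ _⟩,
      fun s s' => pullback.hom_ext⟩
  choose W p q lift ext using ex
  choose l hlp hlq using @lift
  have hX₀ (m : SimplexCategoryᵒᵖ) : P (hT.from (X.obj m)) := by
    obtain ⟨c, hc, h, h'⟩ := exists_limit_boundary hX hT m.unop.len
    rw [← hT.hom_ext (matchingMap hc ≫ hT.from _) (hT.from _)]
    exact P.comp_mem _ _ h' h
  let Z : SimplicialObject C :=
    { obj m := W (X.obj m) (Y.obj m) (hX₀ m)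
      map {m m'} τ := l _ _ (hX₀ m') (p _ _ (hX₀ m) ≫ X.map τ) (q _ _ (hX₀ m) ≫ Y.map τ)
      map_id m := ext _ _ _ _ _ (by simp [hlp]) (by simp [hlq])
      map_comp τ τ' := ext _ _ _ _ _ (by
        rw [hlp, Category.assoc, hlp, ← Category.assoc (l _ _ _ _ _), hlp, X.map_comp,
          Category.assoc]) (by
        rw [hlq, Category.assoc, hlq, ← Category.assoc (l _ _ _ _ _), hlq, Y.map_comp,
          Category.assoc]) }
  let π₁ : Z ⟶ X := { app m := p _ _ (hX₀ m), naturality _ _ τ := hlp _ _ _ _ _ }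
  let π₂ : Z ⟶ Y := { app m := q _ _ (hX₀ m), naturality _ _ τ := hlq _ _ _ _ _ }
  have extZ {m} {V : C} {s s' : V ⟶ Z.obj m} (h₁ : s ≫ π₁.app m = s' ≫ π₁.app m)
    (h₂ : s ≫ π₂.app m = s' ≫ π₂.app m) : s = s' := ext _ _ _ _ _ h₁ h₂
  have liftZ {m} {V : C} (a : V ⟶ X.obj m) (b : V ⟶ Y.obj m) : ∃ s : V ⟶ Z.obj m,
      s ≫ π₁.app m = a ∧ s ≫ π₂.app m = b := ⟨l _ _ (hX₀ m) a b, hlp _ _ _ _ _, hlq _ _ _ _ _⟩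
  clear_value Z π₁ π₂
  refine ⟨Z, fun m => ?_, ⟨π₁⟩, ⟨π₂⟩⟩
  obtain ⟨c, hc, h₁, h₂⟩ := exists_limit_boundary hX hT m
  obtain ⟨c', hc', hP'⟩ := hY m
  have exx {k : SimplexCategory} (f : k ⟶ ⦋m⦌) (hf : boundary m f) :
      ∃ t : W c.pt c'.pt h₁ ⟶ Z.obj (op k), t ≫ π₁.app _ = p _ _ h₁ ≫ proj c f hf ∧
        t ≫ π₂.app _ = q _ _ h₁ ≫ proj c' f hf := liftZ _ _
  choose x hx₁ hx₂ using @exx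
  obtain ⟨hlim⟩ := exists_isLimit (X := Z) (S := boundary m) (W c.pt c'.pt h₁) x (by
      intro k k' f hf g
      refine extZ ?_ ?_
      · rw [Category.assoc, π₁.naturality, ← Category.assoc, hx₁, hx₁, Category.assoc,
          proj_w c f hf g _ _ rfl]
      · rw [Category.assoc, π₂.naturality, ← Category.assoc, hx₂, hx₂, Category.assoc,
          proj_w c' f hf g _ _ rfl]) (by
      intro r
      obtain ⟨t, ht⟩ := exists_lift hc (fun f hf => proj r f hf ≫ π₁.app _) (fun f hf g => by
        rw [← proj_w r f hf g _ _ rfl, Category.assoc, Category.assoc, π₁.naturality])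
      obtain ⟨t', ht'⟩ := exists_lift hc' (fun f hf => proj r f hf ≫ π₂.app _) (fun f hf g => by
        rw [← proj_w r f hf g _ _ rfl, Category.assoc, Category.assoc, π₂.naturality])
      refine ⟨l _ _ h₁ t t', fun f hf => extZ ?_ ?_⟩
      · rw [Category.assoc, hx₁, ← Category.assoc, hlp, ht]
      · rw [Category.assoc, hx₂, ← Category.assoc, hlq, ht']) (by
      intro V t t' h
      refine ext _ _ _ _ _ (proj_hom_ext hc fun f hf => ?_) (proj_hom_ext hc' fun f hf => ?_)
      · rw [Category.assoc, Category.assoc, ← hx₁, ← Category.assoc, h, Category.assoc]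
      · rw [Category.assoc, Category.assoc, ← hx₂, ← Category.assoc, h, Category.assoc])
  refine ⟨_, hlim, ?_⟩
  set e : Z.obj (op ⦋m⦌) ⟶ W c.pt c'.pt h₁ := matchingMap hlim
  have hex {k : SimplexCategory} (f : k ⟶ ⦋m⦌) (hf : boundary m f) : e ≫ x f hf = Z.map f.op :=
    matchingMap_proj hlim f hf
  have hep : e ≫ p _ _ h₁ = π₁.app _ ≫ matchingMap hc := proj_hom_ext hc fun f hf => by
    rw [Category.assoc, Category.assoc, matchingMap_proj, ← hx₁, ← Category.assoc, hex,
      π₁.naturality]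
  have heq : e ≫ q _ _ h₁ = π₂.app _ ≫ matchingMap hc' := proj_hom_ext hc' fun f hf => by
    rw [Category.assoc, Category.assoc, matchingMap_proj, ← hx₂, ← Category.assoc, hex,
      π₂.naturality]
  have hpb := P.hasPullback (p _ c'.pt h₁) h₂
  have hsnd := P.pullback_snd (f := matchingMap hc) (g := p _ c'.pt h₁) h₂
  have hpb' := P.hasPullback (pullback.snd (matchingMap hc) (p _ c'.pt h₁) ≫ q _ _ h₁) hP'
  have hsnd' := P.pullback_snd (f := matchingMap hc')
    (g := pullback.snd (matchingMap hc) (p _ c'.pt h₁) ≫ q _ _ h₁) hP'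
  -- The product of the matching maps in two stages: the target first pulls back the matching map of
  -- `X`, then that of `Y`.
  let t : Z.obj (op ⦋m⦌) ⟶ pullback (matchingMap hc')
      (pullback.snd (matchingMap hc) (p _ c'.pt h₁) ≫ q _ _ h₁) :=
    pullback.lift (π₂.app _) (pullback.lift (π₁.app _) e hep.symm) (by
      rw [pullback.lift_snd_assoc, heq])
  have ht : t ≫ pullback.snd _ _ ≫ pullback.snd _ _ = e := by
    rw [pullback.lift_snd_assoc, pullback.lift_snd]
  have : IsIso t := by
    obtain ⟨t', h₃, h₄⟩ := liftZ (pullback.snd (matchingMap hc')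
      (pullback.snd (matchingMap hc) (p _ c'.pt h₁) ≫ q _ _ h₁) ≫ pullback.fst _ _)
      (pullback.fst (matchingMap hc') (pullback.snd (matchingMap hc) (p _ c'.pt h₁) ≫ q _ _ h₁))
    refine ⟨t', extZ ?_ ?_, pullback.hom_ext ?_ (pullback.hom_ext ?_ (ext _ _ _ _ _ ?_ ?_))⟩
    · rw [Category.assoc, h₃, pullback.lift_snd_assoc, pullback.lift_fst, Category.id_comp]
    · rw [Category.assoc, h₄, pullback.lift_fst, Category.id_comp]
    · rw [Category.assoc, pullback.lift_fst, h₄, Category.id_comp]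
    · simp only [t, Category.assoc, Category.id_comp, pullback.lift_snd, pullback.lift_fst, h₃]
    · simp only [t, Category.assoc, Category.id_comp, pullback.lift_snd, hep,
        ← pullback.condition]
      rw [← Category.assoc, h₃, Category.assoc]
    · simp only [t, Category.assoc, Category.id_comp, pullback.lift_snd, heq]
      rw [← Category.assoc, h₄, pullback.condition]
  rw [← ht]
  exact P.comp_mem _ _ (P.of_isIso t) (P.comp_mem _ _ hsnd' hsnd)

end Product

/-! ### Filling boundaries of simplices -/

section Faces

variable {C : Type u} [Category.{v} C]

/-- A family of faces `y j : T ⟶ X_k` of a map from `∂Δ_{k+1}` to `X`. -/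
def IsBoundaryFamily (X : SimplicialObject C) {k : ℕ} {T : C}
    (y : Fin (k + 2) → (T ⟶ X.obj (op ⦋k⦌))) : Prop :=
  ∀ {l : SimplexCategory} (θ θ' : l ⟶ ⦋k⦌) (j j' : Fin (k + 2)),
    θ ≫ SimplexCategory.δ j = θ' ≫ SimplexCategory.δ j' →
      y j ≫ X.map θ.op = y j' ≫ X.map θ'.op

theorem comp_δ_apply_ne {k : ℕ} {l : SimplexCategory} (θ : l ⟶ ⦋k⦌) (j : Fin (k + 2))
    (a : Fin (l.len + 1)) : (θ ≫ SimplexCategory.δ j).toOrderHom a ≠ j := by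
  change (SimplexCategory.δ j).toOrderHom (θ.toOrderHom a) ≠ j
  exact Fin.succAbove_ne _ _

/-- The two vertices of `Δ_1` are disjoint, so an equality of composites forces `j = j'` and there
is nothing to match. -/
theorem isBoundaryFamily_zero (X : SimplicialObject C) {T : C}
    (y : Fin 2 → (T ⟶ X.obj (op ⦋0⦌))) : IsBoundaryFamily X (k := 0) y := by
  intro l θ θ' j j' h
  have h₁ := comp_δ_apply_ne θ j 0
  have h₂ := comp_δ_apply_ne θ' j' 0
  rw [h] at h₁
  have e : j = j' := by
    generalize (θ' ≫ SimplexCategory.δ j').toOrderHom 0 = z at h₁ h₂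
    have : (z : ℕ) < 2 := z.2
    omega
  subst e
  rw [(cancel_mono _).1 h]

/-- Two distinct faces of a simplex meet in a face of codimension two, so the usual simplicial
identities imply all compatibilities. -/
theorem isBoundaryFamily_succ (X : SimplicialObject C) {k : ℕ} {T : C}
    (y : Fin (k + 3) → (T ⟶ X.obj (op ⦋k + 1⦌)))
    (hy : ∀ i j : Fin (k + 2), i ≤ j → y j.succ ≫ X.δ i = y i.castSucc ≫ X.δ j) :
    IsBoundaryFamily X y := by
  have key {l : SimplexCategory} (θ θ' : l ⟶ ⦋k + 1⦌) (j j' : Fin (k + 3)) (hj : j < j')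
      (h : θ ≫ SimplexCategory.δ j = θ' ≫ SimplexCategory.δ j') :
      y j ≫ X.map θ.op = y j' ≫ X.map θ'.op := by
    obtain ⟨i, rfl⟩ := Fin.exists_castSucc_eq.2 (Fin.ne_last_of_lt hj)
    obtain ⟨j₀, rfl⟩ := Fin.exists_succ_eq.2 (Fin.ne_zero_of_lt hj)
    have hij : i ≤ j₀ := by
      rw [Fin.le_def]; rw [Fin.lt_def] at hj; simp at hj; omega
    -- The common composite misses `i.castSucc`, and `δ j₀.succ` sends `i` to `i.castSucc`; hence
    -- `θ'` misses `i`.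
    obtain ⟨ρ, rfl⟩ := SimplexCategory.eq_comp_δ_of_not_surjective' θ' i (by
      intro a ha
      have h₁ := comp_δ_apply_ne θ i.castSucc a
      rw [h] at h₁
      apply h₁
      change (SimplexCategory.δ j₀.succ).toOrderHom (θ'.toOrderHom a) = _
      rw [ha]
      exact Fin.succAbove_of_castSucc_lt _ _ hj)
    rw [Category.assoc, SimplexCategory.δ_comp_δ hij, ← Category.assoc, cancel_mono] at h
    subst h
    rw [op_comp, op_comp, X.map_comp, X.map_comp]
    have := hy i j₀ hij
    simp only [SimplicialObject.δ] at this
    rw [← Category.assoc, ← Category.assoc, this]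
  intro l θ θ' j j' h
  rcases lt_trichotomy j j' with hj | rfl | hj
  · exact key _ _ _ _ hj h
  · rw [(cancel_mono _).1 h]
  · exact (key _ _ _ _ hj h.symm).symm

/-- The boundary of `Δ_{k+1}` is the union of its faces, so `y` amounts to a map from `T` to
`Hom(∂Δ_{k+1}, X)`. The pullback of the matching map along it is the desired cover. -/
theorem IsReedy.exists_filling {P : MorphismProperty C} [P.HasPullbacks]
    [P.IsStableUnderBaseChange] {X : SimplicialObject C} (hX : IsReedy P X) {k : ℕ} {T : C}
    {y : Fin (k + 2) → (T ⟶ X.obj (op ⦋k⦌))} (hy : IsBoundaryFamily X y) :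
    ∃ (T' : C) (c : T' ⟶ T) (x : T' ⟶ X.obj (op ⦋k + 1⦌)), P c ∧
      ∀ j, x ≫ X.δ j = c ≫ y j := by
  obtain ⟨M, hM, hP⟩ := hX (k + 1)
  have hex {l : SimplexCategory} (f : l ⟶ ⦋k + 1⦌) (hf : boundary (k + 1) f) :
      ∃ (j : Fin (k + 2)) (θ : l ⟶ ⦋k⦌), f = θ ≫ SimplexCategory.δ j :=
    SimplexCategory.eq_comp_δ_of_not_surjective f fun h =>
      hf (SimplexCategory.epi_iff_surjective.2 h)
  choose j θ hθ using @hex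
  obtain ⟨t, ht⟩ := exists_lift hM (fun f hf => y (j f hf) ≫ X.map (θ f hf).op)
    (fun f hf g => by
      rw [Category.assoc, ← X.map_comp, ← op_comp]
      refine hy _ _ _ _ ?_
      rw [Category.assoc, ← hθ, ← hθ])
  have := P.hasPullback t hP
  refine ⟨pullback (matchingMap hM) t, pullback.snd _ _, pullback.fst _ _, P.pullback_snd _ _ hP,
    fun i => ?_⟩
  have hi : boundary (k + 1) (SimplexCategory.δ i) := by
    intro h
    rw [SimplexCategory.epi_iff_surjective] at h
    obtain ⟨a, ha⟩ := h i
    exact Fin.succAbove_ne _ _ ha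
  have e := matchingMap_proj hM _ hi
  change pullback.fst _ _ ≫ X.map _ = _
  rw [← e, pullback.condition_assoc, ht]
  congr 1
  have := hy (θ _ hi) (𝟙 _) (j _ hi) i (by rw [← hθ, Category.id_comp])
  simpa using this

end Faces

/-! ### Local contractibility of hypercoverings -/

section LocalCones

variable {I : Type u} [Category.{v} I] {F : MorphismProperty I}
    [F.HasPullbacks] [F.IsStableUnderBaseChange]

variable (F) in
-- Covers have a common refinement by pullback, and conditions stable under refinement survive it.
-- The induction needs `A` finite; this is the source of all finiteness conditions on sets of
-- simplices.
theorem exists_common_cover [F.IsMultiplicative] {T : I} {ι : Type*} {A : Set ι} (hA : A.Finite)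
    (R : ι → ∀ {T' : I}, (T' ⟶ T) → Prop)
    (hR : ∀ a {T' T'' : I} (d : T'' ⟶ T') (c : T' ⟶ T), R a c → R a (d ≫ c))
    (h : ∀ a ∈ A, ∃ (T' : I) (c : T' ⟶ T), F c ∧ R a c) :
    ∃ (T' : I) (c : T' ⟶ T), F c ∧ ∀ a ∈ A, R a c := by
  induction A, hA using Set.Finite.induction_on with
  | empty => exact ⟨T, 𝟙 T, F.id_mem T, by simp⟩
  | @insert a A _ _ ih =>
    obtain ⟨T₁, c₁, h₁, h₁'⟩ := ih fun b hb => h b (.inr hb)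
    obtain ⟨T₂, c₂, h₂, h₂'⟩ := h a (.inl rfl)
    have := F.hasPullback c₁ h₂
    refine ⟨pullback c₂ c₁, pullback.snd _ _ ≫ c₁,
      F.comp_mem _ _ (F.pullback_snd _ _ h₂) h₁, ?_⟩
    rintro b (rfl | hb)
    · rw [← pullback.condition]
      exact hR _ _ _ h₂'
    · exact hR _ _ _ (h₁' b hb)

variable {i : I} {X : SimplicialObject (Over i)}

/-- A map `s` that sends the simplices of `X(T)` in the face-closed family `S` to simplices of
`X(T')` that are cones over their restrictions to `T'`, with vertices given by `v`. -/
structure IsLocalCone (X : SimplicialObject (Over i)) {T T' : I} (c : T' ⟶ T) (S₀ : Set (T ⟶ i))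
    (S : ∀ k : ℕ, Set (T ⟶ (X.obj (op ⦋k⦌)).left))
    (v : ∀ e ∈ S₀, (T' ⟶ (X.obj (op ⦋0⦌)).left))
    (s : ∀ (k : ℕ), ∀ x ∈ S k, (T' ⟶ (X.obj (op ⦋k + 1⦌)).left)) : Prop where
  v_hom (e : T ⟶ i) (he : e ∈ S₀) : v e he ≫ (X.obj (op ⦋0⦌)).hom = c ≫ e
  δ_zero {k : ℕ} (x : T ⟶ (X.obj (op ⦋k⦌)).left) (hx : x ∈ S k) :
    s k x hx ≫ (X.δ 0).left = c ≫ x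
  δ_succ {k : ℕ} (x : T ⟶ (X.obj (op ⦋k + 1⦌)).left) (hx : x ∈ S (k + 1)) (j : Fin (k + 2))
    (hj : x ≫ (X.δ j).left ∈ S k) : s (k + 1) x hx ≫ (X.δ j.succ).left = s k _ hj
  δ_one (x : T ⟶ (X.obj (op ⦋0⦌)).left) (hx : x ∈ S 0) (e : T ⟶ i) (he : e ∈ S₀)
    (h : x ≫ (X.obj (op ⦋0⦌)).hom = e) : s 0 x hx ≫ (X.δ 1).left = v e he

/-- The conditions on the faces other than the face `δ 0` of a cone `t` on a `k`-simplex `x`. -/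
def HasConeFaces (X : SimplicialObject (Over i)) {T T' T'' : I} {S₀ : Set (T ⟶ i)}
    {S : ∀ k : ℕ, Set (T ⟶ (X.obj (op ⦋k⦌)).left)}
    (v : ∀ e ∈ S₀, (T' ⟶ (X.obj (op ⦋0⦌)).left))
    (s : ∀ (k : ℕ), ∀ x ∈ S k, (T' ⟶ (X.obj (op ⦋k + 1⦌)).left)) (d : T'' ⟶ T')
    (k : ℕ) (x : T ⟶ (X.obj (op ⦋k⦌)).left) (t : T'' ⟶ (X.obj (op ⦋k + 1⦌)).left) : Prop :=
  match k, x, t with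
  | 0, x, t => ∀ e he, x ≫ (X.obj (op ⦋0⦌)).hom = e → t ≫ (X.δ 1).left = d ≫ v e he
  | k + 1, x, t => ∀ (j : Fin (k + 2)) (hj : x ≫ (X.δ j).left ∈ S k),
      t ≫ (X.δ j.succ).left = d ≫ s k _ hj

theorem HasConeFaces.comp {T T' T'' : I} {S₀ : Set (T ⟶ i)}
    {S : ∀ k : ℕ, Set (T ⟶ (X.obj (op ⦋k⦌)).left)}
    {v : ∀ e ∈ S₀, (T' ⟶ (X.obj (op ⦋0⦌)).left)}
    {s : ∀ (k : ℕ), ∀ x ∈ S k, (T' ⟶ (X.obj (op ⦋k + 1⦌)).left)} {d : T'' ⟶ T'} {k : ℕ}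
    {x : T ⟶ (X.obj (op ⦋k⦌)).left} {t : T'' ⟶ (X.obj (op ⦋k + 1⦌)).left}
    (h : HasConeFaces X v s d k x t) {U : I} (a : U ⟶ T'') :
    HasConeFaces X v s (a ≫ d) k x (a ≫ t) := by
  cases k with
  | zero => exact fun e he hx => by rw [Category.assoc, h e he hx, Category.assoc]
  | succ k => exact fun j hj => by rw [Category.assoc, h j hj, Category.assoc]

theorem IsLocalCone.hasConeFaces {T T' : I} {c : T' ⟶ T} {S₀ : Set (T ⟶ i)}
    {S : ∀ k : ℕ, Set (T ⟶ (X.obj (op ⦋k⦌)).left)}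
    {v : ∀ e ∈ S₀, (T' ⟶ (X.obj (op ⦋0⦌)).left)}
    {s : ∀ (k : ℕ), ∀ x ∈ S k, (T' ⟶ (X.obj (op ⦋k + 1⦌)).left)}
    (h : IsLocalCone X c S₀ S v s) {k : ℕ} (x : T ⟶ (X.obj (op ⦋k⦌)).left) (hx : x ∈ S k) :
    HasConeFaces X v s (𝟙 T') k x (s k x hx) := by
  cases k with
  | zero => exact fun e he hx' => by rw [h.δ_one _ hx e he hx', Category.id_comp]
  | succ k => exact fun j hj => by rw [h.δ_succ _ _ _ hj, Category.id_comp]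

theorem IsReedy.exists_filling_over (hX : IsReedy (overClass F i) X) {k : ℕ} {T : I} (e : T ⟶ i)
    (y : Fin (k + 2) → (T ⟶ (X.obj (op ⦋k⦌)).left)) (he : ∀ j, y j ≫ (X.obj (op ⦋k⦌)).hom = e)
    (hy : IsBoundaryFamily X (T := Over.mk e) fun j => Over.homMk (y j) (he j)) :
    ∃ (T' : I) (c : T' ⟶ T) (x : T' ⟶ (X.obj (op ⦋k + 1⦌)).left), F c ∧
      ∀ j, x ≫ (X.δ j).left = c ≫ y j := by
  obtain ⟨T', c, x, hc, h⟩ := hX.exists_filling hy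
  exact ⟨T'.left, c.left, x.left, hc, fun j => congr_arg CommaMorphism.left (h j)⟩

theorem IsLocalCone.comp_hom {T T' : I} {c : T' ⟶ T} {S₀ : Set (T ⟶ i)}
    {S : ∀ k : ℕ, Set (T ⟶ (X.obj (op ⦋k⦌)).left)}
    {v : ∀ e ∈ S₀, (T' ⟶ (X.obj (op ⦋0⦌)).left)}
    {s : ∀ (k : ℕ), ∀ x ∈ S k, (T' ⟶ (X.obj (op ⦋k + 1⦌)).left)}
    (h : IsLocalCone X c S₀ S v s) {k : ℕ} (x : T ⟶ (X.obj (op ⦋k⦌)).left) (hx : x ∈ S k) :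
    s k x hx ≫ (X.obj _).hom = c ≫ x ≫ (X.obj _).hom := by
  rw [← Over.w (X.δ 0), ← Category.assoc, h.δ_zero, Category.assoc]

/-- The cone on a vertex `x` is an edge between `x` and the chosen apex. Both ends lie over the same
map to `i`, so the edge exists locally. -/
theorem IsLocalCone.exists_filling_zero {T T' : I} {c : T' ⟶ T} {S₀ : Set (T ⟶ i)}
    {S : ∀ k : ℕ, Set (T ⟶ (X.obj (op ⦋k⦌)).left)}
    {v : ∀ e ∈ S₀, (T' ⟶ (X.obj (op ⦋0⦌)).left)}
    {s : ∀ (k : ℕ), ∀ x ∈ S k, (T' ⟶ (X.obj (op ⦋k + 1⦌)).left)}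
    (h : IsLocalCone X c S₀ S v s) (hX : IsReedy (overClass F i) X)
    (x : T ⟶ (X.obj (op ⦋0⦌)).left) (hx : x ≫ (X.obj (op ⦋0⦌)).hom ∈ S₀) :
    ∃ (T'' : I) (d : T'' ⟶ T'), F d ∧ ∃ t : T'' ⟶ (X.obj (op ⦋1⦌)).left,
      t ≫ (X.δ 0).left = d ≫ c ≫ x ∧ HasConeFaces X v s d 0 x t := by
  obtain ⟨T'', d, t, hd, ht⟩ := hX.exists_filling_over (k := 0) (c ≫ x ≫ (X.obj (op ⦋0⦌)).hom)
    ![c ≫ x, v _ hx] (fun j => by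
      fin_cases j
      · simp
      · simp [h.v_hom]) (isBoundaryFamily_zero _ _)
  refine ⟨T'', d, hd, t, by simpa using ht 0, ?_⟩
  rintro e he rfl
  simpa using ht 1

/-- The prescribed boundary has `x` as face `0` and the cones on the faces of `x` as its other
faces. These fit together by the simplicial identities for `X`, so a filling exists locally. -/
theorem IsLocalCone.exists_filling_succ {T T' : I} {c : T' ⟶ T} {S₀ : Set (T ⟶ i)}
    {S : ∀ k : ℕ, Set (T ⟶ (X.obj (op ⦋k⦌)).left)}
    {v : ∀ e ∈ S₀, (T' ⟶ (X.obj (op ⦋0⦌)).left)}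
    {s : ∀ (k : ℕ), ∀ x ∈ S k, (T' ⟶ (X.obj (op ⦋k + 1⦌)).left)}
    (h : IsLocalCone X c S₀ S v s) (hX : IsReedy (overClass F i) X)
    (hδ : ∀ k, ∀ x ∈ S (k + 1), ∀ j, x ≫ (X.δ j).left ∈ S k)
    (hS' : ∀ x ∈ S 0, x ≫ (X.obj (op ⦋0⦌)).hom ∈ S₀) {k : ℕ}
    (x : T ⟶ (X.obj (op ⦋k + 1⦌)).left) (hx : ∀ j, x ≫ (X.δ j).left ∈ S k) :
    ∃ (T'' : I) (d : T'' ⟶ T'), F d ∧ ∃ t : T'' ⟶ (X.obj (op ⦋k + 2⦌)).left,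
      t ≫ (X.δ 0).left = d ≫ c ≫ x ∧ HasConeFaces X v s d (k + 1) x t := by
  obtain ⟨T'', d, t, hd, ht⟩ := hX.exists_filling_over (k := k + 1)
    (c ≫ x ≫ (X.obj (op ⦋k + 1⦌)).hom)
    (fun j => Fin.cases (c ≫ x) (fun j => s k _ (hx j)) j) (fun j => by
      cases j using Fin.cases with
      | zero => simp
      | succ j => simp [h.comp_hom]) (isBoundaryFamily_succ _ _ (by
        intro a b hab
        ext
        cases a using Fin.cases with
        | zero =>
          change s k _ (hx b) ≫ (X.δ 0).left = (c ≫ x) ≫ (X.δ b).left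
          rw [h.δ_zero, Category.assoc]
        | succ a =>
          cases b using Fin.cases with
          | zero => simp at hab
          | succ b =>
            change s k _ (hx b.succ) ≫ (X.δ a.succ).left =
              s k _ (hx a.castSucc) ≫ (X.δ b.succ).left
            cases k with
            -- The cones on the two ends of an edge must share their apex. They do, because the apex
            -- depends only on the map to `i`, which is the same for both ends.
            | zero =>
              obtain rfl : a = 0 := Subsingleton.elim (α := Fin 1) _ _
              obtain rfl : b = 0 := Subsingleton.elim (α := Fin 1) _ _
              refine (h.δ_one _ _ _ (hS' _ (hx 1)) rfl).trans (h.δ_one _ _ _ _ ?_).symm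
              simp
            | succ k =>
              have e := congr_arg CommaMorphism.left
                (X.δ_comp_δ (i := a) (j := b) (by simpa using hab))
              simp only [Over.comp_left] at e
              have e' : (x ≫ (X.δ b.succ).left) ≫ (X.δ a).left =
                  (x ≫ (X.δ a.castSucc).left) ≫ (X.δ b).left := by
                rw [Category.assoc, Category.assoc, e]
              rw [h.δ_succ _ _ _ (hδ _ _ (hx _) _), h.δ_succ _ _ _ (hδ _ _ (hx _) _)]
              congr 1))
  exact ⟨T'', d, hd, t, by simpa using ht 0, fun j hj => by simpa using ht (Fin.succ j)⟩

/-- Induction on dimension: choose the apexes, then fill the cones on simplices of dimension `0`,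
`1`, and so on, passing in each dimension to a common cover for the finitely many fillings. -/
theorem exists_isLocalCone [F.IsMultiplicative] (hX : IsReedy (overClass F i) X) {T : I} {S₀ : Set (T ⟶ i)}
    (hS₀ : S₀.Finite) (n : ℕ) (S : ∀ k : ℕ, Set (T ⟶ (X.obj (op ⦋k⦌)).left))
    (hS : ∀ k, (S k).Finite) (hn : ∀ k, n ≤ k → S k = ∅)
    (hδ : ∀ k, ∀ x ∈ S (k + 1), ∀ j, x ≫ (X.δ j).left ∈ S k)
    (hS' : ∀ x ∈ S 0, x ≫ (X.obj (op ⦋0⦌)).hom ∈ S₀) :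
    ∃ (T' : I) (c : T' ⟶ T) (v : ∀ e ∈ S₀, (T' ⟶ (X.obj (op ⦋0⦌)).left))
      (s : ∀ (k : ℕ), ∀ x ∈ S k, (T' ⟶ (X.obj (op ⦋k + 1⦌)).left)),
      F c ∧ IsLocalCone X c S₀ S v s := by
  induction n generalizing S with
  | zero =>
    -- Apexes exist locally because the augmentation of `X_0` to `i` is in `F`.
    obtain ⟨T', c, hc, h⟩ := exists_common_cover F hS₀
      (fun e T' c => ∃ v : T' ⟶ (X.obj (op ⦋0⦌)).left, v ≫ (X.obj (op ⦋0⦌)).hom = c ≫ e)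
      (fun e T' T'' d c ⟨v, hv⟩ => ⟨d ≫ v, by simp [hv]⟩) (fun e _ => by
        obtain ⟨_, _, _, _, h⟩ := isReedy_hom_mem F hX 0
        have := F.hasPullback e h
        exact ⟨_, _, F.pullback_snd _ _ h, pullback.fst _ e, pullback.condition⟩)
    choose v hv using h
    have h0 {k : ℕ} {x} (hx : x ∈ S k) : False := by simp [hn k k.zero_le] at hx
    exact ⟨T', c, v, fun k x hx => (h0 hx).elim, hc, hv, fun x hx => (h0 hx).elim,
      fun x hx => (h0 hx).elim, fun x hx => (h0 hx).elim⟩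
  | succ n ih =>
    obtain ⟨T', c, v, s, hc, h⟩ := ih (fun k => {x | x ∈ S k ∧ k < n})
      (fun k => (hS k).subset fun x hx => hx.1)
      (fun k hk => by ext x; simp; omega)
      (fun k x hx j => ⟨hδ k x hx.1 j, by have := hx.2; omega⟩)
      (fun x hx => hS' x hx.1)
    have step : ∃ (T'' : I) (d : T'' ⟶ T'), F d ∧ ∀ x ∈ S n,
        ∃ t : T'' ⟶ (X.obj (op ⦋n + 1⦌)).left, t ≫ (X.δ 0).left = d ≫ c ≫ x ∧
          HasConeFaces X v s d n x t := by
      refine exists_common_cover F (hS n) _ ?_ ?_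
      · rintro x T' T'' a d ⟨t, h₁, h₂⟩
        exact ⟨a ≫ t, by rw [Category.assoc, h₁, Category.assoc], h₂.comp a⟩
      · intro x hx
        cases n with
        | zero => exact h.exists_filling_zero hX x (hS' x hx)
        | succ n =>
          exact h.exists_filling_succ hX
            (fun k x hx j => ⟨hδ k x hx.1 j, by have := hx.2; omega⟩)
            (fun x hx => hS' x hx.1) x (fun j => ⟨hδ n x hx j, n.lt_succ_self⟩)
    obtain ⟨T'', d, hd, step⟩ := step
    -- In dimensions below `n` the old cones are restricted along `d` and not chosen anew, since the
    -- new cones in dimension `n` were filled with these as faces.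
    have total (k : ℕ) (x) (hx : x ∈ S k) : ∃ t : T'' ⟶ (X.obj (op ⦋k + 1⦌)).left,
        (t ≫ (X.δ 0).left = d ≫ c ≫ x ∧ HasConeFaces X v s d k x t) ∧
          ∀ hx' : x ∈ S k ∧ k < n, t = d ≫ s k x hx' := by
      by_cases hk : k < n
      · refine ⟨d ≫ s k x ⟨hx, hk⟩, ⟨?_, ?_⟩, fun _ => rfl⟩
        · rw [Category.assoc, h.δ_zero]
        · simpa using (h.hasConeFaces x ⟨hx, hk⟩).comp d
      · by_cases hk' : k = n
        · subst hk'
          obtain ⟨t, ht⟩ := step x hx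
          exact ⟨t, ht, fun h => (hk h.2).elim⟩
        · simp [hn k (by omega)] at hx
    choose t ht ht' using total
    refine ⟨T'', d ≫ c, fun e he => d ≫ v e he, t, F.comp_mem _ _ hd hc, ?_, ?_, ?_, ?_⟩
    · intro e he
      rw [Category.assoc, h.v_hom, Category.assoc]
    · intro k x hx
      rw [(ht k x hx).1, Category.assoc]
    · intro k x hx j hj
      have hk : k < n := by
        by_contra hk
        simp [hn (k + 1) (by omega)] at hx
      rw [ht' k _ hj ⟨hj, hk⟩]
      exact (ht (k + 1) x hx).2 j ⟨hj, hk⟩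
    · intro x hx e he hxe
      exact (ht 0 x hx).2 e he hxe

/-- After passing to a covering `T' ⟶ T`, finitely many simplices of `X(T)` are cones, up to
boundaries. The groups `B k` play the role of chain groups of `X(T')`. -/
theorem exists_local_homotopy [F.IsMultiplicative] (hX : IsReedy (overClass F i) X) {T : I} {n : ℕ}
    {A : Set (T ⟶ (X.obj (op ⦋n⦌)).left)} (hA : A.Finite) :
    ∃ (T' : I) (c : T' ⟶ T) (S : ∀ k : ℕ, Set (T ⟶ (X.obj (op ⦋k⦌)).left)), F c ∧ A ⊆ S n ∧
      ∀ (B : ℕ → Type*) [∀ k, AddCommGroup (B k)] (β : ∀ k, (T' ⟶ (X.obj (op ⦋k⦌)).left) → B k)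
        (d : ∀ k, B (k + 1) →+ B k)
        (_ : ∀ k x, d k (β (k + 1) x) =
          ∑ j : Fin (k + 2), (-1 : ℤ) ^ (j : ℕ) • β k (x ≫ (X.δ j).left)),
        ∃ (τ : (T ⟶ i) → B 0) (σ : ∀ k, (T ⟶ (X.obj (op ⦋k⦌)).left) → B (k + 1)),
          (∀ x ∈ S 0, d 0 (σ 0 x) + τ (x ≫ (X.obj (op ⦋0⦌)).hom) = β 0 (c ≫ x)) ∧
          ∀ k, ∀ x ∈ S (k + 1), d (k + 1) (σ (k + 1) x) +
            ∑ j : Fin (k + 2), (-1 : ℤ) ^ (j : ℕ) • σ k (x ≫ (X.δ j).left) =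
              β (k + 1) (c ≫ x) := by
  classical
  let S₀ : Set (T ⟶ i) := (fun x => x ≫ (X.obj (op ⦋n⦌)).hom) '' A
  -- The closure of `A` under simplicial operators, cut off above dimension `n`. The cutoff keeps it
  -- stable under faces and makes it empty from degree `n + 1` on, as the induction on dimension
  -- requires.
  let S (k : ℕ) : Set (T ⟶ (X.obj (op ⦋k⦌)).left) :=
    {y | k ≤ n ∧ ∃ x ∈ A, ∃ θ : ⦋k⦌ ⟶ ⦋n⦌, x ≫ (X.map θ.op).left = y}
  have hδ (k : ℕ) (x) (hx : x ∈ S (k + 1)) (j : Fin (k + 2)) : x ≫ (X.δ j).left ∈ S k := by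
    obtain ⟨hk, x, hx, θ, rfl⟩ := hx
    refine ⟨by omega, x, hx, SimplexCategory.δ j ≫ θ, ?_⟩
    rw [op_comp, X.map_comp, Over.comp_left, Category.assoc]
    rfl
  have h₀ (x) (hx : x ∈ S 0) : x ≫ (X.obj (op ⦋0⦌)).hom ∈ S₀ := by
    obtain ⟨hk, x, hx, θ, rfl⟩ := hx
    exact ⟨x, hx, by simp⟩
  obtain ⟨T', c, v, s, hc, h⟩ := exists_isLocalCone hX (hA.image _ : S₀.Finite) (n + 1) S
    (fun k => ((hA.prod (Set.finite_univ (α := ⦋k⦌ ⟶ ⦋n⦌))).image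
      (fun p => p.1 ≫ (X.map p.2.op).left)).subset (by
        rintro _ ⟨hk, x, hx, θ, rfl⟩
        exact ⟨(x, θ), ⟨hx, trivial⟩, rfl⟩))
    (fun k hk => by
      ext x
      simp only [Set.mem_empty_iff_false, iff_false]
      rintro ⟨h, -⟩
      omega) hδ h₀
  refine ⟨T', c, S, hc, fun x hx => ⟨le_rfl, x, hx, 𝟙 _, by simp⟩, ?_⟩
  intro B _ β d hd
  -- The operator has to be total in order to be extended linearly later. Its value `0` off `S`
  -- never enters the identities, because `S` contains the faces of its members.
  let σ (k : ℕ) (x : T ⟶ (X.obj (op ⦋k⦌)).left) : B (k + 1) :=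
    if hx : x ∈ S k then β (k + 1) (s k x hx) else 0
  have hσ {k : ℕ} (x) (hx : x ∈ S k) : σ k x = β (k + 1) (s k x hx) := dif_pos hx
  refine ⟨fun e => if he : e ∈ S₀ then β 0 (v e he) else 0, σ, fun x hx => ?_, fun k x hx => ?_⟩
  · have e : s 0 x hx ≫ (X.δ 1).left = _ := h.δ_one x hx _ (h₀ x hx) rfl
    dsimp only
    rw [dif_pos (h₀ x hx), hσ x hx, hd, Fin.sum_univ_two, h.δ_zero x hx, e]
    simp
  -- Face `0` of the cone on `x` is the restriction of `x`; face `j + 1` is the cone on face `j` of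
  -- `x`, and appears with the opposite sign.
  · rw [hσ x hx, hd, Fin.sum_univ_succ, h.δ_zero x hx, add_assoc, ← Finset.sum_add_distrib,
      Finset.sum_eq_zero, add_zero]
    · simp
    · intro j _
      rw [h.δ_succ x hx j (hδ k x hx j), hσ _ (hδ k x hx j), ← add_smul]
      simp [pow_succ]

end LocalCones

/-! ### Chain homotopies in the free preadditive category -/

noncomputable section Chains

variable {I : Type w} [SmallCategory I]

/-- The free preadditive category on `I`. -/
abbrev fr : I ⥤ Free ℤ I := Free.embedding ℤ I

theorem fr_hom_eq_sum {T X : I} (z : fr.obj T ⟶ fr.obj X) :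
    ∃ (A : Finset (T ⟶ X)) (a : (T ⟶ X) → ℤ), z = ∑ x ∈ A, a x • fr.map x := by
  let z' : (T ⟶ X) →₀ ℤ := z
  refine ⟨z'.support, z', ?_⟩
  refine (Finsupp.sum_single z').symm.trans (Finset.sum_congr rfl fun x _ => ?_)
  refine (?_ : Finsupp.single x (z' x) = z' x • Finsupp.single x (1 : ℤ))
  simp

theorem exists_fr_extension {T X : I} {B : Type*} [AddCommGroup B] (σ : (T ⟶ X) → B) :
    ∃ Φ : (fr.obj T ⟶ fr.obj X) →+ B, ∀ x, Φ (fr.map x) = σ x := by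
  let Φ : ((T ⟶ X) →₀ ℤ) →+ B := Finsupp.liftAddHom fun x => (zmultiplesHom B) (σ x)
  refine ⟨Φ, fun x => ?_⟩
  refine (?_ : Φ (Finsupp.single x 1) = σ x)
  simp [Φ]

/-- The differential of the chain complex of `X` in the free preadditive category. -/
def frD (X : SimplicialObject I) (k : ℕ) :
    fr.obj (X.obj (op ⦋k + 1⦌)) ⟶ fr.obj (X.obj (op ⦋k⦌)) :=
  ∑ j : Fin (k + 2), (-1 : ℤ) ^ (j : ℕ) • fr.map (X.δ j)

theorem frD_comp_frD (X : SimplicialObject I) (k : ℕ) : frD X (k + 1) ≫ frD X k = 0 :=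
  AlgebraicTopology.AlternatingFaceMapComplex.d_squared
    (((SimplicialObject.whiskering I (Free ℤ I)).obj fr).obj X) k

theorem frD_naturality {X Y : SimplicialObject I} (f : X ⟶ Y) (k : ℕ) :
    frD X k ≫ fr.map (f.app _) = fr.map (f.app _) ≫ frD Y k := by
  simp only [frD, Preadditive.sum_comp, Preadditive.comp_sum, Preadditive.zsmul_comp,
    Preadditive.comp_zsmul]
  refine Finset.sum_congr rfl fun j _ => ?_
  rw [← Functor.map_comp, ← Functor.map_comp]
  congr 2
  exact f.naturality _

theorem fr_comp_frD {T : I} (X : SimplicialObject I) (k : ℕ) (x : T ⟶ X.obj (op ⦋k + 1⦌)) :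
    fr.map x ≫ frD X k = ∑ j : Fin (k + 2), (-1 : ℤ) ^ (j : ℕ) • fr.map (x ≫ X.δ j) := by
  simp only [frD, Preadditive.comp_sum, Preadditive.comp_zsmul, Functor.map_comp]

variable {F : MorphismProperty I} [F.IsMultiplicative] [F.HasPullbacks]
  [F.IsStableUnderBaseChange] {i : I} {X : SimplicialObject (Over i)}

/-- The augmentation of a simplicial object of `I/i`. -/
def augmentation (X : SimplicialObject (Over i)) (k : ℕ) :
    ((total i).obj X).obj (op ⦋k⦌) ⟶ i :=
  (X.obj (op ⦋k⦌)).hom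

theorem map_augmentation {X Y : SimplicialObject (Over i)} (f : X ⟶ Y) (k : ℕ) :
    ((total i).map f).app (op ⦋k⦌) ≫ augmentation Y k = augmentation X k :=
  Over.w (f.app (op ⦋k⦌))

theorem δ_augmentation (X : SimplicialObject (Over i)) (k : ℕ) (j : Fin (k + 2)) :
    ((total i).obj X).δ j ≫ augmentation X k = augmentation X (k + 1) :=
  Over.w (X.δ j)

theorem exists_local_homotopy_total (hX : IsReedy (overClass F i) X) {T : I} {n : ℕ}
    {A : Set (T ⟶ ((total i).obj X).obj (op ⦋n⦌))} (hA : A.Finite) :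
    ∃ (T' : I) (c : T' ⟶ T) (S : ∀ k : ℕ, Set (T ⟶ ((total i).obj X).obj (op ⦋k⦌))), F c ∧
      A ⊆ S n ∧ ∀ (B : ℕ → Type w) [∀ k, AddCommGroup (B k)]
        (β : ∀ k, (T' ⟶ ((total i).obj X).obj (op ⦋k⦌)) → B k) (d : ∀ k, B (k + 1) →+ B k)
        (_ : ∀ k x, d k (β (k + 1) x) =
          ∑ j : Fin (k + 2), (-1 : ℤ) ^ (j : ℕ) • β k (x ≫ ((total i).obj X).δ j)),
        ∃ (τ : (T ⟶ i) → B 0) (σ : ∀ k, (T ⟶ ((total i).obj X).obj (op ⦋k⦌)) → B (k + 1)),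
          (∀ x ∈ S 0, d 0 (σ 0 x) + τ (x ≫ augmentation X 0) = β 0 (c ≫ x)) ∧
          ∀ k, ∀ x ∈ S (k + 1), d (k + 1) (σ (k + 1) x) +
            ∑ j : Fin (k + 2), (-1 : ℤ) ^ (j : ℕ) • σ k (x ≫ ((total i).obj X).δ j) =
              β (k + 1) (c ≫ x) :=
  exists_local_homotopy hX hA

/-- The cones give `d σ + τ ε = 1` on the simplices occurring in `z`, with `ε` the augmentation.
Extended linearly, `τ` takes `z ε = 0` to zero, so the cone on `z` bounds the restriction of `z`. -/
theorem exists_fr_boundary_zero (hX : IsReedy (overClass F i) X) {T : I}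
    (z : fr.obj T ⟶ fr.obj (((total i).obj X).obj (op ⦋0⦌)))
    (hz : z ≫ fr.map (augmentation X 0) = 0) :
    ∃ (T' : I) (c : T' ⟶ T) (y : fr.obj T' ⟶ fr.obj (((total i).obj X).obj (op ⦋1⦌))), F c ∧
      y ≫ frD ((total i).obj X) 0 = fr.map c ≫ z := by
  obtain ⟨A, a, rfl⟩ := fr_hom_eq_sum z
  obtain ⟨T', c, S, hc, hA, h⟩ := exists_local_homotopy_total hX A.finite_toSet
  obtain ⟨τ, σ, h, -⟩ := h (fun k => fr.obj T' ⟶ fr.obj (((total i).obj X).obj (op ⦋k⦌)))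
    (fun k x => fr.map x) (fun k => Preadditive.rightComp _ (frD _ k))
    (fun k x => fr_comp_frD ((total i).obj X) k x)
  obtain ⟨Φ, hΦ⟩ := exists_fr_extension τ
  refine ⟨T', c, ∑ x ∈ A, a x • σ 0 x, hc, ?_⟩
  have e := congr_arg Φ hz
  simp only [Preadditive.sum_comp, Preadditive.zsmul_comp, ← Functor.map_comp, map_sum,
    map_zsmul, map_zero, hΦ] at e
  rw [Preadditive.sum_comp, Preadditive.comp_sum, ← add_zero (∑ x ∈ A, _), ← e,
    ← Finset.sum_add_distrib]
  refine Finset.sum_congr rfl fun x hx => ?_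
  rw [Preadditive.zsmul_comp, Preadditive.comp_zsmul, ← Functor.map_comp, ← h x (hA hx), smul_add]
  rfl

/-- As in degree zero, with the term `σ d` in place of `τ ε`: it vanishes on `z` because `z` is a
cycle. -/
theorem exists_fr_boundary_succ (hX : IsReedy (overClass F i) X) {T : I} {k : ℕ}
    (z : fr.obj T ⟶ fr.obj (((total i).obj X).obj (op ⦋k + 1⦌)))
    (hz : z ≫ frD ((total i).obj X) k = 0) :
    ∃ (T' : I) (c : T' ⟶ T) (y : fr.obj T' ⟶ fr.obj (((total i).obj X).obj (op ⦋k + 2⦌))), F c ∧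
      y ≫ frD ((total i).obj X) (k + 1) = fr.map c ≫ z := by
  obtain ⟨A, a, rfl⟩ := fr_hom_eq_sum z
  obtain ⟨T', c, S, hc, hA, h⟩ := exists_local_homotopy_total hX A.finite_toSet
  obtain ⟨τ, σ, -, h⟩ := h (fun k => fr.obj T' ⟶ fr.obj (((total i).obj X).obj (op ⦋k⦌)))
    (fun k x => fr.map x) (fun k => Preadditive.rightComp _ (frD _ k))
    (fun k x => fr_comp_frD ((total i).obj X) k x)
  obtain ⟨Φ, hΦ⟩ := exists_fr_extension (σ k)
  refine ⟨T', c, ∑ x ∈ A, a x • σ (k + 1) x, hc, ?_⟩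
  have e := congr_arg Φ hz
  simp only [Preadditive.sum_comp, Preadditive.zsmul_comp, fr_comp_frD, map_sum,
    map_zsmul, map_zero, hΦ] at e
  rw [Preadditive.sum_comp, Preadditive.comp_sum, ← add_zero (∑ x ∈ A, _), ← e,
    ← Finset.sum_add_distrib]
  refine Finset.sum_congr rfl fun x hx => ?_
  rw [Preadditive.zsmul_comp, Preadditive.comp_zsmul, ← Functor.map_comp, ← h k x (hA hx),
    smul_add]
  rfl

/-- The refinement of a hypercovering by a covering of its `n`-th term. -/
theorem exists_hcov_refinement (X : HCov F i) {n : ℕ} {T : I}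
    {c : T ⟶ ((total i).obj X.obj).obj (op ⦋n⦌)} (hc : F c) :
    ∃ (X' : HCov F i) (φ : X' ⟶ X) (a : ((total i).obj X'.obj).obj (op ⦋n⦌) ⟶ T),
      a ≫ c = ((total i).map φ.hom).app (op ⦋n⦌) := by
  obtain ⟨X', hX', φ, a, h⟩ := exists_refinement X.property
    (A := Over.mk (c ≫ augmentation X.obj n)) (c := Over.homMk c) hc
  exact ⟨⟨X', hX'⟩, ObjectProperty.homMk φ, a.left, congr_arg CommaMorphism.left h⟩

/-- The degree `k` part of `d ≫ H`, for a homotopy `H` between the chain complexes of `Z`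
and `Y` in the free preadditive category. -/
def frPrev {Z Y : SimplicialObject I}
    (H : ∀ k : ℕ, fr.obj (Z.obj (op ⦋k⦌)) ⟶ fr.obj (Y.obj (op ⦋k + 1⦌))) (k : ℕ) :
    fr.obj (Z.obj (op ⦋k⦌)) ⟶ fr.obj (Y.obj (op ⦋k⦌)) :=
  match k with
  | 0 => 0
  | k + 1 => frD Z k ≫ H k

theorem frPrev_congr {Z Y : SimplicialObject I}
    {H H' : ∀ k : ℕ, fr.obj (Z.obj (op ⦋k⦌)) ⟶ fr.obj (Y.obj (op ⦋k + 1⦌))} {k : ℕ}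
    (h : ∀ j < k, H j = H' j) : frPrev H k = frPrev H' k := by
  cases k with
  | zero => rfl
  | succ k => exact congr(frD Z k ≫ $(h k k.lt_succ_self))

theorem comp_frPrev {Z' Z Y : SimplicialObject I} (φ : Z' ⟶ Z)
    (H : ∀ k : ℕ, fr.obj (Z.obj (op ⦋k⦌)) ⟶ fr.obj (Y.obj (op ⦋k + 1⦌))) (k : ℕ) :
    fr.map (φ.app _) ≫ frPrev H k = frPrev (fun k => fr.map (φ.app _) ≫ H k) k := by
  cases k with
  | zero => exact comp_zero
  | succ k =>
    change _ ≫ frD Z k ≫ H k = frD Z' k ≫ _ ≫ H k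
    rw [← Category.assoc, ← Category.assoc, frD_naturality]

/-- The homotopy is built degree by degree. In degree `N` its obstruction is a cycle in `Y` over
`Z_N`, hence a boundary over some cover of `Z_N`, and a refinement of `Z` factors through that
cover. Each degree costs a refinement, so only finitely many degrees are treated. -/
theorem exists_fr_homotopy {X Y : HCov F i} (f g : X ⟶ Y) (N : ℕ) :
    ∃ (Z : HCov F i) (h : Z ⟶ X) (H : ∀ k : ℕ, fr.obj (((total i).obj Z.obj).obj (op ⦋k⦌)) ⟶
      fr.obj (((total i).obj Y.obj).obj (op ⦋k + 1⦌))), ∀ k < N,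
      fr.map (((total i).map (h ≫ f).hom).app (op ⦋k⦌)) -
        fr.map (((total i).map (h ≫ g).hom).app (op ⦋k⦌)) =
      H k ≫ frD ((total i).obj Y.obj) k + frPrev H k := by
  induction N with
  | zero => exact ⟨X, 𝟙 X, fun k => 0, fun k hk => (Nat.not_lt_zero k hk).elim⟩
  | succ N ih =>
    obtain ⟨Z, h, H, hH⟩ := ih
    obtain ⟨T, c, y, hc, hy⟩ : ∃ (T : I) (c : T ⟶ ((total i).obj Z.obj).obj (op ⦋N⦌))
        (y : fr.obj T ⟶ fr.obj (((total i).obj Y.obj).obj (op ⦋N + 1⦌))), F c ∧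
        y ≫ frD ((total i).obj Y.obj) N = fr.map c ≫
          (fr.map (((total i).map (h ≫ f).hom).app (op ⦋N⦌)) -
            fr.map (((total i).map (h ≫ g).hom).app (op ⦋N⦌)) - frPrev H N) := by
      cases N with
      | zero =>
        refine exists_fr_boundary_zero Y.property _ ?_
        change (_ - _ - 0) ≫ _ = _
        rw [sub_zero, Preadditive.sub_comp, ← Functor.map_comp, ← Functor.map_comp,
          map_augmentation, map_augmentation, sub_self]
      | succ N =>
        refine exists_fr_boundary_succ Y.property _ ?_
        change (_ - _ - frD _ N ≫ H N) ≫ _ = _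
        -- The obstruction is a cycle: by the homotopy identity in the previous degree, its boundary
        -- is `d` composed with `frPrev`, which vanishes because `d² = 0`.
        rw [Preadditive.sub_comp, Preadditive.sub_comp, ← frD_naturality, ← frD_naturality,
          ← Preadditive.comp_sub, hH N N.lt_succ_self, Category.assoc, ← Preadditive.comp_sub,
          add_sub_cancel_left]
        cases N with
        | zero => exact comp_zero
        | succ N =>
          change _ ≫ frD _ _ ≫ _ = _
          rw [← Category.assoc, frD_comp_frD, zero_comp]
    obtain ⟨Z', φ, a, ha⟩ := exists_hcov_refinement Z hc
    refine ⟨Z', φ ≫ h, Function.update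
      (fun k => fr.map (((total i).map φ.hom).app _) ≫ H k) N (fr.map a ≫ y), fun k hk => ?_⟩
    have e : fr.map (((total i).map ((φ ≫ h) ≫ f).hom).app (op ⦋k⦌)) -
        fr.map (((total i).map ((φ ≫ h) ≫ g).hom).app (op ⦋k⦌)) =
        fr.map (((total i).map φ.hom).app (op ⦋k⦌)) ≫
          (fr.map (((total i).map (h ≫ f).hom).app (op ⦋k⦌)) -
            fr.map (((total i).map (h ≫ g).hom).app (op ⦋k⦌))) := by
      rw [Preadditive.comp_sub, ← Functor.map_comp, ← Functor.map_comp, Category.assoc,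
        Category.assoc]
      rfl
    -- `frPrev` in degree `k` sees the homotopy only below `k`, and `k ≤ N`, so the new component in
    -- degree `N` does not disturb it.
    have e' : frPrev (Function.update
        (fun k => fr.map (((total i).map φ.hom).app _) ≫ H k) N (fr.map a ≫ y)) k =
        fr.map (((total i).map φ.hom).app _) ≫ frPrev H k := by
      rw [comp_frPrev]
      exact frPrev_congr fun j hj => Function.update_of_ne (by omega) _ _
    rw [e, e']
    by_cases hkN : k = N
    · subst hkN
      rw [Function.update_self, Category.assoc, hy, ← Category.assoc, ← Functor.map_comp, ha,
        ← Preadditive.comp_add, sub_add_cancel]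
    · rw [Function.update_of_ne hkN, hH k (by omega), Preadditive.comp_add, Category.assoc]

end Chains

/-! ### Unnormalized cochains, and maps that agree on cohomology -/

noncomputable section Cochains

section Moore

variable {E : Type u} [Category.{w} E] [Abelian E]

/-- The unnormalized cochain complex of a cosimplicial object, given as a simplicial object of the
opposite category. -/
abbrev altCochains : (SimplicialObject Eᵒᵖ)ᵒᵖ ⥤ HomologicalComplex E (ComplexShape.down ℕ).symm :=
  (AlgebraicTopology.alternatingFaceMapComplex Eᵒᵖ).op ⋙
    HomologicalComplex.unopFunctor E (ComplexShape.down ℕ)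

instance isIso_homologyMap_inclusion {A : Type u} [Category.{w} A] [Abelian A]
    (S : SimplicialObject A) (n : ℕ) : IsIso (HomologicalComplex.homologyMap
      ((AlgebraicTopology.inclusionOfMooreComplex A).app S) n) := by
  have : QuasiIso ((AlgebraicTopology.inclusionOfMooreComplex A).app S) :=
    (AlgebraicTopology.DoldKan.homotopyEquivNormalizedMooreComplexAlternatingFaceMapComplex
      (A := A) (Y := S)).quasiIso_hom
  infer_instance

theorem homologyUnop_naturality {K L : ChainComplex Eᵒᵖ ℕ} (φ : K ⟶ L) (n : ℕ) :
    HomologicalComplex.homologyMap ((HomologicalComplex.unopFunctor E _).map φ.op) n ≫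
      (K.homologyUnop n).hom = (L.homologyUnop n).hom ≫
        (HomologicalComplex.homologyMap φ n).unop := by
  apply Quiver.Hom.op_inj
  have := HomologicalComplex.homologyOp_hom_naturality
    ((HomologicalComplex.unopFunctor E _).map φ.op) n
  exact this.symm

/-- The normalized and unnormalized cochain complexes have the same cohomology. -/
def mooreIso (n : ℕ) : altCochains ⋙ HomologicalComplex.homologyFunctor E _ n ≅
    (AlgebraicTopology.normalizedMooreComplex Eᵒᵖ ⋙
      HomologicalComplex.homologyFunctor Eᵒᵖ _ n).leftOp :=
  NatIso.ofComponents (fun S => HomologicalComplex.homologyUnop _ n ≪≫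
    (asIso (HomologicalComplex.homologyMap
      ((AlgebraicTopology.inclusionOfMooreComplex Eᵒᵖ).app S.unop) n)).unop) (by
    intro S S' f
    have h₁ := homologyUnop_naturality ((AlgebraicTopology.alternatingFaceMapComplex Eᵒᵖ).map f.unop) n
    have h₂ : (HomologicalComplex.homologyMap
        ((AlgebraicTopology.alternatingFaceMapComplex Eᵒᵖ).map f.unop) n).unop ≫
        (HomologicalComplex.homologyMap
          ((AlgebraicTopology.inclusionOfMooreComplex Eᵒᵖ).app S'.unop) n).unop =
        (HomologicalComplex.homologyMap
          ((AlgebraicTopology.inclusionOfMooreComplex Eᵒᵖ).app S.unop) n).unop ≫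
        (HomologicalComplex.homologyMap
          ((AlgebraicTopology.normalizedMooreComplex Eᵒᵖ).map f.unop) n).unop := by
      rw [← unop_comp, ← unop_comp, ← HomologicalComplex.homologyMap_comp,
        ← HomologicalComplex.homologyMap_comp, NatTrans.naturality]
    change HomologicalComplex.homologyMap ((HomologicalComplex.unopFunctor E _).map
      ((AlgebraicTopology.alternatingFaceMapComplex Eᵒᵖ).map f.unop).op) n ≫
      (HomologicalComplex.homologyUnop _ n).hom ≫ _ =
      ((HomologicalComplex.homologyUnop _ n).hom ≫ _) ≫ _
    exact (Category.assoc _ _ _).symm.trans ((congr($h₁ ≫ _)).trans ((Category.assoc _ _ _).trans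
      ((congr(_ ≫ $h₂)).trans (Category.assoc _ _ _).symm))))

end Moore

section

variable {I : Type w} [SmallCategory I] {E : Type u} [Category.{w} E] [Abelian E]

/-- The unnormalized cochain complex of `P(X)`. -/
def cochains : (Iᵒᵖ ⥤ E) ⥤ (SimplicialObject I)ᵒᵖ ⥤
    HomologicalComplex E (ComplexShape.down ℕ).symm where
  obj P := ((SimplicialObject.whiskering I Eᵒᵖ).obj P.rightOp).op ⋙ altCochains
  map η := Functor.whiskerRight
    (NatTrans.op ((SimplicialObject.whiskering I Eᵒᵖ).map (NatTrans.rightOp η))) altCochains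
  map_id P := by
    ext X n
    rfl
  map_comp η θ := by
    ext X n
    rfl

theorem cochains_d (P : Iᵒᵖ ⥤ E) (X : SimplicialObject I) (k : ℕ) :
    ((cochains.obj P).obj (op X)).d k (k + 1) =
      ∑ j : Fin (k + 2), (-1 : ℤ) ^ (j : ℕ) • P.map (X.δ j).op := by
  have := AlgebraicTopology.alternatingFaceMapComplex_obj_d
    (((SimplicialObject.whiskering I Eᵒᵖ).obj P.rightOp).obj X) k
  refine (congr_arg Quiver.Hom.unop this).trans ?_
  simp only [AlgebraicTopology.AlternatingFaceMapComplex.objD, unop_sum, unop_zsmul]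
  rfl

@[simp]
theorem cochains_obj_map_f (P : Iᵒᵖ ⥤ E) {X Y : SimplicialObject I} (f : X ⟶ Y) (k : ℕ) :
    ((cochains.obj P).map f.op).f k = P.map (f.app (op ⦋k⦌)).op := rfl

/-- The cohomology of `P(X)` computed by unnormalized cochains. -/
def cohomologyIso (n : ℕ) (P : Iᵒᵖ ⥤ E) :
    cochains.obj P ⋙ HomologicalComplex.homologyFunctor E _ n ≅ (cohomology n).obj P :=
  Functor.isoWhiskerLeft (((SimplicialObject.whiskering I Eᵒᵖ).obj P.rightOp).op) (mooreIso n)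

theorem cohomologyIso_naturality (n : ℕ) {P Q : Iᵒᵖ ⥤ E} (η : P ⟶ Q) (X : SimplicialObject I) :
    HomologicalComplex.homologyMap ((cochains.map η).app (op X)) n ≫
      (cohomologyIso n Q).hom.app (op X) =
    (cohomologyIso n P).hom.app (op X) ≫ ((cohomology n).map η).app (op X) :=
  (mooreIso n).hom.naturality
    (((SimplicialObject.whiskering I Eᵒᵖ).map (NatTrans.rightOp η)).app X).op

/-- The term through `K.d n m` vanishes on cycles, and a boundary term vanishes in opcycles, so a
homotopy identity in the single degree `n` is enough. The alternative `b = 0` serves degree zero,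
where no boundary term is present. -/
theorem homologyMap_eq_of_sub_eq {C : Type*} [Category* C] [Abelian C] {ι : Type*}
    {c : ComplexShape ι} {K L : HomologicalComplex C c} (φ ψ : K ⟶ L) {n m : ι}
    {a : K.X m ⟶ L.X n} {b : K.X n ⟶ L.X n} (h : φ.f n - ψ.f n = K.d n m ≫ a + b)
    (hb : b = 0 ∨ ∃ (l : ι) (s : K.X n ⟶ L.X l), b = s ≫ L.d l n) :
    HomologicalComplex.homologyMap φ n = HomologicalComplex.homologyMap ψ n := by
  rw [← cancel_epi (HomologicalComplex.homologyπ _ n),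
    ← cancel_mono (HomologicalComplex.homologyι _ n)]
  simp only [Category.assoc, HomologicalComplex.homologyι_naturality,
    HomologicalComplex.homology_π_ι_assoc, HomologicalComplex.p_opcyclesMap]
  rw [← sub_eq_zero, ← Preadditive.comp_sub, ← Preadditive.sub_comp, h, Preadditive.add_comp,
    Preadditive.comp_add, Category.assoc, HomologicalComplex.iCycles_d_assoc, zero_comp, zero_add]
  obtain rfl | ⟨l, s, rfl⟩ := hb
  · rw [zero_comp, comp_zero]
  · rw [Category.assoc, HomologicalComplex.d_pOpcycles, comp_zero, comp_zero]

/-- Evaluation of `P`, as a functor on the free preadditive category. -/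
def evalFr (P : Iᵒᵖ ⥤ E) {A B : I} : (fr.obj A ⟶ fr.obj B) →+ (P.obj (op B) ⟶ P.obj (op A)) :=
  (exists_fr_extension (fun f : A ⟶ B => P.map f.op)).choose

theorem evalFr_map (P : Iᵒᵖ ⥤ E) {A B : I} (f : A ⟶ B) : evalFr P (fr.map f) = P.map f.op :=
  (exists_fr_extension (fun f : A ⟶ B => P.map f.op)).choose_spec f

theorem evalFr_comp (P : Iᵒᵖ ⥤ E) {A B C : I} (f : fr.obj A ⟶ fr.obj B) (g : fr.obj B ⟶ fr.obj C) :
    evalFr P (f ≫ g) = evalFr P g ≫ evalFr P f := by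
  obtain ⟨S, a, rfl⟩ := fr_hom_eq_sum f
  obtain ⟨T, b, rfl⟩ := fr_hom_eq_sum g
  simp only [Preadditive.sum_comp, Preadditive.comp_sum, Preadditive.zsmul_comp,
    Preadditive.comp_zsmul, map_sum, map_zsmul, evalFr_map, ← Functor.map_comp, op_comp]
  simp only [Finset.smul_sum]
  rw [Finset.sum_comm]
  refine Finset.sum_congr rfl fun x _ => Finset.sum_congr rfl fun y _ => smul_comm _ _ _

theorem evalFr_frD (P : Iᵒᵖ ⥤ E) (X : SimplicialObject I) (k : ℕ) :
    evalFr P (frD X k) = ((cochains.obj P).obj (op X)).d k (k + 1) := by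
  rw [cochains_d, frD]
  simp only [map_sum, map_zsmul, evalFr_map]

variable {F : MorphismProperty I} [F.IsMultiplicative] [F.HasPullbacks]
  [F.IsStableUnderBaseChange] {i : I}

variable (E) in
-- The additive extension of `P` to the free preadditive category turns a chain homotopy in degrees
-- below `N` into a cochain homotopy there. The refinement is found before `P` enters, so it serves
-- all `P` at once.
theorem exists_cohomology_map_eq {X Y : HCov F i} (f g : X ⟶ Y) (N : ℕ) :
    ∃ (Z : HCov F i) (h : Z ⟶ X), ∀ (P : Iᵒᵖ ⥤ E), ∀ n < N,
      ((cohomology n).obj P).map ((total i).map (h ≫ f).hom).op =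
        ((cohomology n).obj P).map ((total i).map (h ≫ g).hom).op := by
  obtain ⟨Z, h, H, hH⟩ := exists_fr_homotopy f g N
  refine ⟨Z, h, fun P n hn => ?_⟩
  rw [← cancel_epi ((cohomologyIso n P).hom.app _), ← NatTrans.naturality, ← NatTrans.naturality]
  congr 1
  have e := congr_arg (evalFr P) (hH n hn)
  rw [map_sub, evalFr_map, evalFr_map, map_add, evalFr_comp, evalFr_frD] at e
  refine homologyMap_eq_of_sub_eq _ _ e ?_
  cases n with
  | zero => exact .inl (map_zero _)
  | succ n =>
    refine .inr ⟨n, evalFr P (H n), (evalFr_comp P _ _).trans ?_⟩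
    rw [evalFr_frD]
    rfl

end
end Cochains

/-! ### Dold colimits as filtered colimits -/

theorem isReedy_const {C : Type u} [Category.{v} C] (P : MorphismProperty C) [P.ContainsIdentities]
    {T : C} (hT : IsTerminal T) : IsReedy P ((Functor.const _).obj T : SimplicialObject C) := by
  intro n
  obtain ⟨h⟩ := exists_isLimit (X := ((Functor.const _).obj T : SimplicialObject C))
    (S := boundary n) T (fun _ _ => 𝟙 T) (fun _ _ _ => hT.hom_ext _ _)
    (fun s => ⟨hT.from _, fun _ _ => hT.hom_ext _ _⟩) (fun a b _ => hT.hom_ext _ _)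
  refine ⟨_, h, ?_⟩
  have : matchingMap h = 𝟙 T := hT.hom_ext _ _
  rw [this]
  exact P.id_mem T

theorem exact_of_forall_evaluation {J : Type*} [Category* J] {C : Type*} [Category* C] [Abelian C]
    (S : ShortComplex (J ⥤ C)) (h : ∀ j, (S.map ((evaluation J C).obj j)).Exact) : S.Exact := by
  rw [ShortComplex.exact_iff_isZero_homology]
  refine Functor.isZero _ fun j => ?_
  have := h j
  rw [ShortComplex.exact_iff_isZero_homology] at this
  exact this.of_iso (S.mapHomologyIso ((evaluation J C).obj j)).symm

noncomputable section Filtered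

variable {I : Type w} [SmallCategory I] (F : MorphismProperty I)
  (E : Type u) [Category.{w} E] [Abelian E]

/-- Two maps of hypercoverings are related if they induce the same maps on all cohomology objects
of degree less than `N`. -/
def cohRel (N : ℕ) (i : I) : HomRel (HCov F i) := fun _ _ f g =>
  ∀ (P : Iᵒᵖ ⥤ E), ∀ n < N, ((cohomology n).obj P).map ((total i).map f.hom).op =
    ((cohomology n).obj P).map ((total i).map g.hom).op

/-- The category of hypercoverings of `i`, modulo the equality of maps on cohomology objects of
degree less than `N`. -/
abbrev HCTrunc (N : ℕ) (i : I) : Type w := CategoryTheory.Quotient (cohRel F E N i)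

variable {F E}

/-- The functor `X ↦ H^n(P(X))` on the category `HCTrunc F E N i`, for `n < N`. -/
def cohomologyTrunc {N n : ℕ} (hn : n < N) (P : Iᵒᵖ ⥤ E) (i : I) : (HCTrunc F E N i)ᵒᵖ ⥤ E :=
  (CategoryTheory.Quotient.lift (cohRel F E N i)
    (((IsHypercovering F i).ι ⋙ total i).op ⋙ (cohomology n).obj P).rightOp
    (fun _ _ _ _ h => Quiver.Hom.unop_inj (h P n hn))).leftOp

/-- A natural transformation between truncated cohomology functors. -/
def truncHom {N n m : ℕ} (hn : n < N) (hm : m < N) {P Q : Iᵒᵖ ⥤ E} {i : I}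
    (α : ∀ X : HCov F i, ((cohomology n).obj P).obj (op ((total i).obj X.obj)) ⟶
      ((cohomology m).obj Q).obj (op ((total i).obj X.obj)))
    (hα : ∀ {X Y : HCov F i} (t : Y ⟶ X), ((cohomology n).obj P).map ((total i).map t.hom).op ≫
      α Y = α X ≫ ((cohomology m).obj Q).map ((total i).map t.hom).op) :
    cohomologyTrunc (F := F) hn P i ⟶ cohomologyTrunc hm Q i where
  app X := α X.unop.as
  naturality X Y t := by
    obtain ⟨s, hs⟩ := (CategoryTheory.Quotient.functor (cohRel F E N i)).map_surjective
      (X := Y.unop.as) (Y := X.unop.as) t.unop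
    have : t = ((CategoryTheory.Quotient.functor (cohRel F E N i)).map s).op :=
      Quiver.Hom.unop_inj hs.symm
    subst this
    exact hα s

section

variable [HasColimitsOfSize.{w, w} E]

theorem doldι_desc {n : ℕ} {P : Iᵒᵖ ⥤ E} {i : I} {T : E}
    (x : ∀ X : HCov F i, ((cohomology n).obj P).obj (op ((total i).obj X.obj)) ⟶ T)
    (hx : ∀ {X Y : HCov F i} (t : Y ⟶ X),
      ((cohomology n).obj P).map ((total i).map t.hom).op ≫ x Y = x X) (X : HCov F i) :
    doldι F n P X ≫ doldDesc x hx = x X :=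
  colimit.ι_desc _ _

/-- The cocone given by the maps to `D^n(P)(i)`. -/
def truncCocone {N n : ℕ} (hn : n < N) (P : Iᵒᵖ ⥤ E) (i : I) :
    Cocone (cohomologyTrunc (F := F) hn P i) where
  pt := doldObj F n P i
  ι :=
    { app := fun X => doldι F n P X.unop.as
      naturality := by
        intro X Y t
        obtain ⟨s, hs⟩ := (CategoryTheory.Quotient.functor (cohRel F E N i)).map_surjective
          (X := Y.unop.as) (Y := X.unop.as) t.unop
        have : t = ((CategoryTheory.Quotient.functor (cohRel F E N i)).map s).op :=
          Quiver.Hom.unop_inj hs.symm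
        subst this
        exact (doldι_w n P s).trans (Category.comp_id _).symm }

/-- `D^n(P)(i)` is the colimit of cohomology objects over `HCTrunc F E N i`. -/
def isColimitTruncCocone {N n : ℕ} (hn : n < N) (P : Iᵒᵖ ⥤ E) (i : I) :
    IsColimit (truncCocone (F := F) hn P i) where
  -- A cocone over either quotient of `HCov` is a family compatible with the maps of `HCov` itself,
  -- so the two colimits coincide.
  desc s := doldDesc (fun X => s.ι.app (op ((CategoryTheory.Quotient.functor _).obj X)))
    (fun t => s.w ((CategoryTheory.Quotient.functor _).map t).op)
  fac _ _ := colimit.ι_desc _ _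
  uniq s _ hm := dold_hom_ext fun X =>
    (hm (op ((CategoryTheory.Quotient.functor _).obj X))).trans
      (doldι_desc (n := n) (P := P) (fun X : HCov F i =>
        s.ι.app (op ((CategoryTheory.Quotient.functor _).obj X)))
        (fun t => s.w ((CategoryTheory.Quotient.functor _).map t).op) X).symm

end

variable [F.IsMultiplicative] [F.HasPullbacks] [F.IsStableUnderBaseChange]

/-- Products dominate two hypercoverings; parallel maps become equal in this quotient after the
refinement of `exists_cohomology_map_eq`. A simplicial homotopy between them is never needed. -/
instance (N : ℕ) (i : I) : IsCofiltered (HCTrunc F E N i) where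
  nonempty := ⟨⟨⟨_, isReedy_const (overClass F i) Over.mkIdTerminal⟩⟩⟩
  cone_objs X Y := by
    obtain ⟨W, hW, ⟨p⟩, ⟨q⟩⟩ := exists_product Over.mkIdTerminal X.as.property Y.as.property
    let W' : HCov F i := ⟨W, hW⟩
    exact ⟨⟨W'⟩, (CategoryTheory.Quotient.functor _).map (ObjectProperty.homMk p : W' ⟶ X.as),
      (CategoryTheory.Quotient.functor _).map (ObjectProperty.homMk q : W' ⟶ Y.as), trivial⟩
  cone_maps X Y f g := by
    obtain ⟨f, rfl⟩ := (CategoryTheory.Quotient.functor (cohRel F E N i)).map_surjective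
      (X := X.as) (Y := Y.as) f
    obtain ⟨g, rfl⟩ := (CategoryTheory.Quotient.functor (cohRel F E N i)).map_surjective
      (X := X.as) (Y := Y.as) g
    obtain ⟨Z, h, hh⟩ := exists_cohomology_map_eq E f g N
    refine ⟨⟨Z⟩, (CategoryTheory.Quotient.functor _).map h, ?_⟩
    refine ((CategoryTheory.Quotient.functor _).map_comp _ _).symm.trans (Eq.trans ?_
      ((CategoryTheory.Quotient.functor _).map_comp _ _))
    exact CategoryTheory.Quotient.sound _ hh

/-- All three terms are colimits over the opposite of one cofiltered category, and filtered colimits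
in a Grothendieck abelian category are exact. The three degrees may differ, to allow connecting
maps, so the bound `N` must exceed each of them. -/
theorem dold_exact [IsGrothendieckAbelian.{w} E] {n₁ n₂ n₃ : ℕ} {P₁ P₂ P₃ : Iᵒᵖ ⥤ E} {i : I}
    (α : ∀ X : HCov F i, ((cohomology n₁).obj P₁).obj (op ((total i).obj X.obj)) ⟶
      ((cohomology n₂).obj P₂).obj (op ((total i).obj X.obj)))
    (hα : ∀ {X Y : HCov F i} (t : Y ⟶ X), ((cohomology n₁).obj P₁).map ((total i).map t.hom).op ≫
      α Y = α X ≫ ((cohomology n₂).obj P₂).map ((total i).map t.hom).op)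
    (β : ∀ X : HCov F i, ((cohomology n₂).obj P₂).obj (op ((total i).obj X.obj)) ⟶
      ((cohomology n₃).obj P₃).obj (op ((total i).obj X.obj)))
    (hβ : ∀ {X Y : HCov F i} (t : Y ⟶ X), ((cohomology n₂).obj P₂).map ((total i).map t.hom).op ≫
      β Y = β X ≫ ((cohomology n₃).obj P₃).map ((total i).map t.hom).op)
    (hαβ : ∀ X, α X ≫ β X = 0) (hex : ∀ X, (ShortComplex.mk (α X) (β X) (hαβ X)).Exact)
    (a : doldObj F n₁ P₁ i ⟶ doldObj F n₂ P₂ i) (ha : ∀ X, doldι F n₁ P₁ X ≫ a = α X ≫ doldι F _ _ X)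
    (b : doldObj F n₂ P₂ i ⟶ doldObj F n₃ P₃ i) (hb : ∀ X, doldι F n₂ P₂ X ≫ b = β X ≫ doldι F _ _ X)
    (hab : a ≫ b = 0) : (ShortComplex.mk a b hab).Exact := by
  obtain ⟨N, h₁, h₂, h₃⟩ : ∃ N, n₁ < N ∧ n₂ < N ∧ n₃ < N :=
    ⟨n₁ + n₂ + n₃ + 1, by omega, by omega, by omega⟩
  let S : ShortComplex ((HCTrunc F E N i)ᵒᵖ ⥤ E) :=
    ShortComplex.mk (truncHom h₁ h₂ α hα) (truncHom h₂ h₃ β hβ) (by ext X; exact hαβ X.unop.as)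
  have hS : S.Exact := exact_of_forall_evaluation S fun X => hex X.unop.as
  exact colim.exact_mapShortComplex hS (isColimitTruncCocone h₁ P₁ i) (isColimitTruncCocone h₂ P₂ i)
    (isColimitTruncCocone h₃ P₃ i) a b (fun X => ha X.unop.as) (fun X => hb X.unop.as)

end Filtered

/-! ### The long exact cohomology sequence of a simplicial object -/

noncomputable section LongExact

variable {I : Type w} [SmallCategory I] {E : Type u} [Category.{w} E] [Abelian E]

/-- The short complex of cochain complexes associated with a short complex of presheaves. -/
def cochainsSC (S : ShortComplex (Iᵒᵖ ⥤ E)) (X : SimplicialObject I) :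
    ShortComplex (HomologicalComplex E (ComplexShape.down ℕ).symm) where
  X₁ := (cochains.obj S.X₁).obj (op X)
  X₂ := (cochains.obj S.X₂).obj (op X)
  X₃ := (cochains.obj S.X₃).obj (op X)
  f := (cochains.map S.f).app (op X)
  g := (cochains.map S.g).app (op X)
  zero := by
    ext k
    exact congr_app S.zero _

/-- In degree `k` this is `S` evaluated at `X_k`, and evaluation is exact. -/
theorem cochainsSC_shortExact {S : ShortComplex (Iᵒᵖ ⥤ E)} (hS : S.ShortExact)
    (X : SimplicialObject I) : (cochainsSC S X).ShortExact :=
  HomologicalComplex.shortExact_of_degreewise_shortExact _ fun k =>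
    (hS.map_of_exact ((evaluation Iᵒᵖ E).obj (op (X.obj (op ⦋k⦌)))) :)

/-- The comparison between the cohomology of the unnormalized and the normalized cochains. -/
def cohomologyAppIso (n : ℕ) (P : Iᵒᵖ ⥤ E) (X : SimplicialObject I) :
    ((cochains.obj P).obj (op X)).homology n ≅ ((cohomology n).obj P).obj (op X) :=
  (cohomologyIso n P).app (op X)

theorem cohomologyAppIso_map (n : ℕ) (P : Iᵒᵖ ⥤ E) {X Y : SimplicialObject I} (f : X ⟶ Y) :
    (cohomologyAppIso n P Y).hom ≫ ((cohomology n).obj P).map f.op =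
      HomologicalComplex.homologyMap ((cochains.obj P).map f.op) n ≫
        (cohomologyAppIso n P X).hom :=
  ((cohomologyIso n P).hom.naturality f.op).symm

theorem cohomologyAppIso_naturality (n : ℕ) {P Q : Iᵒᵖ ⥤ E} (η : P ⟶ Q) (X : SimplicialObject I) :
    (cohomologyAppIso n P X).hom ≫ ((cohomology n).map η).app (op X) =
      HomologicalComplex.homologyMap ((cochains.map η).app (op X)) n ≫
        (cohomologyAppIso n Q X).hom :=
  (cohomologyIso_naturality n η X).symm

theorem down_symm_rel (n : ℕ) : (ComplexShape.down ℕ).symm.Rel n (n + 1) := rfl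

/-- The connecting map on the cohomology of unnormalized cochains. -/
def cochainsδ {S : ShortComplex (Iᵒᵖ ⥤ E)} (hS : S.ShortExact) (n : ℕ) (X : SimplicialObject I) :
    ((cochains.obj S.X₃).obj (op X)).homology n ⟶ ((cochains.obj S.X₁).obj (op X)).homology (n + 1) :=
  (cochainsSC_shortExact hS X).δ n (n + 1) (down_symm_rel n)

/-- The connecting map on the cohomology of a simplicial object. -/
def cohomologyδ {S : ShortComplex (Iᵒᵖ ⥤ E)} (hS : S.ShortExact) (n : ℕ) (X : SimplicialObject I) :
    ((cohomology n).obj S.X₃).obj (op X) ⟶ ((cohomology (n + 1)).obj S.X₁).obj (op X) :=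
  (cohomologyAppIso n S.X₃ X).inv ≫ cochainsδ hS n X ≫
    (cohomologyAppIso (n + 1) S.X₁ X).hom

/-- Connecting maps are defined on unnormalized cochains and conjugated to the normalized ones;
naturality squares are carried along by this. -/
theorem comp_conj_eq {C : Type*} [Category* C] {A B A' B' D D' G G' : C} {e : A ≅ A'}
    {e' : B ≅ B'} {k : D ≅ D'} {k' : G ≅ G'} {f : A ⟶ B} {f' : A' ⟶ B'} {g : D ⟶ G} {g' : D' ⟶ G'}
    {d : A ⟶ D} {d' : B ⟶ G} (hf : e.hom ≫ f' = f ≫ e'.hom) (hg : k.hom ≫ g' = g ≫ k'.hom)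
    (h : d ≫ g = f ≫ d') : f' ≫ e'.inv ≫ d' ≫ k'.hom = (e.inv ≫ d ≫ k.hom) ≫ g' := by
  rw [← cancel_epi e.hom, reassoc_of% hf, Category.assoc, Category.assoc, hg, reassoc_of% h]
  simp

theorem cohomologyδ_naturality {S : ShortComplex (Iᵒᵖ ⥤ E)} (hS : S.ShortExact) (n : ℕ)
    {X Y : SimplicialObject I} (f : X ⟶ Y) :
    ((cohomology n).obj S.X₃).map f.op ≫ cohomologyδ hS n X =
      cohomologyδ hS n Y ≫ ((cohomology (n + 1)).obj S.X₁).map f.op :=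
  comp_conj_eq (cohomologyAppIso_map n S.X₃ f) (cohomologyAppIso_map (n + 1) S.X₁ f)
    (HomologicalComplex.HomologySequence.δ_naturality
      (S₁ := cochainsSC S Y) (S₂ := cochainsSC S X)
      { τ₁ := (cochains.obj S.X₁).map f.op
        τ₂ := (cochains.obj S.X₂).map f.op
        τ₃ := (cochains.obj S.X₃).map f.op
        comm₁₂ := (cochains.map S.f).naturality f.op
        comm₂₃ := (cochains.map S.g).naturality f.op }
      (cochainsSC_shortExact hS Y) (cochainsSC_shortExact hS X) n (n + 1) (down_symm_rel n))

theorem cohomologyδ_map {S S' : ShortComplex (Iᵒᵖ ⥤ E)} (hS : S.ShortExact) (hS' : S'.ShortExact)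
    (φ : S ⟶ S') (n : ℕ) (X : SimplicialObject I) :
    ((cohomology n).map φ.τ₃).app (op X) ≫ cohomologyδ hS' n X =
      cohomologyδ hS n X ≫ ((cohomology (n + 1)).map φ.τ₁).app (op X) :=
  comp_conj_eq (cohomologyAppIso_naturality n φ.τ₃ X)
    (cohomologyAppIso_naturality (n + 1) φ.τ₁ X)
    (HomologicalComplex.HomologySequence.δ_naturality
      (S₁ := cochainsSC S X) (S₂ := cochainsSC S' X)
      { τ₁ := (cochains.map φ.τ₁).app (op X)
        τ₂ := (cochains.map φ.τ₂).app (op X)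
        τ₃ := (cochains.map φ.τ₃).app (op X)
        comm₁₂ := by
          ext k
          exact congr_app φ.comm₁₂ _
        comm₂₃ := by
          ext k
          exact congr_app φ.comm₂₃ _ }
      (cochainsSC_shortExact hS X) (cochainsSC_shortExact hS' X) n (n + 1) (down_symm_rel n))

theorem cohomology_exact₂ {S : ShortComplex (Iᵒᵖ ⥤ E)} (hS : S.ShortExact) (n : ℕ)
    (X : SimplicialObject I) (h : ((cohomology n).map S.f).app (op X) ≫
      ((cohomology n).map S.g).app (op X) = 0) : (ShortComplex.mk _ _ h).Exact := by
  refine ShortComplex.exact_of_iso (ShortComplex.isoMk (cohomologyAppIso n S.X₁ X)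
    (cohomologyAppIso n S.X₂ X) (cohomologyAppIso n S.X₃ X) ?_ ?_)
    ((cochainsSC_shortExact hS X).homology_exact₂ n)
  · exact cohomologyAppIso_naturality n S.f X
  · exact cohomologyAppIso_naturality n S.g X

theorem cohomology_exact₁ {S : ShortComplex (Iᵒᵖ ⥤ E)} (hS : S.ShortExact) (n : ℕ)
    (X : SimplicialObject I) (h : cohomologyδ hS n X ≫
      ((cohomology (n + 1)).map S.f).app (op X) = 0) : (ShortComplex.mk _ _ h).Exact := by
  refine ShortComplex.exact_of_iso (ShortComplex.isoMk (cohomologyAppIso n S.X₃ X)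
    (cohomologyAppIso (n + 1) S.X₁ X) (cohomologyAppIso (n + 1) S.X₂ X) ?_ ?_)
    ((cochainsSC_shortExact hS X).homology_exact₁ n (n + 1) (down_symm_rel n))
  · exact Iso.hom_inv_id_assoc _ _
  · exact cohomologyAppIso_naturality (n + 1) S.f X

theorem cohomology_exact₃ {S : ShortComplex (Iᵒᵖ ⥤ E)} (hS : S.ShortExact) (n : ℕ)
    (X : SimplicialObject I) (h : ((cohomology n).map S.g).app (op X) ≫
      cohomologyδ hS n X = 0) : (ShortComplex.mk _ _ h).Exact := by
  refine ShortComplex.exact_of_iso (ShortComplex.isoMk (cohomologyAppIso n S.X₂ X)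
    (cohomologyAppIso n S.X₃ X) (cohomologyAppIso (n + 1) S.X₁ X) ?_ ?_)
    ((cochainsSC_shortExact hS X).homology_exact₃ n (n + 1) (down_symm_rel n))
  · exact cohomologyAppIso_naturality n S.g X
  · exact Iso.hom_inv_id_assoc _ _

theorem isIso_homologyπ_zero (K : HomologicalComplex E (ComplexShape.down ℕ).symm) :
    IsIso (K.homologyπ 0) := by
  have hp : (ComplexShape.down ℕ).symm.prev 0 = 0 := by
    refine ComplexShape.prev_eq_self _ _ fun h => ?_
    exact absurd h (Nat.succ_ne_zero _)
  exact K.isIso_homologyπ _ 0 hp (K.shape _ _ fun h => absurd h (Nat.succ_ne_zero _))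

/-- There are no coboundaries in degree zero, so `H^0` is the object of cocycles, a subobject of the
cochains, on which `S.f` is mono. -/
theorem cohomology_mono_zero {S : ShortComplex (Iᵒᵖ ⥤ E)} (hS : S.ShortExact)
    (X : SimplicialObject I) : Mono (((cohomology 0).map S.f).app (op X)) := by
  have hf : Mono (((cochains.map S.f).app (op X)).f 0) :=
    ((cochainsSC_shortExact hS X).map_of_exact (HomologicalComplex.eval _ _ 0)).mono_f
  have h1 : Mono (HomologicalComplex.homologyMap ((cochains.map S.f).app (op X)) 0) := by
    have e := HomologicalComplex.homologyπ_naturality ((cochains.map S.f).app (op X)) 0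
    have := isIso_homologyπ_zero ((cochains.obj S.X₁).obj (op X))
    have := isIso_homologyπ_zero ((cochains.obj S.X₂).obj (op X))
    rw [← cancel_epi (inv (HomologicalComplex.homologyπ ((cochains.obj S.X₁).obj (op X)) 0)),
      IsIso.inv_hom_id_assoc] at e
    rw [e]
    infer_instance
  have e := cohomologyAppIso_naturality 0 S.f X
  rw [← Iso.eq_inv_comp] at e
  rw [e]
  infer_instance

theorem cohomologyδ_comp {S : ShortComplex (Iᵒᵖ ⥤ E)} (hS : S.ShortExact) (n : ℕ)
    (X : SimplicialObject I) :
    cohomologyδ hS n X ≫ ((cohomology (n + 1)).map S.f).app (op X) = 0 := by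
  unfold cohomologyδ
  rw [Category.assoc, Category.assoc, cohomologyAppIso_naturality]
  have : cochainsδ hS n X ≫ HomologicalComplex.homologyMap ((cochains.map S.f).app (op X)) (n + 1) = 0 :=
    (cochainsSC_shortExact hS X).δ_comp n (n + 1) (down_symm_rel n)
  rw [reassoc_of% this]
  simp

theorem comp_cohomologyδ {S : ShortComplex (Iᵒᵖ ⥤ E)} (hS : S.ShortExact) (n : ℕ)
    (X : SimplicialObject I) :
    ((cohomology n).map S.g).app (op X) ≫ cohomologyδ hS n X = 0 := by
  have : HomologicalComplex.homologyMap ((cochains.map S.g).app (op X)) n ≫ cochainsδ hS n X = 0 :=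
    (cochainsSC_shortExact hS X).comp_δ n (n + 1) (down_symm_rel n)
  have h := cohomologyAppIso_naturality n S.g X
  rw [← Iso.eq_inv_comp] at h
  rw [h]
  unfold cohomologyδ
  rw [Category.assoc, Category.assoc, Iso.hom_inv_id_assoc, reassoc_of% this]
  simp

theorem cohomology_map_comp_eq_zero {S : ShortComplex (Iᵒᵖ ⥤ E)} (n : ℕ) (X : SimplicialObject I) :
    ((cohomology n).map S.f).app (op X) ≫ ((cohomology n).map S.g).app (op X) = 0 := by
  have h : HomologicalComplex.homologyMap ((cochains.map S.f).app (op X)) n ≫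
      HomologicalComplex.homologyMap ((cochains.map S.g).app (op X)) n = 0 := by
    rw [← HomologicalComplex.homologyMap_comp]
    exact (congr(HomologicalComplex.homologyMap $((cochainsSC S X).zero) n)).trans
      (HomologicalComplex.homologyMap_zero _ _ _)
  have h₁ := cohomologyAppIso_naturality n S.f X
  have h₂ := cohomologyAppIso_naturality n S.g X
  rw [← cancel_epi (cohomologyAppIso n S.X₁ X).hom, reassoc_of% h₁, h₂, reassoc_of% h]
  simp

end LongExact

/-! ### The long exact sequence of Dold-derived functors -/

noncomputable section DoldLongExact

variable {I : Type w} [SmallCategory I] (F : MorphismProperty I)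
  {E : Type u} [Category.{w} E] [Abelian E] [HasColimitsOfSize.{w, w} E]

variable {F}

/-- The connecting map of Dold-derived functors, at an object. -/
def doldδObj {S : ShortComplex (Iᵒᵖ ⥤ E)} (hS : S.ShortExact) (n : ℕ) (i : I) :
    doldObj F n S.X₃ i ⟶ doldObj F (n + 1) S.X₁ i :=
  doldDesc (fun X => cohomologyδ hS n ((total _).obj X.obj) ≫ doldι F (n + 1) S.X₁ X) (fun t => by
    rw [← Category.assoc, cohomologyδ_naturality, Category.assoc, doldι_w])

theorem doldι_δObj {S : ShortComplex (Iᵒᵖ ⥤ E)} (hS : S.ShortExact) (n : ℕ) {i : I} (X : HCov F i) :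
    doldι F n S.X₃ X ≫ doldδObj hS n i =
      cohomologyδ hS n ((total i).obj X.obj) ≫ doldι F (n + 1) S.X₁ X :=
  colimit.ι_desc _ _

theorem doldδObj_mapPresheaf {S S' : ShortComplex (Iᵒᵖ ⥤ E)} (hS : S.ShortExact)
    (hS' : S'.ShortExact) (φ : S ⟶ S') (n : ℕ) (i : I) :
    doldMapPresheaf n φ.τ₃ i ≫ doldδObj (F := F) hS' n i =
      doldδObj hS n i ≫ doldMapPresheaf (n + 1) φ.τ₁ i :=
  dold_hom_ext fun X => by
    rw [← Category.assoc, ← Category.assoc, doldι_δObj, doldι_mapPresheaf, Category.assoc, Category.assoc,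
      doldι_mapPresheaf, doldι_δObj, ← Category.assoc, ← Category.assoc,
      cohomologyδ_map hS hS']

variable [F.IsMultiplicative] [F.HasPullbacks] [F.IsStableUnderBaseChange]

theorem doldδObj_map {S : ShortComplex (Iᵒᵖ ⥤ E)} (hS : S.ShortExact) (n : ℕ) {i' i : I}
    (f : i' ⟶ i) : doldMap n S.X₃ f ≫ doldδObj (F := F) hS n i' =
      doldδObj hS n i ≫ doldMap (n + 1) S.X₁ f :=
  dold_hom_ext fun X => by
    rw [← Category.assoc, ← Category.assoc, doldι_δObj,
      doldι_map n S.X₃ f (baseChangeMap f X), Category.assoc, Category.assoc,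
      doldι_map (n + 1) S.X₁ f (baseChangeMap f X), doldι_δObj,
      ← Category.assoc, ← Category.assoc, cohomologyδ_naturality]

variable (F) in
/-- The connecting map of Dold-derived functors. -/
def doldδ {S : ShortComplex (Iᵒᵖ ⥤ E)} (hS : S.ShortExact) (n : ℕ) :
    (doldDerived F E n).obj S.X₃ ⟶ (doldDerived F E (n + 1)).obj S.X₁ where
  app i := doldδObj hS n i.unop
  naturality _ _ f := doldδObj_map hS n f.unop

theorem doldδ_naturality {S S' : ShortComplex (Iᵒᵖ ⥤ E)} (hS : S.ShortExact) (hS' : S'.ShortExact)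
    (φ : S ⟶ S') (n : ℕ) :
    (doldDerived F E n).map φ.τ₃ ≫ doldδ F hS' n =
      doldδ F hS n ≫ (doldDerived F E (n + 1)).map φ.τ₁ := by
  ext i
  exact doldδObj_mapPresheaf hS hS' φ n i.unop

variable {E : Type u} [Category.{w} E] [Abelian E] [IsLocallyFinitelyPresentable.{w} E]

theorem dold_exact₁ {S : ShortComplex (Iᵒᵖ ⥤ E)} (hS : S.ShortExact) (n : ℕ) :
    ∃ h : doldδ F hS n ≫ (doldDerived F E (n + 1)).map S.f = 0, (ShortComplex.mk _ _ h).Exact := by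
  have h : doldδ F hS n ≫ (doldDerived F E (n + 1)).map S.f = 0 := by
    ext i
    exact dold_hom_ext (i := i.unop)
      (a := doldδObj hS n i.unop ≫ doldMapPresheaf (n + 1) S.f i.unop) (b := 0) fun X => by
      rw [← Category.assoc, doldι_δObj, Category.assoc, doldι_mapPresheaf, ← Category.assoc,
        cohomologyδ_comp, zero_comp, comp_zero]
  refine ⟨h, exact_of_forall_evaluation _ fun i => ?_⟩
  exact dold_exact (F := F) _ (fun t => cohomologyδ_naturality hS n _) _
    (fun t => NatTrans.naturality _ _) (fun X => cohomologyδ_comp hS n _)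
    (fun X => cohomology_exact₁ hS n _ _) _ (doldι_δObj hS n) _ (doldι_mapPresheaf _ _)
    (congr_app h i)

theorem dold_exact₂ {S : ShortComplex (Iᵒᵖ ⥤ E)} (hS : S.ShortExact) (n : ℕ) :
    ∃ h : (doldDerived F E n).map S.f ≫ (doldDerived F E n).map S.g = 0,
      (ShortComplex.mk _ _ h).Exact := by
  have h : (doldDerived F E n).map S.f ≫ (doldDerived F E n).map S.g = 0 := by
    ext i
    exact dold_hom_ext (i := i.unop)
      (a := doldMapPresheaf n S.f i.unop ≫ doldMapPresheaf n S.g i.unop) (b := 0) fun X => by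
      rw [← Category.assoc, doldι_mapPresheaf, Category.assoc, doldι_mapPresheaf, ← Category.assoc,
        cohomology_map_comp_eq_zero, zero_comp, comp_zero]
  refine ⟨h, exact_of_forall_evaluation _ fun i => ?_⟩
  exact dold_exact (F := F) _ (fun t => NatTrans.naturality _ _) _
    (fun t => NatTrans.naturality _ _) (fun X => cohomology_map_comp_eq_zero n _)
    (fun X => cohomology_exact₂ hS n _ _) _ (doldι_mapPresheaf _ _) _ (doldι_mapPresheaf _ _)
    (congr_app h i)

theorem dold_exact₃ {S : ShortComplex (Iᵒᵖ ⥤ E)} (hS : S.ShortExact) (n : ℕ) :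
    ∃ h : (doldDerived F E n).map S.g ≫ doldδ F hS n = 0, (ShortComplex.mk _ _ h).Exact := by
  have h : (doldDerived F E n).map S.g ≫ doldδ F hS n = 0 := by
    ext i
    exact dold_hom_ext (i := i.unop)
      (a := doldMapPresheaf n S.g i.unop ≫ doldδObj hS n i.unop) (b := 0) fun X => by
      rw [← Category.assoc, doldι_mapPresheaf, Category.assoc, doldι_δObj, ← Category.assoc,
        comp_cohomologyδ, zero_comp, comp_zero]
  refine ⟨h, exact_of_forall_evaluation _ fun i => ?_⟩
  exact dold_exact (F := F) _ (fun t => NatTrans.naturality _ _) _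
    (fun t => cohomologyδ_naturality hS n _) (fun X => comp_cohomologyδ hS n _)
    (fun X => cohomology_exact₃ hS n _ _) _ (doldι_mapPresheaf _ _) _ (doldι_δObj hS n)
    (congr_app h i)

theorem dold_mono_zero {S : ShortComplex (Iᵒᵖ ⥤ E)} (hS : S.ShortExact) :
    Mono ((doldDerived F E 0).map S.f) := by
  rw [NatTrans.mono_iff_mono_app]
  intro i
  -- A mono is a map that is exact when preceded by zero. The source of the zero map is taken to be
  -- `H^0` of `S.X₁` again, to match the form of `dold_exact`.
  have h := dold_exact (F := F) (E := E) (n₁ := 0) (P₁ := S.X₁) (i := i.unop) 0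
    (fun t => comp_zero.trans zero_comp.symm) _ (fun t => NatTrans.naturality _ _) 
    (fun X => zero_comp)
    (fun X => (ShortComplex.exact_iff_mono _ rfl).2 (cohomology_mono_zero hS _))
    0 (fun X => comp_zero.trans zero_comp.symm) _ (doldι_mapPresheaf 0 S.f) zero_comp
  exact (ShortComplex.exact_iff_mono _ rfl).1 h

end DoldLongExact

/-! ### Invariance under sheafification -/

noncomputable section LocallyZero

variable {I : Type w} [SmallCategory I] (F : MorphismProperty I)
  [F.IsMultiplicative] [F.HasPullbacks] [F.IsStableUnderBaseChange]
  {E : Type u} [Category.{w} E] [Abelian E] [IsLocallyFinitelyPresentable.{w} E]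

/-- As `G` is compact, `Hom(G, -)` commutes with the filtered colimits that build the associated
sheaf. So `x` and `0` have the same image in the sheaf associated with `Hom(G, P)` and agree on a
covering sieve, which contains a map in `F`. -/
theorem exists_cover_comp_eq_zero {P : Iᵒᵖ ⥤ E}
    (hP : IsZero ((presheafToSheaf (topology F) E).obj P)) {G : E} [IsFinitelyPresentable.{w} G]
    {T : I} (x : G ⟶ P.obj (op T)) :
    ∃ (T' : I) (c : T' ⟶ T), F c ∧ x ≫ P.map c.op = 0 := by
  have h0 : (topology F).toSheafify P = 0 := by
    rw [← toSheafify_sheafifyLift (topology F) ((topology F).toSheafify P)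
      (sheafify_isSheaf_of_lfp E _ P)]
    have : IsZero (sheafify (topology F) P) := (sheafToPresheaf (topology F) E).map_isZero hP
    rw [this.eq_of_src (sheafifyLift _ _ _) 0, comp_zero]
  have (X : I) : PreservesColimitsOfShape ((topology F).Cover X)ᵒᵖ (coyoneda.obj (op G)) :=
    PreservesFilteredColimitsOfSize.preserves_filtered_colimits _
  have h1 := (topology F).whiskerRight_toSheafify_sheafifyCompIso_hom (coyoneda.obj (op G)) P
  have h2 : ((topology F).toSheafify (P ⋙ coyoneda.obj (op G))).app (op T) x =
      ((topology F).toSheafify (P ⋙ coyoneda.obj (op G))).app (op T) (0 : G ⟶ _) := by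
    rw [← h1]
    change ((topology F).sheafifyCompIso (coyoneda.obj (op G)) P).hom.app (op T)
      (x ≫ ((topology F).toSheafify P).app (op T)) =
      ((topology F).sheafifyCompIso (coyoneda.obj (op G)) P).hom.app (op T)
      (0 ≫ ((topology F).toSheafify P).app (op T))
    rw [h0]
    simp
  obtain ⟨T', c, hc, h⟩ := Presheaf.equalizerSieve_mem (topology F)
    ((topology F).toSheafify (P ⋙ coyoneda.obj (op G))) x (0 : G ⟶ _) h2
  refine ⟨T', c, hc, ?_⟩
  have h3 : x ≫ P.map c.op = (0 : G ⟶ _) ≫ P.map c.op := h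
  rw [h3, zero_comp]

/-- Test on compact generators `G`. A cocycle `G ⟶ P(X_n)` dies on a cover of `X_n`; a refinement of
`X` factors through that cover in degree `n`, so the cocycle is already zero there. -/
theorem doldι_eq_zero {P : Iᵒᵖ ⥤ E} (hP : IsZero ((presheafToSheaf (topology F) E).obj P)) (n : ℕ)
    {i : I} (X : HCov F i) : doldι F n P X = 0 := by
  rw [← cancel_epi (cohomologyAppIso n P _).hom, ← cancel_epi (HomologicalComplex.homologyπ _ n),
    comp_zero, comp_zero]
  obtain ⟨Q, _, hQ, hs, _⟩ := exists_compactGenerator E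
  refine hs _ _ fun G hG x => ?_
  have := hQ G hG
  let K (X : SimplicialObject I) := (cochains.obj P).obj (op X)
  obtain ⟨T', c, hc, h⟩ := exists_cover_comp_eq_zero F hP (T := ((total i).obj X.obj).obj (op ⦋n⦌))
    (x ≫ (K _).iCycles n)
  obtain ⟨X', φ, a, ha⟩ := exists_hcov_refinement X hc
  have h' : x ≫ HomologicalComplex.cyclesMap ((cochains.obj P).map ((total i).map φ.hom).op) n
      = 0 := by
    rw [← cancel_mono (HomologicalComplex.iCycles _ _), Category.assoc,
      HomologicalComplex.cyclesMap_i, zero_comp]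
    have e : ((cochains.obj P).map ((total i).map φ.hom).op).f n = P.map c.op ≫ P.map a.op := by
      refine (cochains_obj_map_f ..).trans ?_
      rw [← P.map_comp, ← op_comp, ha]
    refine (congr(x ≫ _ ≫ $e)).trans ((Category.assoc _ _ _).symm.trans
      ((Category.assoc _ _ _).symm.trans ((congr($h ≫ _)).trans zero_comp)))
  rw [← doldι_w n P φ, ← Category.assoc (cohomologyAppIso _ _ _).hom, cohomologyAppIso_map,
    Category.assoc, HomologicalComplex.homologyπ_naturality_assoc, reassoc_of% h']
  simp

theorem isZero_doldDerived {P : Iᵒᵖ ⥤ E} (hP : IsZero ((presheafToSheaf (topology F) E).obj P))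
    (n : ℕ) : IsZero ((doldDerived F E n).obj P) := by
  refine Functor.isZero _ fun i => (IsZero.iff_id_eq_zero _).2 ?_
  refine dold_hom_ext fun X => ?_
  rw [doldι_eq_zero F hP]
  exact zero_comp.trans zero_comp.symm

/-- The neighbours of `D^n(S.f)` in the long exact sequence are `D^{n-1}` and `D^n` of the locally
zero cokernel. In degree zero the sequence has no left neighbour, and injectivity is
`dold_mono_zero`. -/
theorem isIso_doldDerived_map_f {S : ShortComplex (Iᵒᵖ ⥤ E)} (hS : S.ShortExact)
    (h : IsZero ((presheafToSheaf (topology F) E).obj S.X₃)) (n : ℕ) :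
    IsIso ((doldDerived F E n).map S.f) := by
  have hep : Epi ((doldDerived F E n).map S.f) := by
    obtain ⟨h0, h'⟩ := dold_exact₂ (F := F) hS n
    exact h'.epi_f ((isZero_doldDerived F h n).eq_of_tgt _ _)
  have hmo : Mono ((doldDerived F E n).map S.f) := by
    cases n with
    | zero => exact dold_mono_zero hS
    | succ n =>
      obtain ⟨h0, h'⟩ := dold_exact₁ (F := F) hS n
      exact h'.mono_g ((isZero_doldDerived F h n).eq_of_src _ _)
  exact isIso_of_mono_of_epi _

theorem isIso_doldDerived_map_g {S : ShortComplex (Iᵒᵖ ⥤ E)} (hS : S.ShortExact)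
    (h : IsZero ((presheafToSheaf (topology F) E).obj S.X₁)) (n : ℕ) :
    IsIso ((doldDerived F E n).map S.g) := by
  have hep : Epi ((doldDerived F E n).map S.g) := by
    obtain ⟨h0, h'⟩ := dold_exact₃ (F := F) hS n
    exact h'.epi_f ((isZero_doldDerived F h _).eq_of_tgt _ _)
  have hmo : Mono ((doldDerived F E n).map S.g) := by
    obtain ⟨h0, h'⟩ := dold_exact₂ (F := F) hS n
    exact h'.mono_g ((isZero_doldDerived F h n).eq_of_src _ _)
  exact isIso_of_mono_of_epi _

/-- The Dold-derived functors invert the maps that become isomorphisms of associated sheaves. -/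
theorem isIso_doldDerived_map {P Q : Iᵒᵖ ⥤ E} (f : P ⟶ Q)
    (hf : IsIso ((presheafToSheaf (topology F) E).map f)) (n : ℕ) :
    IsIso ((doldDerived F E n).map f) := by
  let a := presheafToSheaf (topology F) E
  have : IsIso (a.map f) := hf
  have hf : Abelian.factorThruImage f ≫ Abelian.image.ι f = f := Abelian.image.fac f
  have e : a.map (Abelian.factorThruImage f) ≫ a.map (Abelian.image.ι f) = a.map f := by
    rw [← a.map_comp, hf]
  -- Exactness of `a` makes the image inclusion mono after sheafification, and it is epi there
  -- because `a.map f` is. Both factors of `f` thus become isomorphisms, so its kernel and cokernel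
  -- are locally zero.
  have h1 : IsIso (a.map (Abelian.image.ι f)) := by
    have : Epi (a.map (Abelian.factorThruImage f) ≫ a.map (Abelian.image.ι f)) := by
      rw [e]; infer_instance
    have := epi_of_epi (a.map (Abelian.factorThruImage f)) (a.map (Abelian.image.ι f))
    exact isIso_of_mono_of_epi _
  have h2 : IsIso (a.map (Abelian.factorThruImage f)) := by
    rw [← IsIso.eq_comp_inv] at e
    rw [e]
    infer_instance
  have hS₁ : (ShortComplex.mk (Abelian.image.ι f) (cokernel.π _) (cokernel.condition _)).ShortExact :=
    { exact := ShortComplex.exact_cokernel _ }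
  have hS₂ : (ShortComplex.mk (kernel.ι _) (Abelian.factorThruImage f)
      (kernel.condition _)).ShortExact :=
    { exact := ShortComplex.exact_kernel _ }
  have h1' := isIso_doldDerived_map_f F hS₁ ((hS₁.map_of_exact a).isIso_f_iff.1 h1) n
  have h2' := isIso_doldDerived_map_g F hS₂ ((hS₂.map_of_exact a).isIso_g_iff.1 h2) n
  rw [← hf, Functor.map_comp]
  exact IsIso.comp_isIso' h2' h1'

end LocallyZero

/-! ### Degree zero on sheaves -/

noncomputable section SheafDegreeZero

section

variable {I : Type w} [SmallCategory I] {F : MorphismProperty I}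
  [F.IsMultiplicative] [F.HasPullbacks] [F.IsStableUnderBaseChange]
  {E : Type u} [Category.{w} E]

theorem existsUnique_gluing {P : Iᵒᵖ ⥤ E} (hP : Presheaf.IsSheaf (topology F) P) {T T' : I}
    {c : T' ⟶ T} (hc : F c) {A : E} (y : A ⟶ P.obj (op T'))
    (hy : ∀ {Z : I} (p₁ p₂ : Z ⟶ T'), p₁ ≫ c = p₂ ≫ c → y ≫ P.map p₁.op = y ≫ P.map p₂.op) :
    ∃! x : A ⟶ P.obj (op T), x ≫ P.map c.op = y :=
  Presieve.isSheafFor_singleton.1 ((Presieve.isSheafFor_iff_generate _).2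
    (hP A _ ⟨T', c, hc, Sieve.le_generate _ _ _ (Presieve.singleton_self c)⟩)) y hy

theorem eq_of_comp_cover_eq {P : Iᵒᵖ ⥤ E} (hP : Presheaf.IsSheaf (topology F) P) {T T' : I}
    {c : T' ⟶ T} (hc : F c) {A : E} {x y : A ⟶ P.obj (op T)}
    (h : x ≫ P.map c.op = y ≫ P.map c.op) : x = y := by
  refine (existsUnique_gluing hP hc (y ≫ P.map c.op) fun p₁ p₂ e => ?_).unique h rfl
  rw [Category.assoc, Category.assoc, ← P.map_comp, ← P.map_comp, ← op_comp, ← op_comp, e]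

theorem augmentation_zero_mem {i : I} (X : HCov F i) : F (augmentation X.obj 0) := by
  obtain ⟨_, _, _, _, h⟩ := isReedy_hom_mem F X.property 0
  exact h

variable [Abelian E]

section Cocycles

variable (P : Iᵒᵖ ⥤ E) (X : SimplicialObject I) (n : ℕ)

/-- The differential of the complex of unnormalized cochains. -/
def cochainsD : P.obj (op (X.obj (op ⦋n⦌))) ⟶ P.obj (op (X.obj (op ⦋n + 1⦌))) :=
  ((cochains.obj P).obj (op X)).d n (n + 1)

theorem cochainsD_eq :
    cochainsD P X n = ∑ j : Fin (n + 2), (-1 : ℤ) ^ (j : ℕ) • P.map (X.δ j).op :=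
  cochains_d P X n

/-- The inclusion of cocycles into cochains. -/
def cocyclesι : ((cochains.obj P).obj (op X)).cycles n ⟶ P.obj (op (X.obj (op ⦋n⦌))) :=
  ((cochains.obj P).obj (op X)).iCycles n

instance : Mono (cocyclesι P X n) :=
  inferInstanceAs (Mono (((cochains.obj P).obj (op X)).iCycles n))

theorem cocyclesι_D : cocyclesι P X n ≫ cochainsD P X n = 0 :=
  HomologicalComplex.iCycles_d _ _ _

variable {P X n} in
theorem exists_cocycles_lift {A : E} (y : A ⟶ P.obj (op (X.obj (op ⦋n⦌))))
    (hy : y ≫ cochainsD P X n = 0) : ∃ z, z ≫ cocyclesι P X n = y :=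
  ⟨HomologicalComplex.liftCycles _ y (n + 1) (ComplexShape.next_eq' _ (down_symm_rel n)) hy,
    HomologicalComplex.liftCycles_i _ _ _ _ _⟩

variable {X} in
theorem cyclesMap_cocyclesι {Y : SimplicialObject I} (f : Y ⟶ X) :
    HomologicalComplex.cyclesMap ((cochains.obj P).map f.op) n ≫ cocyclesι P Y n =
      cocyclesι P X n ≫ P.map (f.app (op ⦋n⦌)).op :=
  HomologicalComplex.cyclesMap_i _ _

variable {P} in
theorem cyclesMap_cocyclesι' {Q : Iᵒᵖ ⥤ E} (η : P ⟶ Q) :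
    HomologicalComplex.cyclesMap ((cochains.map η).app (op X)) n ≫ cocyclesι Q X n =
      cocyclesι P X n ≫ η.app _ :=
  HomologicalComplex.cyclesMap_i _ _

theorem cochainsD_zero : cochainsD P X 0 = P.map (X.δ 0).op - P.map (X.δ 1).op := by
  rw [cochainsD_eq, Fin.sum_univ_two]
  simp only [Fin.val_zero, pow_zero, one_smul, Fin.val_one, pow_one, neg_smul]
  exact (sub_eq_add_neg _ _).symm

end Cocycles

variable (P : Iᵒᵖ ⥤ E) {i : I}

theorem exists_augmentationCycles (X : SimplicialObject (Over i)) :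
    ∃ z, z ≫ cocyclesι P ((total i).obj X) 0 = P.map (augmentation X 0).op := by
  refine exists_cocycles_lift (P.map (augmentation X 0).op) ?_
  rw [cochainsD_zero, Preadditive.comp_sub, ← P.map_comp, ← P.map_comp, ← op_comp, ← op_comp,
    δ_augmentation, δ_augmentation, sub_self]

/-- The canonical map from `P(i)` to the zero cocycles of a simplicial object augmented by `i`. -/
def augmentationCycles (X : SimplicialObject (Over i)) :
    P.obj (op i) ⟶ ((cochains.obj P).obj (op ((total i).obj X))).cycles 0 :=
  (exists_augmentationCycles P X).choose

theorem augmentationCycles_ι (X : SimplicialObject (Over i)) :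
    augmentationCycles P X ≫ cocyclesι P _ 0 = P.map (augmentation X 0).op :=
  (exists_augmentationCycles P X).choose_spec

/-- The canonical map from `P(i)` to the zeroth cohomology of a simplicial object augmented
by `i`. -/
def augmentationMap (X : SimplicialObject (Over i)) :
    P.obj (op i) ⟶ ((cohomology 0).obj P).obj (op ((total i).obj X)) :=
  augmentationCycles P X ≫ HomologicalComplex.homologyπ _ 0 ≫ (cohomologyAppIso 0 P _).hom

theorem augmentationMap_comp {i' : I} {f : i' ⟶ i} {X : SimplicialObject (Over i)}
    {Z : SimplicialObject (Over i')} (ψ : (total i').obj Z ⟶ (total i).obj X)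
    (hψ : ψ.app (op ⦋0⦌) ≫ augmentation X 0 = augmentation Z 0 ≫ f) :
    augmentationMap P X ≫ ((cohomology 0).obj P).map ψ.op =
      P.map f.op ≫ augmentationMap P Z := by
  have h : augmentationCycles P X ≫
      HomologicalComplex.cyclesMap ((cochains.obj P).map ψ.op) 0 =
        P.map f.op ≫ augmentationCycles P Z := by
    rw [← cancel_mono (cocyclesι _ _ _), Category.assoc, Category.assoc, cyclesMap_cocyclesι,
      augmentationCycles_ι, ← P.map_comp, ← op_comp, ← hψ, op_comp, P.map_comp, ← Category.assoc,
      augmentationCycles_ι]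
  unfold augmentationMap
  rw [Category.assoc, Category.assoc, cohomologyAppIso_map,
    HomologicalComplex.homologyπ_naturality_assoc, reassoc_of% h]

theorem augmentationMap_naturality {P Q : Iᵒᵖ ⥤ E} (η : P ⟶ Q) (X : SimplicialObject (Over i)) :
    augmentationMap P X ≫ ((cohomology 0).map η).app _ = η.app (op i) ≫ augmentationMap Q X := by
  have h : augmentationCycles P X ≫
      HomologicalComplex.cyclesMap ((cochains.map η).app (op ((total i).obj X))) 0 =
        η.app (op i) ≫ augmentationCycles Q X := by
    rw [← cancel_mono (cocyclesι _ _ _), Category.assoc, Category.assoc, cyclesMap_cocyclesι',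
      augmentationCycles_ι, ← η.naturality, ← Category.assoc, augmentationCycles_ι]
  unfold augmentationMap
  rw [Category.assoc, Category.assoc, cohomologyAppIso_naturality,
    HomologicalComplex.homologyπ_naturality_assoc, reassoc_of% h]

variable {P}

/-- A zero cocycle is a section over `X_0` whose pullbacks along the two faces agree on `X_1`. Any
two maps `Z ⟶ X_0` over `i` lift locally to `X_1`, so such a section descends uniquely along the
cover `X_0 ⟶ i`. -/
theorem isIso_augmentationMap (hP : Presheaf.IsSheaf (topology F) P) (X : HCov F i) :
    IsIso (augmentationMap P X.obj) := by
  have hF := augmentation_zero_mem X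
  have hd := cocyclesι_D P ((total i).obj X.obj) 0
  rw [cochainsD_zero, Preadditive.comp_sub, sub_eq_zero] at hd
  obtain ⟨r, hr, -⟩ := existsUnique_gluing hP hF (cocyclesι P ((total i).obj X.obj) 0) (by
    intro Z p₁ p₂ e
    obtain ⟨T', c, x, hc, h₀, h₁⟩ : ∃ (T' : I) (c : T' ⟶ Z)
        (x : T' ⟶ ((total i).obj X.obj).obj (op ⦋1⦌)), F c ∧
          c ≫ p₁ = x ≫ ((total i).obj X.obj).δ 0 ∧ c ≫ p₂ = x ≫ ((total i).obj X.obj).δ 1 := by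
      obtain ⟨T', c, x, hc, hx⟩ := X.property.exists_filling_over (p₁ ≫ augmentation X.obj 0)
        ![p₁, p₂] (by
          intro j
          fin_cases j
          · rfl
          · exact e.symm) (isBoundaryFamily_zero _ _)
      exact ⟨T', c, x, hc, (hx 0).symm, (hx 1).symm⟩
    refine eq_of_comp_cover_eq hP hc ?_
    rw [Category.assoc, Category.assoc, ← P.map_comp, ← P.map_comp, ← op_comp, ← op_comp, h₀, h₁,
      op_comp, op_comp, P.map_comp, P.map_comp,
      reassoc_of% hd])
  have : IsIso (augmentationCycles P X.obj) := by
    refine ⟨r, ?_, ?_⟩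
    · refine eq_of_comp_cover_eq hP hF ?_
      rw [Category.assoc, hr, Category.id_comp, augmentationCycles_ι]
    · rw [← cancel_mono (cocyclesι _ _ _), Category.assoc, Category.id_comp, augmentationCycles_ι, hr]
  have := isIso_homologyπ_zero ((cochains.obj P).obj (op ((total i).obj X.obj)))
  unfold augmentationMap
  infer_instance

end

variable {I : Type w} [SmallCategory I] (F : MorphismProperty I)
  [F.IsMultiplicative] {E : Type u} [Category.{w} E] [Abelian E] [HasColimitsOfSize.{w, w} E]

/-- The constant hypercovering. -/
def constHCov (i : I) : HCov F i := ⟨_, isReedy_const (overClass F i) Over.mkIdTerminal⟩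

/-- The canonical map from `P(i)` to `D^0(P)(i)`. -/
def toDoldObj (P : Iᵒᵖ ⥤ E) (i : I) : P.obj (op i) ⟶ doldObj F 0 P i :=
  augmentationMap P (constHCov F i).obj ≫ doldι F 0 P (constHCov F i)

variable {F}

/-- Every hypercovering maps to the constant one, so the maps from `P(i)` agree in the colimit. -/
theorem augmentationMap_doldι (P : Iᵒᵖ ⥤ E) {i : I} (X : HCov F i) :
    augmentationMap P X.obj ≫ doldι F 0 P X = toDoldObj F P i := by
  let t : X ⟶ constHCov F i := ObjectProperty.homMk
    { app := fun m => Over.mkIdTerminal.from (X.obj.obj m)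
      naturality := fun _ _ _ => Over.mkIdTerminal.hom_ext _ _ }
  have h := augmentationMap_comp P (f := 𝟙 i) ((total i).map t.hom) (by
    rw [map_augmentation, Category.comp_id])
  unfold toDoldObj
  rw [← doldι_w 0 P t, ← Category.assoc, h, op_id, P.map_id, Category.id_comp]

theorem toDoldObj_mapPresheaf {P Q : Iᵒᵖ ⥤ E} (η : P ⟶ Q) (i : I) :
    η.app (op i) ≫ toDoldObj F Q i = toDoldObj F P i ≫ doldMapPresheaf 0 η i := by
  let X := constHCov F i
  rw [← augmentationMap_doldι P X, Category.assoc, doldι_mapPresheaf, ← Category.assoc,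
    augmentationMap_naturality, Category.assoc, augmentationMap_doldι]

variable [F.HasPullbacks] [F.IsStableUnderBaseChange]

theorem toDoldObj_map (P : Iᵒᵖ ⥤ E) {i' i : I} (f : i' ⟶ i) :
    P.map f.op ≫ toDoldObj F P i' = toDoldObj F P i ≫ doldMap 0 P f := by
  let X := constHCov F i
  rw [← augmentationMap_doldι P X, Category.assoc, doldι_map 0 P f (baseChangeMap f X),
    ← Category.assoc, augmentationMap_comp P (f := f) (totalMap (baseChangeMap f X))
      (Over.w ((baseChangeMap f X).app (op ⦋0⦌))), Category.assoc, augmentationMap_doldι]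

/-- For a sheaf every term of the colimit is already `P(i)`, compatibly with refinements. -/
theorem isIso_toDoldObj {P : Iᵒᵖ ⥤ E} (hP : Presheaf.IsSheaf (topology F) P) (i : I) :
    IsIso (toDoldObj F P i) := by
  have (X : HCov F i) : IsIso (augmentationMap P X.obj) := isIso_augmentationMap hP X
  have h {X Y : HCov F i} (t : Y ⟶ X) : ((cohomology 0).obj P).map ((total i).map t.hom).op ≫
      inv (augmentationMap P Y.obj) = inv (augmentationMap P X.obj) := by
    have e := augmentationMap_comp P (f := 𝟙 i) ((total i).map t.hom) (by
      rw [map_augmentation, Category.comp_id])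
    rw [op_id, P.map_id, Category.id_comp] at e
    rw [IsIso.comp_inv_eq, ← e, IsIso.inv_hom_id_assoc]
  refine ⟨doldDesc (fun X => inv (augmentationMap P X.obj)) h, ?_, ?_⟩
  · unfold toDoldObj
    rw [Category.assoc, doldι_desc, IsIso.hom_inv_id]
  · refine dold_hom_ext fun X => ?_
    rw [← Category.assoc, doldι_desc, ← augmentationMap_doldι P X, IsIso.inv_hom_id_assoc,
      Category.comp_id]

variable (F E) in
/-- The canonical map from `P` to `D^0(P)`. -/
def toDold : 𝟭 (Iᵒᵖ ⥤ E) ⟶ doldDerived F E 0 where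
  app P :=
    { app i := toDoldObj F P i.unop
      naturality _ _ f := toDoldObj_map P f.unop }
  naturality P Q η := by
    ext i
    exact toDoldObj_mapPresheaf η i.unop

theorem isIso_toDold_app {P : Iᵒᵖ ⥤ E} (hP : Presheaf.IsSheaf (topology F) P) :
    IsIso ((toDold F E).app P) := by
  have (i : Iᵒᵖ) : IsIso (((toDold F E).app P).app i) := isIso_toDoldObj hP i.unop
  exact NatIso.isIso_of_isIso_app _

/-- `D^0(P) ≅ P` for sheaves `P`. -/
def doldZeroIso :
    sheafToPresheaf (topology F) E ≅ sheafToPresheaf (topology F) E ⋙ doldDerived F E 0 :=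
  NatIso.ofComponents (fun P => @asIso _ _ _ _ _ (isIso_toDold_app P.property))
    (fun η => (toDold F E).naturality ((sheafToPresheaf (topology F) E).map η))

end SheafDegreeZero

/-! ### Free presheaves and their complexes -/

noncomputable section FreePresheaf

/-- By compactness the map factors through a finite subcoproduct, which is a biproduct, so it is the
sum of its components. -/
theorem exists_eq_sum_sigma {E : Type u} [Category.{w} E] [Abelian E]
    [HasColimitsOfSize.{w, w} E] {α : Type w} {A H : E} [IsFinitelyPresentable.{w} H]
    (x : H ⟶ ∐ fun _ : α => A) :
    ∃ (S : Finset α) (a : α → (H ⟶ A)), x = ∑ s ∈ S, a s ≫ Sigma.ι (fun _ : α => A) s := by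
  classical
  obtain ⟨S, p, rfl⟩ := IsFinitelyPresentable.exists_hom_of_isColimit
    (CoproductsFromFiniteFiltered.isColimitFiniteSubproductsCocone fun _ : α => A) x
  let T : Type w := { x // x ∈ S }
  let p' : H ⟶ ∐ fun _ : T => A := p
  let π (s : T) : (∐ fun _ : T => A) ⟶ A := Sigma.desc fun t => if t = s then 𝟙 A else 0
  have hid : ∑ s : T, π s ≫ Sigma.ι (fun _ : T => A) s = 𝟙 _ := by
    refine Sigma.hom_ext _ _ fun t => ?_
    rw [Preadditive.comp_sum, Finset.sum_eq_single t]
    · simp [π]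
    · intro s _ hs
      simp [π, hs.symm]
    · simp
  refine ⟨S.image fun s => s.as, fun s => if hs : ⟨s⟩ ∈ S then p' ≫ π ⟨⟨s⟩, hs⟩ else 0, ?_⟩
  change p' ≫ Sigma.desc (fun s : T => Sigma.ι (fun _ : α => A) s.1.as) = _
  have hp : p' = ∑ s : T, (p' ≫ π s) ≫ Sigma.ι (fun _ : T => A) s := by
    simp only [Category.assoc, ← Preadditive.comp_sum, hid, Category.comp_id]
  refine (congr($hp ≫ _)).trans ?_
  rw [Preadditive.sum_comp, Finset.sum_image (fun s _ t _ h => by ext; exact h),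
    ← Finset.sum_coe_sort S]
  refine Finset.sum_congr rfl fun s _ => ?_
  have hs : ⟨s.1.as⟩ ∈ S := s.2
  have e : (if hs : ⟨s.1.as⟩ ∈ S then p' ≫ π ⟨⟨s.1.as⟩, hs⟩ else 0) = p' ≫ π s := dif_pos hs
  rw [Category.assoc]
  refine Eq.trans ?_ (congr($e.symm ≫ Sigma.ι (fun _ : α => A) s.1.as))
  rw [Sigma.ι_desc]

variable {I : Type w} [SmallCategory I] {E : Type u} [Category.{w} E]
  [HasColimitsOfSize.{w, w} E]

/-- The presheaf freely generated by `A` at the object `X`. -/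
def freePresheaf (A : E) (X : I) : Iᵒᵖ ⥤ E where
  obj T := ∐ fun _ : T.unop ⟶ X => A
  map {T T'} g := Sigma.desc fun f => Sigma.ι (fun _ : T'.unop ⟶ X => A) (g.unop ≫ f)

/-- The inclusion of a summand. -/
def freeι (A : E) {X T : I} (f : T ⟶ X) : A ⟶ (freePresheaf A X).obj (op T) :=
  Sigma.ι (fun _ : T ⟶ X => A) f

theorem free_hom_ext {A B : E} {X T : I} {a b : (freePresheaf A X).obj (op T) ⟶ B}
    (h : ∀ f, freeι A f ≫ a = freeι A f ≫ b) : a = b :=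
  Sigma.hom_ext _ _ h

theorem exists_free_desc {A B : E} {X T : I} (b : (T ⟶ X) → (A ⟶ B)) :
    ∃ d : (freePresheaf A X).obj (op T) ⟶ B, ∀ f, freeι A f ≫ d = b f :=
  ⟨Sigma.desc b, fun _ => Sigma.ι_desc _ _⟩

theorem freeι_map (A : E) {X T T' : I} (f : T ⟶ X) (g : T' ⟶ T) :
    freeι A f ≫ (freePresheaf A X).map g.op = freeι A (g ≫ f) :=
  Sigma.ι_desc _ _

/-- The map from a free presheaf given by a section. -/
def freeDesc {A : E} {X : I} {P : Iᵒᵖ ⥤ E} (z : A ⟶ P.obj (op X)) : freePresheaf A X ⟶ P where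
  app T := Sigma.desc fun f => z ≫ P.map f.op
  naturality T T' g := Sigma.hom_ext _ _ fun f => by
    simp [freePresheaf]

theorem freeι_desc {A : E} {X T : I} {P : Iᵒᵖ ⥤ E} (z : A ⟶ P.obj (op X)) (f : T ⟶ X) :
    freeι A f ≫ (freeDesc z).app (op T) = z ≫ P.map f.op :=
  Sigma.ι_desc _ _

theorem freePresheaf_hom_ext {A : E} {X : I} {P : Iᵒᵖ ⥤ E} {a b : freePresheaf A X ⟶ P}
    (h : freeι A (𝟙 X) ≫ a.app (op X) = freeι A (𝟙 X) ≫ b.app (op X)) : a = b := by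
  ext ⟨T⟩
  refine free_hom_ext fun f => ?_
  rw [← Category.comp_id f, ← freeι_map, Category.assoc, Category.assoc, NatTrans.naturality,
    NatTrans.naturality, reassoc_of% h]

variable [Abelian E]

/-- The differential of the complex of presheaves freely generated by `A` at `X`. -/
def freeD (A : E) (X : SimplicialObject I) (k : ℕ) :
    freePresheaf A (X.obj (op ⦋k + 1⦌)) ⟶ freePresheaf A (X.obj (op ⦋k⦌)) :=
  freeDesc (∑ j : Fin (k + 2), (-1 : ℤ) ^ (j : ℕ) • freeι A (X.δ j))

theorem freeι_D (A : E) (X : SimplicialObject I) (k : ℕ) {T : I} (f : T ⟶ X.obj (op ⦋k + 1⦌)) :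
    freeι A f ≫ (freeD A X k).app (op T) =
      ∑ j : Fin (k + 2), (-1 : ℤ) ^ (j : ℕ) • freeι A (f ≫ X.δ j) := by
  unfold freeD
  rw [freeι_desc, Preadditive.sum_comp]
  refine Finset.sum_congr rfl fun j _ => ?_
  rw [Preadditive.zsmul_comp, freeι_map]

/-- Maps from the free presheaf at `X_k` to `P` are maps `A ⟶ P(X_k)`, and under this identification
`freeD` induces the differential of cochains. -/
theorem freeD_desc {A : E} (X : SimplicialObject I) (k : ℕ) {P : Iᵒᵖ ⥤ E}
    (z : A ⟶ P.obj (op (X.obj (op ⦋k⦌)))) :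
    freeD A X k ≫ freeDesc z = freeDesc (z ≫ cochainsD P X k) := by
  refine freePresheaf_hom_ext ?_
  rw [NatTrans.comp_app, ← Category.assoc, freeι_D, Preadditive.sum_comp, freeι_desc, op_id,
    P.map_id, Category.comp_id, cochainsD_eq, Preadditive.comp_sum]
  refine Finset.sum_congr rfl fun j _ => ?_
  rw [Preadditive.zsmul_comp, freeι_desc, Preadditive.comp_zsmul, Category.id_comp]

end FreePresheaf

/-! ### Acyclicity of injective sheaves -/

noncomputable section InjectiveSheaf

variable {I : Type w} [SmallCategory I] {F : MorphismProperty I}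
  [F.IsMultiplicative] [F.HasPullbacks] [F.IsStableUnderBaseChange]
  {E : Type u} [Category.{w} E] [Abelian E] [IsLocallyFinitelyPresentable.{w} E]

/-- The free complex on `X` is locally exact: after a cover of `T`, a section of the kernel lies in
the image of the next differential, which `y` kills. Since `P` is separated, `y` kills the section
itself. Testing against compact objects reduces sections to finite sums of simplices. -/
theorem ker_freeD_comp_eq_zero {P : Iᵒᵖ ⥤ E} (hP : Presheaf.IsSheaf (topology F) P) {i : I}
    (X : HCov F i) {n : ℕ} {A : E} (y : freePresheaf A (((total i).obj X.obj).obj (op ⦋n + 1⦌)) ⟶ P)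
    (hy : freeD A ((total i).obj X.obj) (n + 1) ≫ y = 0) :
    kernel.ι (freeD A ((total i).obj X.obj) n) ≫ y = 0 := by
  obtain ⟨Q, _, hQ, hs, _⟩ := exists_compactGenerator E
  ext ⟨T⟩
  refine hs _ _ fun H hH x => ?_
  have := hQ H hH
  let Y := (total i).obj X.obj
  let κ := kernel.ι (freeD A Y n)
  have hκ : κ ≫ freeD A Y n = 0 := kernel.condition _
  change x ≫ κ.app (op T) ≫ y.app (op T) = x ≫ 0
  rw [← Category.assoc, comp_zero]
  have hx : (x ≫ κ.app (op T)) ≫ (freeD A Y n).app (op T) = 0 := by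
    rw [Category.assoc, ← NatTrans.comp_app, hκ]
    exact comp_zero
  generalize x ≫ κ.app (op T) = x' at hx ⊢
  obtain ⟨S, a, rfl⟩ : ∃ (S : Finset (T ⟶ Y.obj (op ⦋n + 1⦌))) (a : _ → (H ⟶ A)),
      x' = ∑ s ∈ S, a s ≫ freeι A s := exists_eq_sum_sigma x'
  obtain ⟨T', c, S', hc, hS, h⟩ := exists_local_homotopy_total X.property S.finite_toSet
  obtain ⟨τ, σ, -, h⟩ := h (fun k => A ⟶ (freePresheaf A (Y.obj (op ⦋k⦌))).obj (op T'))
    (fun k x => freeι A x) (fun k => Preadditive.rightComp _ ((freeD A Y k).app (op T')))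
    (fun k x => freeι_D A Y k x)
  refine eq_of_comp_cover_eq hP hc ?_
  obtain ⟨r, hr⟩ := exists_free_desc (σ n)
  -- The homotopy identity of the cones, summed with coefficients `a s`; its last term contains the
  -- differential of the section, which is zero.
  have e : (∑ s ∈ S, a s ≫ freeι A s) ≫ (freePresheaf A _).map c.op =
      (∑ s ∈ S, a s ≫ σ (n + 1) s) ≫ (freeD A Y (n + 1)).app (op T') +
      ((∑ s ∈ S, a s ≫ freeι A s) ≫ (freeD A Y n).app (op T)) ≫ r := by
    simp only [Preadditive.sum_comp, Category.assoc, ← Finset.sum_add_distrib,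
      ← Preadditive.comp_add]
    refine Finset.sum_congr rfl fun s hs => ?_
    rw [freeι_map]
    refine congr(a s ≫ $((h n s (hS hs)).symm)).trans ?_
    refine congr(a s ≫ ($rfl + $(?_)))
    rw [← Category.assoc, freeι_D, Preadditive.sum_comp]
    refine Finset.sum_congr rfl fun j _ => ?_
    rw [Preadditive.zsmul_comp, hr]
  rw [hx, zero_comp, add_zero] at e
  rw [zero_comp, Category.assoc, ← y.naturality, reassoc_of% e, ← NatTrans.comp_app, hy]
  exact comp_zero

/-- As `y` kills the kernel of `freeD`, it factors through the coimage, a subobject of the free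
presheaf at `X_n`. Injectivity of `P` among presheaves extends it there, and the extension is the
cochain `z`. -/
theorem exists_comp_cochainsD_eq {P : Iᵒᵖ ⥤ E} [Injective P]
    (hP : Presheaf.IsSheaf (topology F) P) {i : I} (X : HCov F i) {n : ℕ} {A : E}
    (y : A ⟶ P.obj (op (((total i).obj X.obj).obj (op ⦋n + 1⦌))))
    (hy : y ≫ cochainsD P ((total i).obj X.obj) (n + 1) = 0) :
    ∃ z, z ≫ cochainsD P ((total i).obj X.obj) n = y := by
  have hy' : freeD A ((total i).obj X.obj) (n + 1) ≫ freeDesc y = 0 := by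
    rw [freeD_desc, hy]
    refine freePresheaf_hom_ext ?_
    rw [freeι_desc]
    simp
  have h0 := ker_freeD_comp_eq_zero hP X _ hy'
  let D := freeD A ((total i).obj X.obj) n
  let y' : Abelian.coimage D ⟶ P := cokernel.desc _ _ h0
  obtain ⟨g, hg⟩ := Injective.factors y' (Abelian.factorThruCoimage D)
  have e : D ≫ g = freeDesc y := by
    rw [← Abelian.coimage.fac D, Category.assoc, hg]
    exact cokernel.π_desc _ _ _
  refine ⟨freeι A (𝟙 _) ≫ g.app _, ?_⟩
  have hg' : g = freeDesc (freeι A (𝟙 _) ≫ g.app _) := freePresheaf_hom_ext (by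
    rw [freeι_desc, op_id, P.map_id, Category.comp_id])
  rw [hg'] at e
  have e' : freeDesc _ = freeDesc y := (freeD_desc _ _ _).symm.trans e
  have := congr(freeι A (𝟙 _) ≫ NatTrans.app $e' (op _))
  rwa [freeι_desc, freeι_desc, op_id, P.map_id, Category.comp_id, Category.comp_id] at this

theorem isZero_doldDerived_injective (J : Sheaf (topology F) E) [Injective J] (n : ℕ) :
    IsZero ((doldDerived F E (n + 1)).obj ((sheafToPresheaf (topology F) E).obj J)) := by
  -- The right adjoint `e` of the exact functor `a` preserves injectives.
  have hJ : Injective ((sheafToPresheaf (topology F) E).obj J) :=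
    Injective.injective_of_adjoint (sheafificationAdjunction (topology F) E) J
  generalize hP : (sheafToPresheaf (topology F) E).obj J = P at hJ ⊢
  have hP' : Presheaf.IsSheaf (topology F) P := by
    rw [← hP]
    exact J.property
  refine Functor.isZero _ fun i => (IsZero.iff_id_eq_zero _).2 ?_
  refine dold_hom_ext fun X => ?_
  have : doldι F (n + 1) P X = 0 := by
    rw [← cancel_epi (cohomologyAppIso (n + 1) P _).hom,
      ← cancel_epi (HomologicalComplex.homologyπ _ (n + 1)), comp_zero, comp_zero]
    -- Applied to the universal cocycle, with the object of cocycles itself as `A`: the inclusion of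
    -- cocycles lifts through the differential.
    obtain ⟨z, hz⟩ := exists_comp_cochainsD_eq hP' X _ (cocyclesι_D P _ _)
    have h : HomologicalComplex.homologyπ ((cochains.obj P).obj (op ((total i.unop).obj X.obj)))
        (n + 1) = 0 := by
      have hd : cochainsD P ((total i.unop).obj X.obj) n ≫ HomologicalComplex.pOpcycles
          ((cochains.obj P).obj (op ((total i.unop).obj X.obj))) (n + 1) = 0 :=
        HomologicalComplex.d_pOpcycles _ n (n + 1)
      rw [← cancel_mono (HomologicalComplex.homologyι _ _), HomologicalComplex.homology_π_ι,
        zero_comp]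
      refine (congr($hz.symm ≫ _)).trans ((Category.assoc _ _ _).trans ?_)
      exact (congr(z ≫ $hd)).trans comp_zero
    rw [h, zero_comp]
  rw [this]
  exact zero_comp.trans zero_comp.symm

end InjectiveSheaf

/-! ### Cocycles of injective complexes under a left exact functor -/

noncomputable section DeltaFunctor

variable {C : Type*} [Category* C] [Abelian C] {D : Type*} [Category* D] [Abelian D]

theorem nonempty_iso_of_exact_of_epi {A B M N : D} {f : A ⟶ B} {p : B ⟶ M} {q : B ⟶ N}
    {hp : f ≫ p = 0} {hq : f ≫ q = 0} (h : (ShortComplex.mk f p hp).Exact) (_ : Epi p)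
    (h' : (ShortComplex.mk f q hq).Exact) (_ : Epi q) : Nonempty (M ≅ N) := by
  have : Epi (ShortComplex.mk f p hp).g := by assumption
  have : Epi (ShortComplex.mk f q hq).g := by assumption
  exact ⟨h.gIsCokernel.coconePointUniqueUpToIso h'.gIsCokernel⟩

theorem exact_of_isIso_comp {A B B' M : D} {f : A ⟶ B} {m : B ⟶ B'} [IsIso m] {f' : A ⟶ B'}
    {g : B' ⟶ M} {w : f ≫ m ≫ g = 0} (hf : f ≫ m = f') (w' : f' ≫ g = 0)
    (h : (ShortComplex.mk f' g w').Exact) : (ShortComplex.mk f (m ≫ g) w).Exact := by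
  let φ : ShortComplex.mk f (m ≫ g) w ≅ ShortComplex.mk f' g w' :=
    ShortComplex.isoMk (Iso.refl _) (asIso m) (Iso.refl _)
      ((Category.id_comp _).trans hf.symm) (Category.comp_id _).symm
  exact ShortComplex.exact_of_iso φ.symm h

variable (C) in
/-- The cochain complexes of injective objects that are exact in positive degrees. -/
def IsInjectiveAcyclic : ObjectProperty (CochainComplex C ℕ) := fun K =>
  (∀ n, Injective (K.X n)) ∧ ∀ n, K.ExactAt (n + 1)

/-- The short complex `Z^b ⟶ K^b ⟶ Z^{b+1}`. -/
def cyclesSC (K : CochainComplex C ℕ) (b : ℕ) : ShortComplex C where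
  X₁ := K.cycles b
  X₂ := K.X b
  X₃ := K.cycles (b + 1)
  f := K.iCycles b
  g := K.toCycles b (b + 1)
  zero := by
    rw [← cancel_mono (K.iCycles (b + 1)), Category.assoc, HomologicalComplex.toCycles_i,
      HomologicalComplex.iCycles_d, zero_comp]

/-- The functoriality of `cyclesSC`. -/
def cyclesSCMap {K L : CochainComplex C ℕ} (φ : K ⟶ L) (b : ℕ) : cyclesSC K b ⟶ cyclesSC L b where
  τ₁ := HomologicalComplex.cyclesMap φ b
  τ₂ := φ.f b
  τ₃ := HomologicalComplex.cyclesMap φ (b + 1)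
  comm₁₂ := HomologicalComplex.cyclesMap_i _ _
  comm₂₃ := by
    have h : φ.f b ≫ L.toCycles b (b + 1) =
        K.toCycles b (b + 1) ≫ HomologicalComplex.cyclesMap φ (b + 1) := by
      rw [← cancel_mono (HomologicalComplex.iCycles _ _)]
      simp
    exact h

/-- The cokernel of `K^b ⟶ Z^{b+1}` is the cohomology in degree `b + 1`, which vanishes. -/
theorem cyclesSC_shortExact {K : CochainComplex C ℕ} {b : ℕ} (hK : K.ExactAt (b + 1)) :
    (cyclesSC K b).ShortExact where
  exact := by
    refine ShortComplex.exact_of_f_is_kernel _ (KernelFork.IsLimit.ofι _ _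
      (fun k hk => K.liftCycles k (b + 1) (CochainComplex.next ℕ b) ?_)
      (fun k hk => K.liftCycles_i _ _ _ _)
      (fun k hk m hm => ?_))
    · have h : k ≫ K.toCycles b (b + 1) = 0 := hk
      rw [← K.toCycles_i]
      exact (Category.assoc _ _ _).symm.trans ((congr($h ≫ _)).trans zero_comp)
    · exact (cancel_mono (K.iCycles b)).1 (hm.trans (K.liftCycles_i _ _ _ _).symm)
  mono_f := inferInstanceAs (Mono (K.iCycles b))
  epi_g := by
    have h := ShortComplex.exact_of_g_is_cokernel
      (ShortComplex.mk _ _ (K.toCycles_comp_homologyπ b (b + 1)))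
      (K.homologyIsCokernel b (b + 1) (CochainComplex.prev_nat_succ b))
    exact h.epi_f ((hK.isZero_homology).eq_of_tgt _ _)

theorem isIso_of_isLimit_kernelFork {A A' X Y : D} {d : X ⟶ Y} {k : A ⟶ X} {k' : A' ⟶ X}
    {w : k ≫ d = 0} {w' : k' ≫ d = 0} (h : IsLimit (KernelFork.ofι k w))
    (h' : IsLimit (KernelFork.ofι k' w')) (m : A ⟶ A') (hm : m ≫ k' = k) : IsIso m := by
  have : m = (h.conePointUniqueUpToIso h').hom := by
    refine Fork.IsLimit.hom_ext h' (hm.trans ?_)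
    exact (h.conePointUniqueUpToIso_hom_comp h' WalkingParallelPair.zero).symm
  rw [this]
  infer_instance

theorem exists_kernelFork_map_isLimit (e : C ⥤ D) [e.Additive] [PreservesFiniteLimits e]
    {A X Y : C} {d : X ⟶ Y} {k : A ⟶ X} {w : k ≫ d = 0} (h : IsLimit (KernelFork.ofι k w)) :
    ∃ w' : e.map k ≫ e.map d = 0, Nonempty (IsLimit (KernelFork.ofι (e.map k) w')) :=
  ⟨by rw [← e.map_comp, w, e.map_zero],
    ⟨IsLimit.ofIsoLimit (KernelFork.mapIsLimit _ h e)
      (Fork.ext (Iso.refl _) (Category.id_comp _))⟩⟩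

variable (e : C ⥤ D) [e.Additive]

/-- The inclusion of the cocycles of the image of a complex. -/
def mapCyclesι (K : CochainComplex C ℕ) (b : ℕ) :
    ((e.mapHomologicalComplex _).obj K).cycles b ⟶ e.obj (K.X b) :=
  ((e.mapHomologicalComplex _).obj K).iCycles b

instance (K : CochainComplex C ℕ) (b : ℕ) : Mono (mapCyclesι e K b) :=
  inferInstanceAs (Mono (((e.mapHomologicalComplex _).obj K).iCycles b))

theorem cyclesMap_mapCyclesι {K L : CochainComplex C ℕ} (φ : K ⟶ L) (b : ℕ) :
    HomologicalComplex.cyclesMap ((e.mapHomologicalComplex _).map φ) b ≫ mapCyclesι e L b =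
      mapCyclesι e K b ≫ e.map (φ.f b) :=
  HomologicalComplex.cyclesMap_i _ _

/-- The differential of the image of a complex, as a map to cocycles. -/
def mapToCycles (K : CochainComplex C ℕ) (b : ℕ) :
    e.obj (K.X b) ⟶ ((e.mapHomologicalComplex _).obj K).cycles (b + 1) :=
  ((e.mapHomologicalComplex _).obj K).toCycles b (b + 1)

theorem mapToCycles_ι (K : CochainComplex C ℕ) (b : ℕ) :
    mapToCycles e K b ≫ mapCyclesι e K (b + 1) = e.map (K.d b (b + 1)) :=
  HomologicalComplex.toCycles_i _ _ _

theorem exists_mapToCycles_exact (K : CochainComplex C ℕ) (b : ℕ) :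
    ∃ w : mapToCycles e K b ≫ ((e.mapHomologicalComplex _).obj K).homologyπ (b + 1) = 0,
      (ShortComplex.mk _ _ w).Exact :=
  ⟨HomologicalComplex.toCycles_comp_homologyπ _ _ _, ShortComplex.exact_of_g_is_cokernel _
    (HomologicalComplex.homologyIsCokernel _ b (b + 1) (CochainComplex.prev_nat_succ b))⟩

variable [PreservesFiniteLimits e]

theorem exists_mapCyclesHom (K : CochainComplex C ℕ) (b : ℕ) :
    ∃ z : e.obj (K.cycles b) ⟶ ((e.mapHomologicalComplex _).obj K).cycles b,
      z ≫ mapCyclesι e K b = e.map (K.iCycles b) ∧ IsIso z := by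
  obtain ⟨w, ⟨h⟩⟩ := exists_kernelFork_map_isLimit e
    (K.cyclesIsKernel b (b + 1) (CochainComplex.next ℕ b))
  have h' : IsLimit (KernelFork.ofι (mapCyclesι e K b) _) :=
    HomologicalComplex.cyclesIsKernel _ b (b + 1) (CochainComplex.next ℕ b)
  obtain ⟨z, hz⟩ := KernelFork.IsLimit.lift' h' _ w
  exact ⟨z, hz, isIso_of_isLimit_kernelFork h h' z hz⟩

/-- The canonical isomorphism from the image of cycles to the cycles of the image. -/
def mapCyclesHom (K : CochainComplex C ℕ) (b : ℕ) :
    e.obj (K.cycles b) ⟶ ((e.mapHomologicalComplex _).obj K).cycles b :=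
  (exists_mapCyclesHom e K b).choose

theorem mapCyclesHom_ι (K : CochainComplex C ℕ) (b : ℕ) :
    mapCyclesHom e K b ≫ mapCyclesι e K b = e.map (K.iCycles b) :=
  (exists_mapCyclesHom e K b).choose_spec.1

instance (K : CochainComplex C ℕ) (b : ℕ) : IsIso (mapCyclesHom e K b) :=
  (exists_mapCyclesHom e K b).choose_spec.2

theorem mapCyclesHom_naturality {K L : CochainComplex C ℕ} (φ : K ⟶ L) (b : ℕ) :
    e.map (HomologicalComplex.cyclesMap φ b) ≫ mapCyclesHom e L b = mapCyclesHom e K b ≫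
      HomologicalComplex.cyclesMap ((e.mapHomologicalComplex _).map φ) b := by
  rw [← cancel_mono (mapCyclesι e L b), Category.assoc, Category.assoc, mapCyclesHom_ι,
    cyclesMap_mapCyclesι, ← e.map_comp, HomologicalComplex.cyclesMap_i, e.map_comp,
    ← Category.assoc, mapCyclesHom_ι]

theorem map_toCycles (K : CochainComplex C ℕ) (b : ℕ) :
    e.map (K.toCycles b (b + 1)) ≫ mapCyclesHom e K (b + 1) = mapToCycles e K b := by
  rw [← cancel_mono (mapCyclesι e K (b + 1)), Category.assoc, mapCyclesHom_ι, mapToCycles_ι,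
    ← e.map_comp, HomologicalComplex.toCycles_i]

/-- Together with the surjectivity of `homologyπ`, this presents the cohomology of `e(K)` in degree
`b + 1` as the cokernel of `e(K^b) ⟶ e(Z^{b+1})`. Left exactness of `e` serves to identify
`e(Z^{b+1})` with the cocycles of `e(K)`. -/
theorem exists_map_toCycles_exact (K : CochainComplex C ℕ) (b : ℕ) :
    ∃ w : e.map (K.toCycles b (b + 1)) ≫ mapCyclesHom e K (b + 1) ≫
      HomologicalComplex.homologyπ _ (b + 1) = 0, (ShortComplex.mk _ _ w).Exact := by
  obtain ⟨w, h⟩ := exists_mapToCycles_exact e K b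
  refine ⟨by rw [← Category.assoc, map_toCycles, w], ?_⟩
  exact exact_of_isIso_comp (map_toCycles e K b) w h

section

variable (C)

/-- The restriction of the functor of `b`-cocycles. -/
abbrev cyclesF (b : ℕ) : (IsInjectiveAcyclic C).FullSubcategory ⥤ C :=
  (IsInjectiveAcyclic C).ι ⋙ HomologicalComplex.cyclesFunctor C _ b

variable {C}

/-- The cohomology of the image of a complex under `e`. -/
abbrev mapHomologyF (b : ℕ) : (IsInjectiveAcyclic C).FullSubcategory ⥤ D :=
  (IsInjectiveAcyclic C).ι ⋙ e.mapHomologicalComplex _ ⋙ HomologicalComplex.homologyFunctor D _ b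

/-- The natural transformation `K^b ⟶ Z^{b+1}`. -/
def toCyclesF (b : ℕ) : (IsInjectiveAcyclic C).ι ⋙ HomologicalComplex.eval C _ b ⟶
    cyclesF C (b + 1) where
  app K := K.obj.toCycles b (b + 1)
  naturality _ _ φ := (cyclesSCMap φ.hom b).comm₂₃

/-- The projection from the image of cocycles to the cohomology of the image. -/
def mapCyclesToHomologyF (b : ℕ) : cyclesF C b ⋙ e ⟶ mapHomologyF e b where
  app K := mapCyclesHom e K.obj b ≫ HomologicalComplex.homologyπ _ b
  naturality K L φ := by
    change e.map (HomologicalComplex.cyclesMap φ.hom b) ≫ mapCyclesHom e L.obj b ≫ _ =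
      (mapCyclesHom e K.obj b ≫ _) ≫ HomologicalComplex.homologyMap _ b
    rw [← Category.assoc, mapCyclesHom_naturality, Category.assoc, Category.assoc,
      HomologicalComplex.homologyπ_naturality]
    rfl

end

end DeltaFunctor

/-! ### Effaceable delta functors and right derived functors -/

theorem exact_of_isIso_comp_left {D : Type*} [Category* D] [Abelian D] {A A' B M : D} {f : A ⟶ B}
    {m : A' ⟶ A} [IsIso m] {g : B ⟶ M} {w : f ≫ g = 0} {w' : (m ≫ f) ≫ g = 0}
    (h : (ShortComplex.mk f g w).Exact) : (ShortComplex.mk (m ≫ f) g w').Exact := by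
  let φ : ShortComplex.mk (m ≫ f) g w' ≅ ShortComplex.mk f g w :=
    ShortComplex.isoMk (asIso m) (Iso.refl _) (Iso.refl _) (Category.comp_id _).symm
      ((Category.id_comp _).trans (Category.comp_id _).symm)
  exact ShortComplex.exact_of_iso φ.symm h

theorem comp_square {D : Type*} [Category* D] {A A' B B' M M' : D} {f : A ⟶ A'} {g : B ⟶ B'}
    {h : M ⟶ M'} {a : A ⟶ B} {a' : A' ⟶ B'} {b : B ⟶ M} {b' : B' ⟶ M'} (h₁ : f ≫ a' = a ≫ g)
    (h₂ : g ≫ b' = b ≫ h) : f ≫ a' ≫ b' = (a ≫ b) ≫ h := by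
  rw [reassoc_of% h₁, h₂, Category.assoc]

noncomputable section Universal

variable {C : Type*} [Category* C] [Abelian C] {D : Type*} [Category* D] [Abelian D]

/-- A sequence of functors with connecting maps that make the sequences
`G^n(X₂) ⟶ G^n(X₃) ⟶ G^{n+1}(X₁) ⟶ G^{n+1}(X₂)` exact, and that is effaced by injective
objects. -/
structure EffaceableDelta (G : ℕ → C ⥤ D) where
  /-- The connecting map. -/
  δ {S : ShortComplex C} (hS : S.ShortExact) (n : ℕ) : (G n).obj S.X₃ ⟶ (G (n + 1)).obj S.X₁
  δ_naturality {S S' : ShortComplex C} (hS : S.ShortExact) (hS' : S'.ShortExact) (φ : S ⟶ S')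
    (n : ℕ) : (G n).map φ.τ₃ ≫ δ hS' n = δ hS n ≫ (G (n + 1)).map φ.τ₁
  exact₃ {S : ShortComplex C} (hS : S.ShortExact) (n : ℕ) :
    ∃ w : (G n).map S.g ≫ δ hS n = 0, (ShortComplex.mk _ _ w).Exact
  exact₁ {S : ShortComplex C} (hS : S.ShortExact) (n : ℕ) :
    ∃ w : δ hS n ≫ (G (n + 1)).map S.f = 0, (ShortComplex.mk _ _ w).Exact
  isZero_injective (J : C) [Injective J] (n : ℕ) : IsZero ((G (n + 1)).obj J)

namespace EffaceableDelta

variable {G : ℕ → C ⥤ D} (d : EffaceableDelta G)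

/-- The connecting map `G^n(Z^{b+1}) ⟶ G^{n+1}(Z^b)`. -/
def cyclesδ (n b : ℕ) : cyclesF C (b + 1) ⋙ G n ⟶ cyclesF C b ⋙ G (n + 1) where
  app K := d.δ (cyclesSC_shortExact (K.property.2 b)) n
  naturality K L φ := d.δ_naturality (cyclesSC_shortExact (K.property.2 b))
    (cyclesSC_shortExact (L.property.2 b)) (cyclesSCMap φ.hom b) n

theorem epi_cyclesδ (n b : ℕ) : Epi (d.cyclesδ n b) := by
  rw [NatTrans.epi_iff_epi_app]
  intro K
  have := K.property.1 b
  obtain ⟨w, h⟩ := d.exact₁ (cyclesSC_shortExact (K.property.2 b)) n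
  exact h.epi_f ((d.isZero_injective (K.obj.X b) n).eq_of_tgt _ _)

theorem isIso_cyclesδ (n b : ℕ) : IsIso (d.cyclesδ (n + 1) b) := by
  have := d.epi_cyclesδ (n + 1) b
  have : Mono (d.cyclesδ (n + 1) b) := by
    rw [NatTrans.mono_iff_mono_app]
    intro K
    have := K.property.1 b
    obtain ⟨w, h⟩ := d.exact₃ (cyclesSC_shortExact (K.property.2 b)) (n + 1)
    exact h.mono_g ((d.isZero_injective (K.obj.X b) n).eq_of_src _ _)
  exact isIso_of_mono_of_epi _

variable {e : C ⥤ D} [e.Additive] [PreservesFiniteLimits e]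

/-- Dimension shifting, carried out naturally in the complex `K`. For `a = 0`, both sides are the
cokernel of `e(K^b) ⟶ e(Z^{b+1})`; each further step trades one degree of `G` for one degree of
cocycles, since `G` vanishes on `K^b` in positive degrees. -/
theorem nonempty_cycles_iso (d : EffaceableDelta G) (i₀ : e ≅ G 0) (a b N : ℕ) (h : a + b = N) :
    Nonempty (cyclesF C b ⋙ G (a + 1) ≅ mapHomologyF e (N + 1)) := by
  induction a generalizing b with
  | zero =>
    obtain rfl : b = N := by omega
    let f := Functor.whiskerRight (toCyclesF (C := C) b) e
    let p : cyclesF C (b + 1) ⋙ e ⟶ cyclesF C b ⋙ G 1 :=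
      Functor.whiskerLeft _ i₀.hom ≫ d.cyclesδ 0 b
    let q := mapCyclesToHomologyF e (C := C) (b + 1)
    have hp (K : (IsInjectiveAcyclic C).FullSubcategory) : ∃ w : f.app K ≫ p.app K = 0,
        (ShortComplex.mk _ _ w).Exact := by
      let δ : (G 0).obj (K.obj.cycles (b + 1)) ⟶ (G 1).obj (K.obj.cycles b) :=
        d.δ (cyclesSC_shortExact (K.property.2 b)) 0
      obtain ⟨w, h⟩ : ∃ w : (G 0).map (K.obj.toCycles b (b + 1)) ≫ δ = 0,
        (ShortComplex.mk _ _ w).Exact := d.exact₃ (cyclesSC_shortExact (K.property.2 b)) 0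
      have e₁ : f.app K ≫ i₀.hom.app _ =
          i₀.hom.app (K.obj.X b) ≫ (G 0).map (K.obj.toCycles b (b + 1)) :=
        i₀.hom.naturality _
      have w' : (i₀.hom.app (K.obj.X b) ≫ (G 0).map (K.obj.toCycles b (b + 1))) ≫ δ = 0 := by
        rw [Category.assoc, w, comp_zero]
      have w'' : f.app K ≫ i₀.hom.app _ ≫ δ = 0 :=
        (Category.assoc _ _ _).symm.trans ((congr($e₁ ≫ _)).trans w')
      have : IsIso (i₀.hom.app (K.obj.X b)) := inferInstance
      exact ⟨w'', exact_of_isIso_comp e₁ w' (exact_of_isIso_comp_left (m := i₀.hom.app (K.obj.X b)) h)⟩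
    have hq (K : (IsInjectiveAcyclic C).FullSubcategory) : ∃ w : f.app K ≫ q.app K = 0,
        (ShortComplex.mk _ _ w).Exact := exists_map_toCycles_exact e K.obj b
    have hp₀ : f ≫ p = 0 := by
      ext K
      exact (hp K).choose
    have hq₀ : f ≫ q = 0 := by
      ext K
      exact (hq K).choose
    have hep : Epi p := by
      have := d.epi_cyclesδ 0 b
      exact epi_comp _ _
    have heq : Epi q := by
      rw [NatTrans.epi_iff_epi_app]
      intro K
      exact epi_comp (mapCyclesHom e K.obj (b + 1)) (HomologicalComplex.homologyπ _ (b + 1))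
    exact nonempty_iso_of_exact_of_epi (hp := hp₀) (hq := hq₀)
      (exact_of_forall_evaluation _ fun K => (hp K).choose_spec) hep
      (exact_of_forall_evaluation _ fun K => (hq K).choose_spec) heq
  | succ a ih =>
    obtain ⟨α⟩ := ih (b + 1) (by omega)
    have := d.isIso_cyclesδ a b
    exact ⟨(asIso (d.cyclesδ (a + 1) b)).symm ≪≫ α⟩

variable [HasInjectiveResolutions C]

/-- The injective resolution as an object of the category of acyclic complexes. -/
def resolution (X : C) : (IsInjectiveAcyclic C).FullSubcategory :=
  ⟨(injectiveResolution X).cocomplex, fun _ => inferInstance,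
    (injectiveResolution X).cocomplex_exactAt_succ⟩

theorem exists_toCycles_resolution (X : C) :
    ∃ z : X ⟶ (resolution X).obj.cycles 0,
      z ≫ (resolution X).obj.iCycles 0 = (injectiveResolution X).ι.f 0 ∧ IsIso z := by
  have h' : IsLimit (KernelFork.ofι ((resolution X).obj.iCycles 0) _) :=
    HomologicalComplex.cyclesIsKernel _ 0 1 (CochainComplex.next ℕ 0)
  obtain ⟨z, hz⟩ := KernelFork.IsLimit.lift' h' _ (injectiveResolution X).ι_f_zero_comp_complex_d
  exact ⟨z, hz, isIso_of_isLimit_kernelFork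
    (w := (injectiveResolution X).ι_f_zero_comp_complex_d) (injectiveResolution X).isLimitKernelFork h' z hz⟩

/-- For an injective resolution `K` of `X` one has `Z^0 = X`, so the case `b = 0` of the dimension
shift gives the isomorphism on objects. It is natural in `X` because a map of objects lifts to a map
of resolutions and the shift is natural in `K`. -/
theorem nonempty_iso_rightDerived (d : EffaceableDelta G) (i₀ : e ≅ G 0) (n : ℕ) :
    Nonempty (G n ≅ e.rightDerived n) := by
  cases n with
  | zero => exact ⟨i₀.symm ≪≫ e.rightDerivedZeroIsoSelf.symm⟩
  | succ n =>
    obtain ⟨α⟩ := d.nonempty_cycles_iso i₀ n 0 n (by omega)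
    choose z hz hz' using exists_toCycles_resolution (C := C)
    refine ⟨NatIso.ofComponents (fun X => (G (n + 1)).mapIso (asIso (z X)) ≪≫
      α.app (resolution X) ≪≫ ((injectiveResolution X).isoRightDerivedObj e (n + 1)).symm) ?_⟩
    intro X Y f
    let φ : resolution X ⟶ resolution Y := ObjectProperty.homMk
      (InjectiveResolution.desc f (injectiveResolution Y) (injectiveResolution X))
    have hφ : (injectiveResolution X).ι.f 0 ≫ φ.hom.f 0 = f ≫ (injectiveResolution Y).ι.f 0 :=
      InjectiveResolution.desc_commutes_zero f (injectiveResolution Y) (injectiveResolution X)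
    have h₁ : f ≫ z Y = z X ≫ HomologicalComplex.cyclesMap φ.hom 0 := by
      refine (cancel_mono ((resolution Y).obj.iCycles 0)).1 ?_
      rw [Category.assoc, Category.assoc, HomologicalComplex.cyclesMap_i]
      refine (congr(f ≫ $(hz Y))).trans (hφ.symm.trans ?_)
      exact (congr($((hz X).symm) ≫ _)).trans (Category.assoc _ _ _)
    have h₂ := InjectiveResolution.isoRightDerivedObj_inv_naturality f _ _ φ.hom hφ e (n + 1)
    have h₃ := α.hom.naturality φ
    exact comp_square (((G (n + 1)).map_comp _ _).symm.trans
      ((congr((G (n + 1)).map $h₁)).trans ((G (n + 1)).map_comp _ _)))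
      (comp_square h₃ h₂.symm)

end EffaceableDelta

end Universal

/-! ### Restricting a delta functor to a reflective subcategory -/

noncomputable section Restriction

theorem map_comm₁₂ {A B : Type*} [Category* A] [HasZeroMorphisms A] [Category* B] (e : A ⥤ B)
    {S S' : ShortComplex A} (φ : S ⟶ S') :
    e.map S.f ≫ e.map φ.τ₂ = e.map φ.τ₁ ≫ e.map S'.f := by
  rw [← Functor.map_comp, ← Functor.map_comp, φ.comm₁₂]

theorem isIso_map_unit_app {A B : Type*} [Category* A] [Category* B] {e : A ⥤ B} {a : B ⥤ A}
    (adj : a ⊣ e) [IsIso adj.counit] (X : B) : IsIso (a.map (adj.unit.app X)) := by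
  rw [(IsIso.eq_comp_inv _).2 (adj.left_triangle_components X), Category.id_comp]
  infer_instance

/-- A functor that inverts the maps inverted by a reflection `a` factors through `a`. -/
def localizedIso {A B D : Type*} [Category* A] [Category* B] [Category* D] {e : A ⥤ B}
    {a : B ⥤ A} (adj : a ⊣ e) [IsIso adj.counit] (H : B ⥤ D)
    (hH : ∀ ⦃X Y : B⦄ (f : X ⟶ Y), IsIso (a.map f) → IsIso (H.map f)) :
    H ≅ a ⋙ e ⋙ H :=
  have (X : B) : IsIso ((Functor.whiskerRight adj.unit H).app X) := hH _ (isIso_map_unit_app adj X)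
  have := NatIso.isIso_of_isIso_app (Functor.whiskerRight adj.unit H)
  asIso (Functor.whiskerRight adj.unit H)

variable {A : Type*} [Category* A] [Abelian A] {B : Type*} [Category* B] [Abelian B]
  (e : A ⥤ B)

/-- The short complex that starts with the image under `e` of the first map of a short complex
and goes on with its cokernel. -/
abbrev cokernelSC (S : ShortComplex A) : ShortComplex B :=
  ShortComplex.mk (e.map S.f) (cokernel.π (e.map S.f)) (cokernel.condition _)

theorem cokernelSC_shortExact [PreservesFiniteLimits e] {S : ShortComplex A} (hS : S.ShortExact) :
    (cokernelSC e S).ShortExact :=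
  have := hS.mono_f
  { exact := ShortComplex.exact_cokernel _ }

variable [e.Additive]

/-- The comparison map from the cokernel of `e.map S.f` to `e.obj S.X₃`. -/
abbrev cokernelSCDesc (S : ShortComplex A) : cokernel (e.map S.f) ⟶ e.obj S.X₃ :=
  cokernel.desc _ (e.map S.g) (by rw [← Functor.map_comp, S.zero, Functor.map_zero])

/-- The map of cokernels induced by a map of short complexes. -/
abbrev cokernelSCMapRight {S S' : ShortComplex A} (φ : S ⟶ S') :
    cokernel (e.map S.f) ⟶ cokernel (e.map S'.f) :=
  cokernel.map _ _ (e.map φ.τ₁) (e.map φ.τ₂) (map_comm₁₂ e φ)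

/-- The functoriality of `cokernelSC`. -/
abbrev cokernelSCMap {S S' : ShortComplex A} (φ : S ⟶ S') : cokernelSC e S ⟶ cokernelSC e S' :=
  ShortComplex.homMk (e.map φ.τ₁) (e.map φ.τ₂) (cokernelSCMapRight e φ) (map_comm₁₂ e φ).symm
    (cokernel.π_desc _ _ _).symm

theorem cokernelSCDesc_naturality {S S' : ShortComplex A} (φ : S ⟶ S') :
    cokernelSCDesc e S ≫ e.map φ.τ₃ = cokernelSCMapRight e φ ≫ cokernelSCDesc e S' := by
  apply coequalizer.hom_ext
  simp [← Functor.map_comp, φ.comm₂₃]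

variable {e} {a : B ⥤ A}

/-- For sheaves: the presheaf cokernel embeds into the third term by left exactness of `e`. It
becomes everything after sheafification, because `a(e(S.g))` is `S.g` up to the counit and hence
epi. -/
theorem isIso_map_cokernelSCDesc (adj : a ⊣ e) [IsIso adj.counit] [PreservesFiniteLimits a]
    [PreservesFiniteLimits e] {S : ShortComplex A} (hS : S.ShortExact) :
    IsIso (a.map (cokernelSCDesc e S)) := by
  have : Mono (cokernelSCDesc e S) := by
    have := hS.mono_f
    exact (S.map e).exact_iff_mono_cokernel_desc.1
      (hS.exact.map_of_mono_of_preservesKernel e inferInstance inferInstance)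
  have : Epi (a.map (cokernelSCDesc e S)) := by
    have := hS.epi_g
    have h : a.map (e.map S.g) = _ := (IsIso.eq_comp_inv _).2 (adj.counit.naturality S.g)
    have : Epi (a.map (e.map S.g)) := by
      rw [h]
      infer_instance
    have : a.map (cokernel.π (e.map S.f)) ≫ a.map (cokernelSCDesc e S) = a.map (e.map S.g) := by
      rw [← Functor.map_comp, cokernel.π_desc]
    exact epi_of_epi_fac this
  exact isIso_of_mono_of_epi _

variable {D : Type*} [Category* D] [Abelian D] {G : ℕ → B ⥤ D}

/-- A sequence of functors with connecting maps that inverts the maps inverted by an exact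
reflection restricts to an effaceable sequence on the reflective subcategory, if it is effaced by
the injective objects of the latter. -/
def effaceableDeltaOfReflection (adj : a ⊣ e) [IsIso adj.counit] [PreservesFiniteLimits a]
    [PreservesFiniteLimits e]
    (hG : ∀ ⦃X Y : B⦄ (f : X ⟶ Y), IsIso (a.map f) → ∀ n, IsIso ((G n).map f))
    (δ : ∀ {S : ShortComplex B} (_ : S.ShortExact) (n : ℕ),
      (G n).obj S.X₃ ⟶ (G (n + 1)).obj S.X₁)
    (δ_naturality : ∀ {S S' : ShortComplex B} (hS : S.ShortExact) (hS' : S'.ShortExact)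
      (φ : S ⟶ S') (n : ℕ), (G n).map φ.τ₃ ≫ δ hS' n = δ hS n ≫ (G (n + 1)).map φ.τ₁)
    (exact₃ : ∀ {S : ShortComplex B} (hS : S.ShortExact) (n : ℕ),
      ∃ w : (G n).map S.g ≫ δ hS n = 0, (ShortComplex.mk _ _ w).Exact)
    (exact₁ : ∀ {S : ShortComplex B} (hS : S.ShortExact) (n : ℕ),
      ∃ w : δ hS n ≫ (G (n + 1)).map S.f = 0, (ShortComplex.mk _ _ w).Exact)
    (isZero_injective : ∀ (J : A) [Injective J] (n : ℕ), IsZero ((G (n + 1)).obj (e.obj J))) :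
    EffaceableDelta (fun n => e ⋙ G n) where
  -- A short exact sequence in `A` is only left exact in `B`. The connecting map is that of its
  -- completion by the cokernel in `B`; the comparison from this cokernel to `e.obj S.X₃` is
  -- inverted by `a`, hence by `G n`.
  δ {S} hS n :=
    have := hG _ (isIso_map_cokernelSCDesc adj hS) n
    inv ((G n).map (cokernelSCDesc e S)) ≫ δ (cokernelSC_shortExact e hS) n
  δ_naturality {S S'} hS hS' φ n := by
    have := hG _ (isIso_map_cokernelSCDesc adj hS) n
    have := hG _ (isIso_map_cokernelSCDesc adj hS') n
    have h := congr((G n).map $(cokernelSCDesc_naturality e φ))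
    rw [Functor.map_comp, Functor.map_comp, ← IsIso.eq_inv_comp] at h
    refine comp_square ?_ (δ_naturality (cokernelSC_shortExact e hS) (cokernelSC_shortExact e hS')
      (cokernelSCMap e φ) n)
    rw [IsIso.comp_inv_eq, Category.assoc]
    exact h
  exact₃ {S} hS n := by
    have := hG _ (isIso_map_cokernelSCDesc adj hS) n
    obtain ⟨w, h⟩ := exact₃ (cokernelSC_shortExact e hS) n
    have e' : (G n).map (e.map S.g) ≫ inv ((G n).map (cokernelSCDesc e S)) =
        (G n).map (cokernel.π (e.map S.f)) := by
      rw [IsIso.comp_inv_eq, ← Functor.map_comp, cokernel.π_desc]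
    exact ⟨(Category.assoc _ _ _).symm.trans ((congr($e' ≫ _)).trans w),
      exact_of_isIso_comp e' w h⟩
  exact₁ {S} hS n := by
    have := hG _ (isIso_map_cokernelSCDesc adj hS) n
    obtain ⟨w, h⟩ := exact₁ (cokernelSC_shortExact e hS) n
    exact ⟨(Category.assoc _ _ _).trans ((congr(_ ≫ $w)).trans comp_zero),
      exact_of_isIso_comp_left h⟩
  isZero_injective J _ n := isZero_injective J n

end Restriction

/-! ### Comparison with the derived functors of the embedding of sheaves -/

noncomputable section Comparison

variable {I : Type w} [SmallCategory I] (F : MorphismProperty I)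
  [F.IsMultiplicative] [F.HasPullbacks] [F.IsStableUnderBaseChange]
  (E : Type u) [Category.{w} E] [Abelian E] [IsLocallyFinitelyPresentable.{w} E]

/-- The Dold-derived functors form an effaceable sequence on sheaves. -/
def sheafDoldDelta :
    EffaceableDelta (fun n => sheafToPresheaf (topology F) E ⋙ doldDerived F E n) :=
  effaceableDeltaOfReflection (sheafificationAdjunction (topology F) E)
    (fun _ _ f hf n => isIso_doldDerived_map F f hf n) (fun hS n => doldδ F hS n)
    (fun hS hS' φ n => doldδ_naturality hS hS' φ n) (fun hS n => dold_exact₃ hS n)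
    (fun hS n => dold_exact₁ hS n) (fun J _ n => isZero_doldDerived_injective J n)

/-- `D^n(P)` depends only on the sheaf associated with `P`. -/
def doldSheafifyIso (n : ℕ) : doldDerived F E n ≅
    presheafToSheaf (topology F) E ⋙ sheafToPresheaf (topology F) E ⋙ doldDerived F E n :=
  localizedIso (sheafificationAdjunction (topology F) E) _
    (fun _ _ f hf => isIso_doldDerived_map F f hf n)

end Comparison
end HyperDold

theorem mainTheorem3 {I : Type w} [SmallCategory I] (F : MorphismProperty I)
    [F.IsMultiplicative] [F.HasPullbacks] [F.IsStableUnderBaseChange]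
    (E : Type u) [Category.{w} E] [Abelian E] [IsLocallyFinitelyPresentable.{w} E] (n : ℕ) :
    Nonempty (HyperDold.doldDerived F E n ≅
      presheafToSheaf (HyperDold.topology F) E ⋙
        (sheafToPresheaf (HyperDold.topology F) E).rightDerived n) := by
  obtain ⟨α⟩ := (HyperDold.sheafDoldDelta F E).nonempty_iso_rightDerived HyperDold.doldZeroIso n
  exact ⟨HyperDold.doldSheafifyIso F E n ≪≫ Functor.isoWhiskerLeft _ α⟩
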